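/- For $x\neq 0$ and $\eta\in\mathbb Z/2\mathbb Z$ let $(\operatorname{sg}x)^\eta\in\{\pm1\}$ denote the corresponding power of the sign of $x$, and write $e(t)=e^{2\pi i t}$. A function $g$ on $\mathbb R\setminus\{0\}$ has a singularity of type $(\beta,\delta)\in\mathbb C\times\mathbb Z/2\mathbb Z$ at $0$ if there are $n\ge 0$ and complex-valued $C^\infty$ functions $g_0,\dots,g_n$ defined near $0$ such that $g(x)=\sum_{0\le j\le n}(\operatorname{sg}x)^\delta|x|^\beta(\log|x|)^j g_j(x)$ for all sufficiently small $x\ne 0$. Let $\mathcal S_{\mathrm{sis}}(\mathbb R)$ be the space of functions $f\in C^\infty(\mathbb R\setminus\{0\})$, with complex values, which near $0$ are finite sums of functions each having a singularity of some type at $0$, and which decay rapidly, along with all their derivatives, as $|x|\to\infty$. A distribution on $\mathbb R$ vanishes to order $k\geq 0$ at $0$ if near $0$ it is a finite sum of terms $a\,x^{k+n}\frac{d^n}{dx^n}h$ with $n\ge 0$, $a$ smooth and $h\in L^\infty$; a function $F\in L^1_{\mathrm{loc}}(\mathbb R\setminus\{0\})$ has $\sigma$ as canonical extension across $0$ if the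 distribution $\sigma$ on $\mathbb R$ agrees with $F$ on $\mathbb R\setminus\{0\}$ and vanishes to order $k$ at $0$ for every $k\ge 0$. Let $\alpha\in\mathbb C$ and $\eta\in\mathbb Z/2\mathbb Z$. For $f\in\mathcal S_{\mathrm{sis}}(\mathbb R)$ and $y\ne 0$ define $$T_{\alpha,\eta}f(y)=\mathcal F\bigl(x\mapsto f(1/x)(\operatorname{sg}x)^\eta|x|^{-\alpha-1}\bigr)(y)=\int_{\mathbb R} f(1/x)\,(\operatorname{sg}x)^\eta\,|x|^{-\alpha-1}\,e(-xy)\,dx ,$$ where, $G(x)$ being the integrand, the integral is understood as $\sigma(\varphi)+\int_{\mathbb R}(1-\varphi(1/x))\,G(x)\,dx$; here $\sigma$ is the canonical extension across $0$ of $u\mapsto u^{-2}G(1/u)$, and $\varphi$ is any real-valued function in $C_c^\infty(\mathbb R)$ that is equal to $1$ near $0$. Then $T_{\alpha,\eta}f(y)$ is well defined for all $f\in\mathcal S_{\mathrm{sis}}(\mathbb R)$ and $y\neq 0$ (the canonical extension exists and the value is independent of the choices), and $T_{\alpha,\eta}$ maps $\mathcal S_{\mathrm{sis}}(\mathbb R)$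 to itself. -/

import Mathlib

open scoped ContDiff Distributions Topology

noncomputable section

namespace Sis

/-- `(sg x)^η` for `η ∈ ℤ/2ℤ`. -/
def sgPow (η : ZMod 2) (x : ℝ) : ℂ := ((Real.sign x : ℝ) : ℂ) ^ η.val

/-! ### The space of functions with simple singularities

A function on `ℝ ∖ {0}` is represented by a function `ℝ → ℂ`, whose value at `0` is irrelevant. -/

/-- `f` has a singularity of type `(α, η)` at `0`. -/
def HasSingularityOfType (α : ℂ) (η : ZMod 2) (f : ℝ → ℂ) : Prop :=
  ∃ ε : ℝ, 0 < ε ∧ ∃ (n : ℕ) (c : ℕ → ℝ → ℂ),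
    (∀ j ≤ n, ContDiffOn ℝ ∞ (c j) (Set.Ioo (-ε) ε)) ∧
    ∀ x : ℝ, 0 < |x| → |x| < ε →
      f x = ∑ j ∈ Finset.range (n + 1),
        sgPow η x * ((|x| : ℝ) : ℂ) ^ α * ((Real.log |x| : ℝ) : ℂ) ^ j * c j x

/-- Near `0`, `f` is a finite sum of functions which have a singularity of some type. -/
def HasSimpleSingularity (f : ℝ → ℂ) : Prop :=
  ∃ (m : ℕ) (α : Fin m → ℂ) (η : Fin m → ZMod 2) (g : Fin m → ℝ → ℂ),
    (∀ j, HasSingularityOfType (α j) (η j) (g j)) ∧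
    ∃ ε : ℝ, 0 < ε ∧ ∀ x : ℝ, 0 < |x| → |x| < ε → f x = ∑ j, g j x

/-- `f` and all its derivatives decay rapidly as `|x| → ∞`. -/
def DecaysRapidly (f : ℝ → ℂ) : Prop :=
  ∀ k N : ℕ, ∃ C : ℝ, ∀ x : ℝ, 1 ≤ |x| → |x| ^ N * ‖iteratedDeriv k f x‖ ≤ C

/-- The space `S_sis(ℝ)`. -/
def Ssis : Set (ℝ → ℂ) :=
  {f | ContDiffOn ℝ ∞ f {0}ᶜ ∧ HasSimpleSingularity f ∧ DecaysRapidly f}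

/-! ### Distributions vanishing to infinite order, canonical extensions -/

/-- The distribution `σ` on `ℝ` vanishes to order `k` at `0`: on a neighborhood `(-ε, ε)` of `0` it
is a finite sum of terms `f D h` with `h` bounded measurable, `f = x ^ k b` smooth and vanishing to
order `k` at `0`, and `D` a differential operator tangential to `{0}`. Such operators are the finite
sums of operators `a xⁿ dⁿ/dxⁿ` with `a` smooth; splitting these sums and absorbing `a` into `b`,
one may take `D = xⁿ dⁿ/dxⁿ`. The derivatives are moved to the test function. -/
def VanishesToOrder (k : ℕ) (σ : 𝓓'((⊤ : TopologicalSpace.Opens ℝ), ℂ)) : Prop :=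
  ∃ ε : ℝ, 0 < ε ∧ ∃ (N : ℕ) (n : Fin N → ℕ) (b h : Fin N → ℝ → ℂ),
    (∀ l, ContDiffOn ℝ ∞ (b l) (Set.Ioo (-ε) ε)) ∧
    (∀ l, MeasureTheory.MemLp (h l) ⊤ (MeasureTheory.volume.restrict (Set.Ioo (-ε) ε))) ∧
    ∀ φ : 𝓓((⊤ : TopologicalSpace.Opens ℝ), ℝ), tsupport φ ⊆ Set.Ioo (-ε) ε →
      σ φ = ∑ l, (-1 : ℂ) ^ n l *
        ∫ x : ℝ, h l x *
          iteratedDeriv (n l) (fun t : ℝ => (t : ℂ) ^ (k + n l) * b l t * ((φ t : ℝ) : ℂ)) x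

/-- `σ` is the canonical extension across `0` of the locally integrable function `F` on
`ℝ ∖ {0}`: it agrees with `F` there, and vanishes to infinite order at `0`. -/
def IsCanonicalExtension (F : ℝ → ℂ) (σ : 𝓓'((⊤ : TopologicalSpace.Opens ℝ), ℂ)) : Prop :=
  MeasureTheory.LocallyIntegrableOn F {0}ᶜ ∧
  (∀ φ : 𝓓((⊤ : TopologicalSpace.Opens ℝ), ℝ), (0 : ℝ) ∉ tsupport φ →
    σ φ = ∫ u : ℝ, F u * ((φ u : ℝ) : ℂ)) ∧
  ∀ k : ℕ, VanishesToOrder k σ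

/-- `c` is the integral of `G x dx` over `ℝ ∪ {∞}`, where near `∞` the density `G x dx` is replaced
by its canonical extension across `∞`. In the coordinate `u = 1 / x` this density is
`u⁻² G(1/u) du`, and `φ(1/x)`, with `φ` a test function equal to `1` near `0`, cuts off to a
neighborhood of `∞`. -/
def HasCanonicalIntegral (G : ℝ → ℂ) (c : ℂ) : Prop :=
  ∃ σ : 𝓓'((⊤ : TopologicalSpace.Opens ℝ), ℂ),
    IsCanonicalExtension (fun u : ℝ => ((u : ℂ) ^ 2)⁻¹ * G (1 / u)) σ ∧
    ∀ φ : 𝓓((⊤ : TopologicalSpace.Opens ℝ), ℝ), (∀ᶠ u in 𝓝 (0 : ℝ), φ u = 1) →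
      MeasureTheory.Integrable (fun x : ℝ => (1 - ((φ (1 / x) : ℝ) : ℂ)) * G x) ∧
      c = σ φ + ∫ x : ℝ, (1 - ((φ (1 / x) : ℝ) : ℂ)) * G x

/-! ### The operators -/

/-- The integrand `f(1/x) (sg x)^η |x|^(-α-1) e(-xy)`, with `e(t) = exp(2πit)`. -/
def integrand (α : ℂ) (η : ZMod 2) (f : ℝ → ℂ) (y x : ℝ) : ℂ :=
  f (1 / x) * sgPow η x * ((|x| : ℝ) : ℂ) ^ (-α - 1) *
    Complex.exp (-(2 * Real.pi * Complex.I * x * y))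

/-- `T_{α,η} f (y)`, for `y ≠ 0`: the value at `y` of the Fourier transform of
`x ↦ f(1/x) (sg x)^η |x|^(-α-1)`. That there is exactly one number which satisfies the defining
condition is not part of this definition. -/
def T (α : ℂ) (η : ZMod 2) (f : ℝ → ℂ) (y : ℝ) : ℂ :=
  Classical.epsilon fun c : ℂ => HasCanonicalIntegral (integrand α η f y) c

end Sis

end

namespace Sis

open Filter Asymptotics Bornology MeasureTheory
open scoped FourierTransform

local notation "𝓣" => 𝓓((⊤ : TopologicalSpace.Opens ℝ), ℝ)

/-! ### Signed powers with logarithms -/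

/-! Put `G(x) = (sg x)^η |x|^(-α-1) f(1/x)`, which is `Kf (α + 1) η 0 f`. Inversion exchanges the
two ends of the line. Rapid decay of `f` at infinity makes `G` smooth and flat at `0`, and the
singularity of `f` at `0` makes `G`, near infinity, a finite sum of terms `(sg x)^δ |x|^(-β) (log
|x|)^j c(1/x)` with `c` smooth. So `G` is a symbol: each derivative lowers its order of growth by
one. The natural value of its Fourier transform at `y ≠ 0` is `(2πiy)^(-N) 𝓕(G^(N))(y)`, which is
independent of `N` once `N` is large (`regFourier`, `IsSymbol.regFourier_eq`).

This value is the canonical integral (`IsSymbol.hasCanonicalIntegral`). The distribution `σ(φ)` is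
the regularized transform of `G(x) φ(1/x)`. In the coordinate `u = 1/x` it is a sum of integrals of
`H_j φ^(j)`, and for `N` large the `H_j` vanish at `0` to order `k + j`, with `k` arbitrary; this is
vanishing to order `k`. The extension is determined because a distribution vanishing to order `0`
tends to `0` on the cutoffs `χ(su)` as `s → ∞`: the operators `dⁿ/duⁿ uⁿ` are scale invariant and
dominated convergence applies (`tendsto_scaledCutoff_of_vanishesToOrder`).

It remains to see that the regularized transform lies in `S_sis` (`IsTame.mem_Ssis`). The factor
`y^(-N)` gives decay, and integrability of `xⁿ G^(N)` gives smoothness off `0`. For the singularity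
at `0`, integration by parts shows that `𝓕(Kf β δ j c)` solves a first order equation `y u' = (β -
1) u + v`, whose source involves `j - 1` and `u d/du c`. If `c` is a cutoff, the latter contribution
is smooth and induction on `j` gives `|y|^(β-1)` times powers of `log |y|`, plus a smooth function
(`logForm_fourier_Kf_cutoff`). A general `c` is Taylor expanded; the coefficients are summed by the
Borel lemma, and what is left over is `C^n` for every `n`, hence smooth (`fourier_Kf_eq`). -/

lemma sgPow_of_pos (δ : ZMod 2) {x : ℝ} (hx : 0 < x) : sgPow δ x = 1 := by
  simp [sgPow, Real.sign_of_pos hx]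

lemma sgPow_zero_left (x : ℝ) : sgPow 0 x = 1 := by
  simp [sgPow]

lemma sgPow_one_of_neg {x : ℝ} (hx : x < 0) : sgPow 1 x = -1 := by
  simp [sgPow, Real.sign_of_neg hx, ZMod.val_one]

lemma ZMod.two_cases (δ : ZMod 2) : δ = 0 ∨ δ = 1 := by
  revert δ; decide

lemma sgPow_mul_sgPow (δ δ' : ZMod 2) {x : ℝ} (hx : x ≠ 0) :
    sgPow δ x * sgPow δ' x = sgPow (δ + δ') x := by
  rcases lt_or_gt_of_ne hx with h | h
  · rcases ZMod.two_cases δ with rfl | rfl <;> rcases ZMod.two_cases δ' with rfl | rfl <;>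
      simp [sgPow_zero_left, sgPow_one_of_neg h, show (1 : ZMod 2) + 1 = 0 from rfl]
  · simp [sgPow_of_pos _ h]

lemma sgPow_inv (δ : ZMod 2) (x : ℝ) : sgPow δ x⁻¹ = sgPow δ x := by
  simp [sgPow, Real.sign_inv]

lemma norm_sgPow (δ : ZMod 2) {x : ℝ} (hx : x ≠ 0) : ‖sgPow δ x‖ = 1 := by
  rcases lt_or_gt_of_ne hx with h | h
  · rcases ZMod.two_cases δ with rfl | rfl <;> simp [sgPow_zero_left, sgPow_one_of_neg h]
  · simp [sgPow_of_pos _ h]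

lemma sgPow_eventually_eq (δ : ZMod 2) {x : ℝ} (hx : x ≠ 0) :
    ∀ᶠ z in 𝓝 x, sgPow δ z = sgPow δ x := by
  rcases lt_or_gt_of_ne hx with h | h
  · filter_upwards [Iio_mem_nhds h] with z hz
    simp [sgPow, Real.sign_of_neg h, Real.sign_of_neg (show z < 0 from hz)]
  · filter_upwards [Ioi_mem_nhds h] with z hz
    rw [sgPow_of_pos _ h, sgPow_of_pos _ hz]

lemma sgPow_one_mul_abs (x : ℝ) : sgPow 1 x * ((|x| : ℝ) : ℂ) = x := by
  rcases lt_trichotomy x 0 with h | h | h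
  · simp [sgPow_one_of_neg h, abs_of_neg h]
  · simp [h]
  · simp [sgPow_of_pos _ h, abs_of_pos h]

/-- The function `(sg x)^δ |x|^γ (log |x|)^i`, extended by `0` to `x = 0`. -/
noncomputable def pw (γ : ℂ) (δ : ZMod 2) (i : ℕ) (x : ℝ) : ℂ :=
  if x = 0 then 0 else sgPow δ x * ((|x| : ℝ) : ℂ) ^ γ * ((Real.log |x| : ℝ) : ℂ) ^ i

@[simp] lemma pw_zero (γ : ℂ) (δ : ZMod 2) (i : ℕ) : pw γ δ i 0 = 0 := by simp [pw]

lemma pw_of_ne (γ : ℂ) (δ : ZMod 2) (i : ℕ) {x : ℝ} (hx : x ≠ 0) :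
    pw γ δ i x = sgPow δ x * ((|x| : ℝ) : ℂ) ^ γ * ((Real.log |x| : ℝ) : ℂ) ^ i := by
  simp [pw, hx]

lemma ofReal_abs_ne_zero {x : ℝ} (hx : x ≠ 0) : ((|x| : ℝ) : ℂ) ≠ 0 := by
  simpa using hx

lemma pw_mul_pw (γ γ' : ℂ) (δ δ' : ZMod 2) (i i' : ℕ) (x : ℝ) :
    pw γ δ i x * pw γ' δ' i' x = pw (γ + γ') (δ + δ') (i + i') x := by
  by_cases hx : x = 0
  · simp [hx]
  · rw [pw_of_ne _ _ _ hx, pw_of_ne _ _ _ hx, pw_of_ne _ _ _ hx, ← sgPow_mul_sgPow _ _ hx,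
      Complex.cpow_add _ _ (ofReal_abs_ne_zero hx), pow_add]
    ring

lemma pw_natCast (m : ℕ) {x : ℝ} (hx : x ≠ 0) : pw m m 0 x = (x : ℂ) ^ m := by
  induction m with
  | zero => simp [pw_of_ne _ _ _ hx, sgPow_zero_left]
  | succ m ih =>
    have h1 : pw 1 1 0 x = x := by
      rw [pw_of_ne _ _ _ hx]; simp [sgPow_one_mul_abs]
    have := pw_mul_pw m 1 m 1 0 0 x
    rw [ih, h1] at this
    rw [pow_succ, this]
    push_cast
    simp

lemma pw_mul_pow (γ : ℂ) (δ : ZMod 2) (i m : ℕ) (x : ℝ) :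
    pw γ δ i x * (x : ℂ) ^ m = pw (γ + m) (δ + m) i x := by
  by_cases hx : x = 0
  · simp [hx]
  · rw [← pw_natCast m hx, pw_mul_pw]; simp

lemma ZMod.two_add_cancel (δ δ' : ZMod 2) : δ + δ' + δ' = δ := by
  revert δ δ'; decide

lemma pw_div_pow (γ : ℂ) (δ : ZMod 2) (i m : ℕ) (x : ℝ) :
    pw γ δ i x * ((x : ℂ) ^ m)⁻¹ = pw (γ - m) (δ + m) i x := by
  by_cases hx : x = 0
  · simp [hx]
  · rw [mul_inv_eq_iff_eq_mul₀ (pow_ne_zero _ (by exact_mod_cast hx)), pw_mul_pow]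
    simp [ZMod.two_add_cancel]

lemma pw_inv (γ : ℂ) (δ : ZMod 2) (i : ℕ) (x : ℝ) :
    pw γ δ i x⁻¹ = (-1) ^ i * pw (-γ) δ i x := by
  by_cases hx : x = 0
  · simp [hx]
  · rw [pw_of_ne _ _ _ hx, pw_of_ne _ _ _ (inv_ne_zero hx), sgPow_inv, abs_inv, Real.log_inv,
      Complex.ofReal_inv, Complex.inv_cpow _ _
        (by rw [Complex.arg_ofReal_of_nonneg (abs_nonneg x)]; exact Real.pi_pos.ne),
      Complex.cpow_neg, Complex.ofReal_neg, neg_pow]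
    ring

lemma norm_pw (γ : ℂ) (δ : ZMod 2) (i : ℕ) {x : ℝ} (hx : x ≠ 0) :
    ‖pw γ δ i x‖ = |x| ^ γ.re * |Real.log x| ^ i := by
  rw [pw_of_ne _ _ _ hx, norm_mul, norm_mul, norm_sgPow _ hx, one_mul,
    Complex.norm_cpow_eq_rpow_re_of_pos (abs_pos.2 hx), norm_pow, Complex.norm_real,
    Real.norm_eq_abs, Real.log_abs]

lemma hasDerivAt_ofReal_log_abs {x : ℝ} (hx : x ≠ 0) :
    HasDerivAt (fun z : ℝ => ((Real.log |z| : ℝ) : ℂ)) ((x : ℂ)⁻¹) x := by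
  simp_rw [Real.log_abs]
  simpa using (Real.hasDerivAt_log hx).ofReal_comp

lemma pw_eventually_eq (γ : ℂ) (δ : ZMod 2) (i : ℕ) {x : ℝ} (hx : x ≠ 0) :
    pw γ δ i =ᶠ[𝓝 x] fun z => sgPow δ x * Complex.exp (((Real.log |z| : ℝ) : ℂ) * γ) *
      ((Real.log |z| : ℝ) : ℂ) ^ i := by
  filter_upwards [sgPow_eventually_eq δ hx, isOpen_ne.mem_nhds hx] with z hz hz0
  rw [pw_of_ne _ _ _ hz0, hz, Complex.cpow_def_of_ne_zero (ofReal_abs_ne_zero hz0),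
    Complex.ofReal_log (abs_nonneg z)]

lemma contDiffAt_pw (γ : ℂ) (δ : ZMod 2) (i : ℕ) {x : ℝ} (hx : x ≠ 0) {n : WithTop ℕ∞} :
    ContDiffAt ℝ n (pw γ δ i) x := by
  refine ContDiffAt.congr_of_eventuallyEq ?_ (pw_eventually_eq γ δ i hx)
  have h : ContDiffAt ℝ n (fun z : ℝ => ((Real.log |z| : ℝ) : ℂ)) x := by
    simp_rw [Real.log_abs]
    exact Complex.ofRealCLM.contDiff.contDiffAt.comp x (Real.contDiffAt_log.2 hx)
  exact (contDiffAt_const.mul (h.mul contDiffAt_const).cexp).mul (h.pow i)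

lemma hasDerivAt_pw (γ : ℂ) (δ : ZMod 2) (i : ℕ) {x : ℝ} (hx : x ≠ 0) :
    HasDerivAt (pw γ δ i)
      (γ * pw (γ - 1) (δ + 1) i x + i * pw (γ - 1) (δ + 1) (i - 1) x) x := by
  refine HasDerivAt.congr_of_eventuallyEq ?_ (pw_eventually_eq γ δ i hx)
  have hl := hasDerivAt_ofReal_log_abs hx
  have h := (((hl.mul_const γ).cexp).const_mul (sgPow δ x)).mul (hl.pow i)
  refine h.congr_deriv ?_
  have e (k : ℕ) : pw (γ - 1) (δ + 1) k x = pw γ δ k x * (x : ℂ)⁻¹ := by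
    have := pw_div_pow γ δ k 1 x
    simpa using this.symm
  have e' (k : ℕ) : pw γ δ k x = sgPow δ x * Complex.exp (((Real.log |x| : ℝ) : ℂ) * γ) *
      ((Real.log |x| : ℝ) : ℂ) ^ k := (pw_eventually_eq γ δ k hx).self_of_nhds
  rw [e, e, e', e', Pi.pow_apply]
  ring

/-- The strict inequality leaves a positive power of `|x|` to absorb the logarithms. -/
lemma pw_isBigO_cobounded {γ : ℂ} (δ : ZMod 2) (i : ℕ) {a : ℝ} (ha : γ.re < a) :
    pw γ δ i =O[cobounded ℝ] fun x => |x| ^ a := by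
  have h1 : (fun t : ℝ => t ^ γ.re * |Real.log t| ^ i) =O[atTop] fun t : ℝ => t ^ a := by
    have h2 := (isLittleO_log_rpow_rpow_atTop (i : ℝ) (sub_pos.2 ha)).isBigO
    have h3 := (isBigO_refl (fun t : ℝ => t ^ γ.re) atTop).mul h2
    refine IsBigO.congr' (h3.norm_left) ?_ ?_
    · filter_upwards [eventually_ge_atTop 1] with t ht
      simp [abs_of_nonneg (Real.rpow_nonneg (zero_le_one.trans ht) _)]
    · filter_upwards [eventually_gt_atTop 0] with t ht
      rw [← Real.rpow_add ht]; congr 1; ring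
  have h4 := h1.comp_tendsto (tendsto_norm_cobounded_atTop (E := ℝ))
  refine IsBigO.of_norm_left (h4.congr' ?_ ?_)
  · filter_upwards [eventually_ne_cobounded (0 : ℝ)] with x hx
    simp [norm_pw _ _ _ hx]
  · exact Eventually.of_forall fun x => by simp

lemma pw_isBigO_nhdsNE {γ : ℂ} (δ : ZMod 2) (i : ℕ) {a : ℝ} (ha : a < γ.re) :
    pw γ δ i =O[𝓝[≠] 0] fun x => |x| ^ a := by
  have h := (pw_isBigO_cobounded (γ := -γ) δ i (a := -a) (by simpa using ha)).comp_tendsto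
    (tendsto_inv₀_nhdsNE_zero (α := ℝ))
  refine (IsBigO.const_mul_left h ((-1) ^ i)).congr' ?_ ?_
  · refine Eventually.of_forall fun x => ?_
    simp only [Function.comp, pw_inv, neg_neg]
    rw [← mul_assoc, ← mul_pow]; simp
  · refine Eventually.of_forall fun x => ?_
    simp only [Function.comp, abs_inv]
    rw [Real.inv_rpow (abs_nonneg _), Real.rpow_neg (abs_nonneg _), inv_inv]

/-! ### Rapidly decaying functions -/

/-- `c` is smooth off `0`, and decays rapidly at infinity with all its derivatives. -/
structure RapidDecay (c : ℝ → ℂ) : Prop where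
  smooth : ContDiffOn ℝ ∞ c {0}ᶜ
  decay : ∀ k N : ℕ, iteratedDeriv k c =O[cobounded ℝ] fun x => |x| ^ (-(N : ℝ))

/-- The Euler operator `u d/du`. -/
noncomputable def euler (c : ℝ → ℂ) (u : ℝ) : ℂ := u * deriv c u

lemma eventually_one_le_abs_cobounded : ∀ᶠ x : ℝ in cobounded ℝ, 1 ≤ |x| := by
  filter_upwards [tendsto_norm_cobounded_atTop.eventually (eventually_ge_atTop (1 : ℝ))] with x hx
  simpa using hx

lemma eventually_nhds_ne {x : ℝ} (hx : x ≠ 0) : ∀ᶠ z in 𝓝 x, z ≠ 0 := isOpen_ne.mem_nhds hx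

lemma contDiffAt_of_contDiffOn_compl {c : ℝ → ℂ} (hc : ContDiffOn ℝ ∞ c {0}ᶜ) {x : ℝ}
    (hx : x ≠ 0) : ContDiffAt ℝ ∞ c x :=
  hc.contDiffAt (isOpen_compl_singleton.mem_nhds hx)

lemma RapidDecay.deriv {c : ℝ → ℂ} (hc : RapidDecay c) : RapidDecay (deriv c) where
  smooth := ((contDiffOn_infty_iff_deriv_of_isOpen isOpen_compl_singleton).1 hc.smooth).2
  decay k N := by
    rw [← iteratedDeriv_succ']
    exact hc.decay (k + 1) N

lemma contDiff_ofReal {n : WithTop ℕ∞} : ContDiff ℝ n (fun u : ℝ => (u : ℂ)) :=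
  Complex.ofRealCLM.contDiff

lemma deriv_ofReal : deriv (fun u : ℝ => (u : ℂ)) = fun _ => 1 := by
  ext x; exact (Complex.ofRealCLM.hasDerivAt (x := x)).deriv

lemma iteratedDeriv_ofReal_isBigO (i : ℕ) :
    iteratedDeriv i (fun u : ℝ => (u : ℂ)) =O[cobounded ℝ] fun x => |x| := by
  rcases i with _ | i
  · simp only [iteratedDeriv_zero]
    exact IsBigO.of_bound 1 (Eventually.of_forall fun x => by simp)
  · rw [iteratedDeriv_succ', deriv_ofReal]
    refine IsBigO.of_bound 1 ?_
    filter_upwards [eventually_one_le_abs_cobounded] with x hx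
    rw [iteratedDeriv_const]
    split_ifs <;> simp [hx]

lemma RapidDecay.ofReal_mul {c : ℝ → ℂ} (hc : RapidDecay c) :
    RapidDecay (fun u : ℝ => (u : ℂ) * c u) where
  smooth := contDiff_ofReal.contDiffOn.mul hc.smooth
  decay k N := by
    have h : iteratedDeriv k (fun u : ℝ => (u : ℂ) * c u) =ᶠ[cobounded ℝ]
        fun x => ∑ i ∈ Finset.range (k + 1), (k.choose i : ℂ) *
          iteratedDeriv i (fun u : ℝ => (u : ℂ)) x * iteratedDeriv (k - i) c x := by
      filter_upwards [eventually_ne_cobounded (0 : ℝ)] with x hx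
      exact iteratedDeriv_fun_mul contDiff_ofReal.contDiffAt
        ((contDiffAt_of_contDiffOn_compl hc.smooth hx).of_le (by exact_mod_cast le_top))
    refine h.trans_isBigO (IsBigO.fun_sum fun i _ => ?_)
    refine (((iteratedDeriv_ofReal_isBigO i).const_mul_left _).mul
      (hc.decay (k - i) (N + 1))).congr' .rfl ?_
    filter_upwards [eventually_ne_cobounded (0 : ℝ)] with x hx
    have hx' := abs_pos.2 hx
    nth_rewrite 1 [← Real.rpow_one |x|]
    rw [← Real.rpow_add hx']
    congr 1; push_cast; ring

lemma RapidDecay.euler {c : ℝ → ℂ} (hc : RapidDecay c) : RapidDecay (euler c) :=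
  hc.deriv.ofReal_mul

lemma RapidDecay.of_decaysRapidly {c : ℝ → ℂ} (hc : ContDiffOn ℝ ∞ c {0}ᶜ)
    (hd : DecaysRapidly c) : RapidDecay c where
  smooth := hc
  decay k N := by
    obtain ⟨C, hC⟩ := hd k N
    refine IsBigO.of_bound C ?_
    filter_upwards [eventually_one_le_abs_cobounded] with x hx
    have hx' : 0 < |x| := by linarith
    have := hC x hx
    rw [Real.norm_of_nonneg (Real.rpow_nonneg hx'.le _), Real.rpow_neg hx'.le, Real.rpow_natCast,
      ← div_eq_mul_inv, le_div_iff₀ (by positivity)]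
    linarith

lemma eventually_cobounded_eq_zero {c : ℝ → ℂ} (hc : HasCompactSupport c) :
    ∀ᶠ x in cobounded ℝ, ∀ᶠ z in 𝓝 x, c z = 0 := by
  rw [Metric.cobounded_eq_cocompact]
  filter_upwards [hc.isCompact.compl_mem_cocompact] with x hx
  exact notMem_tsupport_iff_eventuallyEq.1 hx

lemma RapidDecay.of_hasCompactSupport {c : ℝ → ℂ} (hc : ContDiff ℝ ∞ c)
    (hs : HasCompactSupport c) : RapidDecay c where
  smooth := hc.contDiffOn
  decay k N := by
    refine IsBigO.of_bound 0 ?_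
    filter_upwards [eventually_cobounded_eq_zero hs] with x hx
    have : c =ᶠ[𝓝 x] fun _ => (0 : ℂ) := hx
    rw [this.iteratedDeriv_eq]
    simp

/-! ### The functions `pw (-β) δ j x * c (1 / x)` -/

/-- The function `(sg x)^δ |x|^(-β) (log |x|)^j c(1/x)`. -/
noncomputable def Kf (β : ℂ) (δ : ZMod 2) (j : ℕ) (c : ℝ → ℂ) (x : ℝ) : ℂ :=
  pw (-β) δ j x * c x⁻¹

@[simp] lemma Kf_zero (β : ℂ) (δ : ZMod 2) (j : ℕ) (c : ℝ → ℂ) : Kf β δ j c 0 = 0 := by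
  simp [Kf]

/-- The derivative of `Kf β δ j c`. -/
noncomputable def KfDeriv (β : ℂ) (δ : ZMod 2) (j : ℕ) (c : ℝ → ℂ) (x : ℝ) : ℂ :=
  -β * Kf (β + 1) (δ + 1) j c x + j * Kf (β + 1) (δ + 1) (j - 1) c x
    - Kf (β + 1) (δ + 1) j (euler c) x

lemma hasDerivAt_Kf_of_ne (β : ℂ) (δ : ZMod 2) (j : ℕ) {c : ℝ → ℂ}
    (hc : ContDiffOn ℝ ∞ c {0}ᶜ) {x : ℝ} (hx : x ≠ 0) :
    HasDerivAt (Kf β δ j c) (KfDeriv β δ j c x) x := by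
  have h1 := hasDerivAt_pw (-β) δ j hx
  have h2 : HasDerivAt c (deriv c x⁻¹) x⁻¹ :=
    ((contDiffAt_of_contDiffOn_compl hc (inv_ne_zero hx)).differentiableAt (by simp)).hasDerivAt
  have h3 := h2.scomp x (hasDerivAt_inv hx)
  refine (h1.mul h3).congr_deriv ?_
  have hx' : (x : ℂ) ≠ 0 := by exact_mod_cast hx
  have e : pw (-(β + 1)) (δ + 1) j x = pw (-β) δ j x * (x : ℂ)⁻¹ := by
    have := pw_div_pow (-β) δ j 1 x
    rw [show -(β + 1) = -β - (1 : ℕ) by push_cast; ring]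
    simpa using this.symm
  simp only [KfDeriv, Kf, euler, Function.comp, Complex.real_smul]
  rw [show -β - 1 = -(β + 1) by ring, e]
  push_cast
  field_simp
  ring

/-- Rapid decay of `c` at infinity turns into flatness at `0`. Order two is all that is needed for
the derivative at `0` to exist and vanish. -/
lemma Kf_isBigO_nhdsNE (β : ℂ) (δ : ZMod 2) (j : ℕ) {c : ℝ → ℂ} (hc : RapidDecay c) :
    Kf β δ j c =O[𝓝 0] fun x : ℝ => x ^ 2 := by
  -- The product has order `-Re β - 1 + N`, which must be at least `2`.
  obtain ⟨N, hN⟩ := exists_nat_ge (3 + β.re)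
  have h1 : pw (-β) δ j =O[𝓝[≠] 0] fun x => |x| ^ (-β.re - 1) :=
    pw_isBigO_nhdsNE δ j (by simp)
  have h2 := (hc.decay 0 N).comp_tendsto (tendsto_inv₀_nhdsNE_zero (α := ℝ))
  have h3 := h1.mul h2
  have h4 : Kf β δ j c =O[𝓝[≠] 0] fun x : ℝ => x ^ 2 := by
    refine IsBigO.trans (h3.congr_left fun x => by simp [Kf]) (IsBigO.of_bound 1 ?_)
    have : ∀ᶠ x : ℝ in 𝓝[≠] 0, |x| ≤ 1 := by
      refine nhdsWithin_le_nhds ?_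
      filter_upwards [Metric.closedBall_mem_nhds (0 : ℝ) one_pos] with x hx
      simpa using hx
    filter_upwards [this, self_mem_nhdsWithin] with x hx1 hx0
    have hx' := abs_pos.2 (show x ≠ 0 from hx0)
    simp only [Function.comp, abs_inv, norm_mul, Real.norm_eq_abs, one_mul]
    rw [abs_of_nonneg (Real.rpow_nonneg hx'.le _),
      abs_of_nonneg (Real.rpow_nonneg (inv_nonneg.2 hx'.le) _), Real.inv_rpow hx'.le,
      Real.rpow_neg hx'.le, inv_inv, ← Real.rpow_add hx', abs_pow, ← Real.rpow_natCast]
    exact Real.rpow_le_rpow_of_exponent_ge hx' hx1 (by push_cast; linarith)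
  obtain ⟨C, hC⟩ := h4.bound
  refine IsBigO.of_bound C ?_
  rw [eventually_nhdsWithin_iff] at hC
  filter_upwards [hC] with x hx
  by_cases h : x = 0
  · simp [h]
  · exact hx h

lemma hasDerivAt_Kf (β : ℂ) (δ : ZMod 2) (j : ℕ) {c : ℝ → ℂ} (hc : RapidDecay c) (x : ℝ) :
    HasDerivAt (Kf β δ j c) (KfDeriv β δ j c x) x := by
  by_cases hx : x = 0
  · subst hx
    rw [hasDerivAt_iff_isLittleO_nhds_zero]
    simp only [zero_add, Kf_zero, sub_zero, KfDeriv, mul_zero, smul_zero]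
    refine (Kf_isBigO_nhdsNE β δ j hc).trans_isLittleO ?_
    exact isLittleO_pow_id one_lt_two
  · exact hasDerivAt_Kf_of_ne β δ j hc.smooth hx

lemma deriv_Kf (β : ℂ) (δ : ZMod 2) (j : ℕ) {c : ℝ → ℂ} (hc : RapidDecay c) :
    deriv (Kf β δ j c) = KfDeriv β δ j c :=
  funext fun x => (hasDerivAt_Kf β δ j hc x).deriv

/-- The derivative is a combination of functions of the same kind, with `β + 1` for `β` and possibly
`euler c` for `c`, so induction over all parameters at once gives every order. -/
lemma contDiff_Kf (β : ℂ) (δ : ZMod 2) (j : ℕ) {c : ℝ → ℂ} (hc : RapidDecay c) :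
    ContDiff ℝ ∞ (Kf β δ j c) := by
  rw [contDiff_infty]
  intro n
  induction n generalizing β δ j c with
  | zero =>
    rw [Nat.cast_zero, contDiff_zero]
    exact continuous_iff_continuousAt.2 fun x => (hasDerivAt_Kf β δ j hc x).continuousAt
  | succ n ih =>
    rw [Nat.cast_succ, contDiff_succ_iff_deriv]
    refine ⟨fun x => (hasDerivAt_Kf β δ j hc x).differentiableAt, by simp, ?_⟩
    rw [deriv_Kf β δ j hc]
    exact ((contDiff_const.mul (ih _ _ _ hc)).add (contDiff_const.mul (ih _ _ _ hc))).sub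
      (ih _ _ _ hc.euler)

/-! ### Weighted averages over dilations, and Taylor expansion with smooth remainder -/

/-- The weighted average `∫₀¹ κ(t) S(ty) dt`. -/
noncomputable def dilAvg (κ S : ℝ → ℂ) (y : ℝ) : ℂ := ∫ t in (0 : ℝ)..1, κ t * S (t * y)

lemma intervalIntegrable_ofReal_mul {κ : ℝ → ℂ} (hκ : IntervalIntegrable κ volume 0 1) :
    IntervalIntegrable (fun t : ℝ => (t : ℂ) * κ t) volume 0 1 :=
  hκ.continuousOn_mul Complex.continuous_ofReal.continuousOn

lemma hasDerivAt_dilAvg {κ S : ℝ → ℂ} (hκ : IntervalIntegrable κ volume 0 1)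
    (hS : ContDiff ℝ ∞ S) (y : ℝ) :
    HasDerivAt (dilAvg κ S) (dilAvg (fun t => t * κ t) (deriv S) y) y := by
  have hS' : Continuous (deriv S) := hS.continuous_deriv (by simp)
  obtain ⟨C, hC⟩ := (isCompact_Icc (a := -(|y| + 1)) (b := |y| + 1)).exists_bound_of_continuousOn
    hS'.continuousOn
  have hmem {t z : ℝ} (ht : t ∈ Set.uIoc (0 : ℝ) 1) (hz : z ∈ Metric.ball y 1) :
      t * z ∈ Set.Icc (-(|y| + 1)) (|y| + 1) ∧ |t| ≤ 1 := by
    rw [Set.uIoc_of_le zero_le_one] at ht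
    have h1 : |t| ≤ 1 := abs_le.2 ⟨by linarith [ht.1], ht.2⟩
    have h2 : |z| ≤ |y| + 1 := by
      have := abs_sub_abs_le_abs_sub z y
      have h3 : |z - y| < 1 := by simpa [Real.dist_eq] using hz
      linarith
    refine ⟨abs_le.1 ?_, h1⟩
    rw [abs_mul]
    calc |t| * |z| ≤ 1 * |z| := by gcongr
      _ ≤ _ := by linarith
  have hm (z : ℝ) : IntervalIntegrable (fun t : ℝ => κ t * S (t * z)) volume 0 1 :=
    hκ.mul_continuousOn (hS.continuous.comp (by fun_prop)).continuousOn
  have hm' : IntervalIntegrable (fun t : ℝ => t * κ t * deriv S (t * y)) volume 0 1 :=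
    (intervalIntegrable_ofReal_mul hκ).mul_continuousOn (hS'.comp (by fun_prop)).continuousOn
  refine (intervalIntegral.hasDerivAt_integral_of_dominated_loc_of_deriv_le
    (F := fun z t => κ t * S (t * z)) (F' := fun z t => t * κ t * deriv S (t * z))
    (bound := fun t => ‖κ t‖ * C) (Metric.ball_mem_nhds y one_pos)
    (Eventually.of_forall fun z => ?_) (hm y) ?_ ?_ (hκ.norm.mul_const C) ?_).2
  · exact (intervalIntegrable_iff.1 (hm z)).aestronglyMeasurable
  · exact (intervalIntegrable_iff.1 hm').aestronglyMeasurable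
  · refine Eventually.of_forall fun t ht z hz => ?_
    obtain ⟨h1, h2⟩ := hmem ht hz
    rw [norm_mul, norm_mul, Complex.norm_real, Real.norm_eq_abs]
    calc |t| * ‖κ t‖ * ‖deriv S (t * z)‖ ≤ 1 * ‖κ t‖ * C := by
          gcongr
          exact hC _ h1
      _ = _ := by ring
  · refine Eventually.of_forall fun t _ z _ => ?_
    have h1 : HasDerivAt S (deriv S (t * z)) (t * z) :=
      (hS.differentiable (by simp) _).hasDerivAt
    have h2 := (h1.scomp z ((hasDerivAt_id z).const_mul t)).const_mul (κ t)
    refine h2.congr_deriv ?_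
    simp only [mul_one, Complex.real_smul]
    ring

/-- Differentiation under the integral replaces `κ` by `t κ` and `S` by `S'`, so dilation averages
are closed under derivatives. -/
lemma contDiff_dilAvg {κ S : ℝ → ℂ} (hκ : IntervalIntegrable κ volume 0 1)
    (hS : ContDiff ℝ ∞ S) : ContDiff ℝ ∞ (dilAvg κ S) := by
  rw [contDiff_infty]
  intro n
  induction n generalizing κ S with
  | zero =>
    rw [Nat.cast_zero, contDiff_zero]
    exact continuous_iff_continuousAt.2 fun y => (hasDerivAt_dilAvg hκ hS y).continuousAt
  | succ n ih =>
    rw [Nat.cast_succ, contDiff_succ_iff_deriv]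
    refine ⟨fun y => (hasDerivAt_dilAvg hκ hS y).differentiableAt, by simp, ?_⟩
    rw [funext fun y => (hasDerivAt_dilAvg hκ hS y).deriv]
    exact ih (intervalIntegrable_ofReal_mul hκ) (contDiff_infty_iff_deriv.1 hS).2

/-- The Hadamard quotient `(S(y) - S(0)) / y`. -/
noncomputable def hadamardQuot (S : ℝ → ℂ) : ℝ → ℂ := dilAvg (fun _ => 1) (deriv S)

lemma contDiff_hadamardQuot {S : ℝ → ℂ} (hS : ContDiff ℝ ∞ S) :
    ContDiff ℝ ∞ (hadamardQuot S) :=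
  contDiff_dilAvg intervalIntegrable_const (contDiff_infty_iff_deriv.1 hS).2

lemma eq_add_mul_hadamardQuot {S : ℝ → ℂ} (hS : ContDiff ℝ ∞ S) (y : ℝ) :
    S y = S 0 + y * hadamardQuot S y := by
  have hS' : Continuous (deriv S) := hS.continuous_deriv (by simp)
  have h : ∫ t in (0 : ℝ)..1, (y : ℂ) * deriv S (t * y) = S (1 * y) - S (0 * y) := by
    refine intervalIntegral.integral_eq_sub_of_hasDerivAt (f := fun t => S (t * y))
      (fun t _ => ?_) ?_
    · have h1 : HasDerivAt S (deriv S (t * y)) (t * y) :=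
        (hS.differentiable (by simp) _).hasDerivAt
      refine (h1.scomp t ((hasDerivAt_id t).mul_const y)).congr_deriv ?_
      simp
    · exact (continuous_const.mul (hS'.comp (by fun_prop))).intervalIntegrable _ _
  rw [intervalIntegral.integral_const_mul] at h
  simp only [one_mul, zero_mul] at h
  simp only [hadamardQuot, dilAvg, one_mul, h]
  ring

/-- Taylor coefficients. -/
noncomputable def taylorCoeff (S : ℝ → ℂ) (m : ℕ) : ℂ := (hadamardQuot^[m] S) 0

lemma contDiff_hadamardQuot_iterate {S : ℝ → ℂ} (hS : ContDiff ℝ ∞ S) (M : ℕ) :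
    ContDiff ℝ ∞ (hadamardQuot^[M] S) := by
  induction M with
  | zero => simpa
  | succ M ih => rw [Function.iterate_succ_apply']; exact contDiff_hadamardQuot ih

lemma eq_sum_taylorCoeff {S : ℝ → ℂ} (hS : ContDiff ℝ ∞ S) (M : ℕ) (y : ℝ) :
    S y = ∑ m ∈ Finset.range M, taylorCoeff S m * (y : ℂ) ^ m
      + (y : ℂ) ^ M * (hadamardQuot^[M] S) y := by
  induction M with
  | zero => simp
  | succ M ih =>
    rw [ih, Finset.sum_range_succ, eq_add_mul_hadamardQuot (contDiff_hadamardQuot_iterate hS M) y,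
      Function.iterate_succ_apply', taylorCoeff]
    ring

/-! ### The equation `y w' - γ w = S` -/

/-- The left side is the integral over `[0, 1]` of `d/dt (t^z S(ty))`; positivity of `Re z` kills
the boundary term at `t = 0`. -/
lemma dilAvg_cpow_eq {z : ℂ} (hz : 0 < z.re) {S : ℝ → ℂ} (hS : ContDiff ℝ ∞ S) (y : ℝ) :
    y * deriv (dilAvg (fun t => (t : ℂ) ^ (z - 1)) S) y
      + z * dilAvg (fun t => (t : ℂ) ^ (z - 1)) S y = S y := by
  have hz0 : z ≠ 0 := fun h => by simp [h] at hz
  have hκ : IntervalIntegrable (fun t : ℝ => (t : ℂ) ^ (z - 1)) volume 0 1 :=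
    intervalIntegral.intervalIntegrable_cpow' (by simpa using hz)
  have hS' : Continuous (deriv S) := hS.continuous_deriv (by simp)
  have i1 : IntervalIntegrable (fun t : ℝ => (t : ℂ) ^ (z - 1) * S (t * y)) volume 0 1 :=
    hκ.mul_continuousOn (hS.continuous.comp (by fun_prop)).continuousOn
  have i2 : IntervalIntegrable (fun t : ℝ => t * (t : ℂ) ^ (z - 1) * deriv S (t * y))
      volume 0 1 :=
    (intervalIntegrable_ofReal_mul hκ).mul_continuousOn (hS'.comp (by fun_prop)).continuousOn
  rw [(hasDerivAt_dilAvg hκ hS y).deriv]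
  simp only [dilAvg]
  rw [← intervalIntegral.integral_const_mul, ← intervalIntegral.integral_const_mul,
    ← intervalIntegral.integral_add (i2.const_mul _) (i1.const_mul _)]
  have h := intervalIntegral.integral_eq_sub_of_hasDerivAt_of_le (a := 0) (b := 1)
    (f := fun t : ℝ => (t : ℂ) ^ z * S (t * y))
    (f' := fun t : ℝ => y * (t * (t : ℂ) ^ (z - 1) * deriv S (t * y))
      + z * ((t : ℂ) ^ (z - 1) * S (t * y))) zero_le_one ?_ ?_
      ((i2.const_mul _).add (i1.const_mul _))
  · rw [h]; simp [Complex.zero_cpow hz0]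
  · exact ((Complex.continuous_ofReal_cpow_const hz).mul
      (hS.continuous.comp (by fun_prop))).continuousOn
  · intro t ht
    have ht0 : t ≠ 0 := ht.1.ne'
    have h1 : HasDerivAt S (deriv S (t * y)) (t * y) :=
      (hS.differentiable (by simp) _).hasDerivAt
    have h2 := h1.scomp t ((hasDerivAt_id t).mul_const y)
    have h3 := hasDerivAt_ofReal_cpow_const ht0 hz0
    refine (h3.mul h2).congr_deriv ?_
    have e : (t : ℂ) ^ z = t * (t : ℂ) ^ (z - 1) := by
      rw [Complex.cpow_sub _ _ (by exact_mod_cast ht0), Complex.cpow_one]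
      field_simp [show (t : ℂ) ≠ 0 by exact_mod_cast ht0]
    simp only [one_mul, id, Function.comp, Complex.real_smul, e]
    ring

/-- A particular solution of `y w' - γ w = S`: a smooth function plus logarithmic terms. -/
lemma exists_particular_solution (γ : ℂ) {S : ℝ → ℂ} (hS : ContDiff ℝ ∞ S) :
    ∃ (B : ℝ → ℂ) (a b : ℂ), ContDiff ℝ ∞ B ∧ ∀ y : ℝ, y ≠ 0 →
      HasDerivAt (fun z => B z + a * pw γ 0 1 z + b * pw γ 1 1 z)
        ((γ * (B y + a * pw γ 0 1 y + b * pw γ 1 1 y) + S y) / y) y := by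
  obtain ⟨n, hn⟩ := exists_nat_gt γ.re
  -- For `Re γ < 0` a dilation average solves the equation. Otherwise write `S = S(0) + y S₁`, solve
  -- for `γ - 1` and `S₁`, and multiply by `y`, which exchanges the parities of the logarithmic
  -- terms; only the constant `S(0)` then remains.
  induction n generalizing γ S with
  | zero =>
    have hz : 0 < (-γ).re := by simpa using hn
    have hκ : IntervalIntegrable (fun t : ℝ => (t : ℂ) ^ (-γ - 1)) volume 0 1 :=
      intervalIntegral.intervalIntegrable_cpow' (by simpa using hz)
    refine ⟨dilAvg (fun t => (t : ℂ) ^ (-γ - 1)) S, 0, 0, contDiff_dilAvg hκ hS, fun y hy => ?_⟩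
    have hy' : (y : ℂ) ≠ 0 := by exact_mod_cast hy
    simp only [zero_mul, add_zero]
    have h := hasDerivAt_dilAvg hκ hS y
    refine h.differentiableAt.hasDerivAt.congr_deriv ?_
    rw [eq_div_iff hy']
    linear_combination dilAvg_cpow_eq hz hS y
  | succ n ih =>
    obtain ⟨B, a, b, hB, h⟩ := ih (γ - 1) (contDiff_hadamardQuot hS)
      (by push_cast at hn; simp; linarith)
    have e (δ : ZMod 2) (z : ℝ) : (z : ℂ) * pw (γ - 1) δ 1 z = pw γ (δ + 1) 1 z := by
      have := pw_mul_pow (γ - 1) δ 1 1 z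
      rw [pow_one, mul_comm] at this
      rw [this]; simp
    have key (y : ℝ) (hy : y ≠ 0) : HasDerivAt
        (fun z : ℝ => (z : ℂ) * B z + b * pw γ 0 1 z + a * pw γ 1 1 z)
        ((γ * (y * B y + b * pw γ 0 1 y + a * pw γ 1 1 y) + (S y - S 0)) / y) y := by
      have hy' : (y : ℂ) ≠ 0 := by exact_mod_cast hy
      have e0 (z : ℝ) : pw γ 1 1 z = (z : ℂ) * pw (γ - 1) 0 1 z := by rw [e]; rfl
      have e1 (z : ℝ) : pw γ 0 1 z = (z : ℂ) * pw (γ - 1) 1 1 z := by rw [e]; rfl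
      simp only [e0, e1]
      refine (((Complex.ofRealCLM.hasDerivAt (x := y)).mul (h y hy)).congr_of_eventuallyEq
        (Eventually.of_forall fun z => ?_)).congr_deriv ?_
      · simp only [Pi.mul_apply, Complex.ofRealCLM_apply]; ring
      · have := eq_add_mul_hadamardQuot hS y
        simp only [Complex.ofRealCLM_apply, Complex.ofReal_one, one_mul]
        rw [this]
        field_simp
        ring
    -- The constant source is resonant exactly for `γ = 0`, where it produces `S(0) log |y|`;
    -- otherwise the constant `-S(0)/γ` solves it.
    by_cases hγ : γ = 0
    · refine ⟨fun z => z * B z, b + S 0, a, contDiff_ofReal.mul hB, fun y hy => ?_⟩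
      have hy' : (y : ℂ) ≠ 0 := by exact_mod_cast hy
      refine (((key y hy).add ((hasDerivAt_pw γ 0 1 hy).const_mul (S 0))).congr_of_eventuallyEq
        (Eventually.of_forall fun z => ?_)).congr_deriv ?_
      · simp only [Pi.add_apply]; ring
      · have := pw_div_pow 0 0 0 1 y
        rw [pow_one, pw_of_ne 0 0 0 hy, sgPow_zero_left] at this
        simp only [Complex.cpow_zero, pow_zero, one_mul, Nat.cast_one] at this
        simp only [hγ, Nat.cast_one, tsub_self, one_mul, zero_mul, zero_add]
        simp only [zero_add] at this
        rw [← this]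
        field_simp
        ring
    · refine ⟨fun z => z * B z - S 0 / γ, b, a,
        (contDiff_ofReal.mul hB).sub contDiff_const, fun y hy => ?_⟩
      have hy' : (y : ℂ) ≠ 0 := by exact_mod_cast hy
      refine (((key y hy).sub_const (S 0 / γ)).congr_of_eventuallyEq
        (Eventually.of_forall fun z => ?_)).congr_deriv ?_
      · ring
      · field_simp
        ring

/-- Solutions of `y w' = γ w` off `0`. -/
lemma eq_of_homogeneous {γ : ℂ} {w : ℝ → ℂ}
    (hw : ∀ y : ℝ, y ≠ 0 → HasDerivAt w (γ * w y / y) y) :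
    ∃ a b : ℂ, ∀ y : ℝ, y ≠ 0 → w y = a * pw γ 0 0 y + b * pw γ 1 0 y := by
  have hd (y : ℝ) (hy : y ≠ 0) : HasDerivAt (fun z => pw (-γ) 0 0 z * w z) 0 y := by
    have hy' : (y : ℂ) ≠ 0 := by exact_mod_cast hy
    refine ((hasDerivAt_pw (-γ) 0 0 hy).mul (hw y hy)).congr_deriv ?_
    have := pw_div_pow (-γ) 0 0 1 y
    simp only [pow_one, Nat.cast_one] at this
    simp only [← this, Nat.cast_zero, zero_mul, add_zero]
    field_simp
    ring
  have hconst {s : Set ℝ} (hs : IsOpen s) (hs' : IsPreconnected s) (h0 : ∀ y ∈ s, y ≠ 0) {p : ℝ}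
      (hp : p ∈ s) (y : ℝ) (hy : y ∈ s) : pw (-γ) 0 0 y * w y = pw (-γ) 0 0 p * w p :=
    hs.is_const_of_deriv_eq_zero hs'
      (fun z hz => (hd z (h0 z hz)).differentiableAt.differentiableWithinAt)
      (fun z hz => (hd z (h0 z hz)).deriv) hy hp
  have hpw (y : ℝ) (hy : y ≠ 0) : w y = pw γ 0 0 y * (pw (-γ) 0 0 y * w y) := by
    rw [← mul_assoc, pw_mul_pw, pw_of_ne _ _ _ hy]
    simp [sgPow_zero_left]
  set p := pw (-γ) 0 0 1 * w 1
  set q := pw (-γ) 0 0 (-1) * w (-1)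
  -- `|y|^(-γ) w` is constant on each half-line, with values `p` and `q`; these are its even and odd
  -- parts.
  refine ⟨(p + q) / 2, (p - q) / 2, fun y hy => ?_⟩
  have e : pw γ 1 0 y = sgPow 1 y * pw γ 0 0 y := by
    rw [pw_of_ne _ _ _ hy, pw_of_ne _ _ _ hy, sgPow_zero_left]; ring
  rw [e, hpw y hy]
  rcases lt_or_gt_of_ne hy with h | h
  · rw [hconst isOpen_Iio isPreconnected_Iio (fun z hz => ne_of_lt hz)
      (show (-1 : ℝ) ∈ Set.Iio 0 by simp) y h, sgPow_one_of_neg h]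
    ring
  · rw [hconst isOpen_Ioi isPreconnected_Ioi (fun z hz => ne_of_gt hz)
      (show (1 : ℝ) ∈ Set.Ioi 0 by simp) y h, sgPow_of_pos _ h]
    ring

/-! ### Finite differentiability of signed powers -/

/-- Differentiation lowers the exponent by one, and a function of exponent with positive real part
is continuous at `0` despite the logarithms. -/
lemma contDiff_pw {γ : ℂ} (δ : ZMod 2) (i : ℕ) {n : ℕ} (h : (n : ℝ) < γ.re) :
    ContDiff ℝ n (pw γ δ i) := by
  induction n generalizing γ δ i with
  | zero =>
    rw [Nat.cast_zero, contDiff_zero]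
    refine continuous_iff_continuousAt.2 fun x => ?_
    by_cases hx : x = 0
    · subst hx
      rw [continuousAt_iff_punctured_nhds, pw_zero]
      have h1 : 0 < γ.re / 2 := by simp at h; linarith
      refine (pw_isBigO_nhdsNE δ i (half_lt_self (by simpa using h))).trans_tendsto ?_
      have : ContinuousAt (fun x : ℝ => |x| ^ (γ.re / 2)) 0 :=
        (continuous_abs.continuousAt).rpow_const (Or.inr h1.le)
      have h2 := this.tendsto.mono_left (nhdsWithin_le_nhds (s := {0}ᶜ))
      simpa [Real.zero_rpow h1.ne'] using h2
    · exact (contDiffAt_pw γ δ i hx (n := 0)).continuousAt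
  | succ n ih =>
    have hd (x : ℝ) : HasDerivAt (pw γ δ i)
        (γ * pw (γ - 1) (δ + 1) i x + i * pw (γ - 1) (δ + 1) (i - 1) x) x := by
      by_cases hx : x = 0
      · subst hx
        rw [hasDerivAt_iff_isLittleO_nhds_zero]
        simp only [zero_add, pw_zero, sub_zero, mul_zero, smul_zero]
        push_cast at h
        have hn : (0 : ℝ) ≤ n := Nat.cast_nonneg n
        -- A value strictly between `1` and `Re γ`: `|x|^s` dominates the function and is `o(x)`.
        set s := (γ.re + 1) / 2 with hs
        have h1 : pw γ δ i =O[𝓝[≠] 0] fun x => |x| ^ s := pw_isBigO_nhdsNE δ i (by linarith)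
        have h2 : (fun x : ℝ => |x| ^ s) =o[𝓝[≠] 0] fun x => x := by
          rw [isLittleO_iff_tendsto' (by
            filter_upwards [self_mem_nhdsWithin] with x hx hx0 using absurd hx0 hx)]
          have h3 : Tendsto (fun x : ℝ => |x| ^ (s - 1)) (𝓝[≠] 0) (𝓝 0) := by
            have : ContinuousAt (fun x : ℝ => |x| ^ (s - 1)) 0 :=
              (continuous_abs.continuousAt).rpow_const (Or.inr (by linarith))
            have h2 := this.tendsto.mono_left (nhdsWithin_le_nhds (s := {0}ᶜ))
            simpa [Real.zero_rpow (show s - 1 ≠ 0 by linarith)] using h2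
          refine squeeze_zero_norm' ?_ h3
          filter_upwards [self_mem_nhdsWithin] with x hx
          have hx' := abs_pos.2 (show x ≠ 0 from hx)
          rw [norm_div, Real.norm_eq_abs, Real.norm_eq_abs,
            abs_of_nonneg (Real.rpow_nonneg hx'.le _), Real.rpow_sub_one hx'.ne']
        have h4 := h1.trans_isLittleO h2
        rw [isLittleO_iff] at h4 ⊢
        intro C hC
        have := h4 hC
        rw [eventually_nhdsWithin_iff] at this
        filter_upwards [this] with x hx
        by_cases h0 : x = 0
        · simp [h0]
        · exact hx h0
      · exact hasDerivAt_pw γ δ i hx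
    rw [Nat.cast_succ, contDiff_succ_iff_deriv]
    refine ⟨fun x => (hd x).differentiableAt, by simp, ?_⟩
    rw [funext fun x => (hd x).deriv]
    have hre : (n : ℝ) < (γ - 1).re := by push_cast at h; simp; linarith
    exact (contDiff_const.mul (ih _ _ hre)).add (contDiff_const.mul (ih _ _ hre))

/-! ### The Borel lemma -/

/-- A smooth function with compact support, equal to `1` near `0`. -/
noncomputable def cutoff (x : ℝ) : ℂ := ((⟨1, 2, one_pos, one_lt_two⟩ : ContDiffBump (0 : ℝ)) x : ℝ)

lemma contDiff_cutoff : ContDiff ℝ ∞ cutoff :=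
  Complex.ofRealCLM.contDiff.comp (ContDiffBump.contDiff _)

lemma hasCompactSupport_cutoff : HasCompactSupport cutoff :=
  (ContDiffBump.hasCompactSupport _).comp_left Complex.ofReal_zero

lemma cutoff_eq_one {x : ℝ} (hx : |x| ≤ 1) : cutoff x = 1 := by
  rw [cutoff, ContDiffBump.one_of_mem_closedBall _ (by simpa using hx)]
  simp

lemma exists_bound_iteratedDeriv {f : ℝ → ℂ} (hf : ContDiff ℝ ∞ f) (hs : HasCompactSupport f)
    (k : ℕ) : ∃ C : ℝ, 0 ≤ C ∧ ∀ x, ‖iteratedDeriv k f x‖ ≤ C := by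
  obtain ⟨C, hC⟩ := (hs.iteratedFDeriv (𝕜 := ℝ) k).exists_bound_of_continuous
    (hf.continuous_iteratedFDeriv (m := k) (by exact_mod_cast le_top))
  have hbound (x : ℝ) : ‖iteratedDeriv k f x‖ ≤ C := by
    rw [← norm_iteratedFDeriv_eq_norm_iteratedDeriv]; exact hC x
  exact ⟨C, (norm_nonneg _).trans (hbound 0), hbound⟩

/-- A function which vanishes near `0` can be divided by any power of `y`. -/
lemma exists_eq_pow_mul_of_eventually_zero {Z : ℝ → ℂ} (hZ : ContDiff ℝ ∞ Z)
    (h0 : ∀ᶠ y in 𝓝 0, Z y = 0) (M : ℕ) :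
    ∃ R : ℝ → ℂ, ContDiff ℝ ∞ R ∧ ∀ y : ℝ, Z y = (y : ℂ) ^ M * R y := by
  refine ⟨fun y => Z y * ((y : ℂ) ^ M)⁻¹, ?_, fun y => ?_⟩
  · refine contDiff_iff_contDiffAt.2 fun y => ?_
    by_cases hy : y = 0
    · subst hy
      refine (contDiffAt_const (c := (0 : ℂ))).congr_of_eventuallyEq ?_
      filter_upwards [h0] with y hy
      simp [hy]
    · exact hZ.contDiffAt.mul ((contDiff_ofReal.contDiffAt.pow M).inv
        (pow_ne_zero _ (by exact_mod_cast hy)))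
  · by_cases hy : y = 0
    · subst hy; simp [h0.self_of_nhds]
    · have : (y : ℂ) ≠ 0 := by exact_mod_cast hy
      field_simp

/-- For `t ≥ 1`, the cutoff at scale `1/t` multiplies the `k`-th derivative of `y^p cutoff y` by
`t^(k-p) ≤ 1/t`, so large `t` makes it small. The scale depends only on `M + p`, hence the same
scales control the series of every Taylor remainder, indexed by `M`. -/
lemma exists_scales (a : ℕ → ℂ) : ∃ t : ℕ → ℝ,
    ∀ M k p : ℕ, k < p → ∀ y : ℝ,
      ‖iteratedDeriv k (fun y : ℝ => a (M + p) * ((y : ℂ) ^ p * cutoff (t (M + p) * y))) y‖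
        ≤ (1 / 2 : ℝ) ^ p := by
  have hψ (p : ℕ) : ContDiff ℝ ∞ (fun y : ℝ => (y : ℂ) ^ p * cutoff y) :=
    (contDiff_ofReal.pow p).mul contDiff_cutoff
  have hψs (p : ℕ) : HasCompactSupport (fun y : ℝ => (y : ℂ) ^ p * cutoff y) :=
    hasCompactSupport_cutoff.mul_left
  choose C hC0 hC using fun p k => exists_bound_iteratedDeriv (hψ p) (hψs p) k
  let D (m : ℕ) : ℝ := ∑ p ∈ Finset.range (m + 1), ∑ k ∈ Finset.range (m + 1), C p k
  have hD {m p k : ℕ} (hp : p ≤ m) (hk : k ≤ m) : C p k ≤ D m := by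
    refine (Finset.single_le_sum (f := fun k => C p k) (fun k _ => hC0 p k)
      (Finset.mem_range.2 (Nat.lt_succ_of_le hk))).trans ?_
    exact Finset.single_le_sum (f := fun p => ∑ k ∈ Finset.range (m + 1), C p k)
      (fun p _ => Finset.sum_nonneg fun k _ => hC0 p k)
      (Finset.mem_range.2 (Nat.lt_succ_of_le hp))
  have hD0 (m : ℕ) : 0 ≤ D m := (hC0 0 0).trans (hD m.zero_le m.zero_le)
  -- This makes `t ≥ 1` and `‖a m‖ D m / t ≤ 2^(-m)`; `D m` dominates all the finitely many
  -- derivative bounds with indices at most `m`.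
  refine ⟨fun m => 1 + 2 ^ m * ‖a m‖ * D m, fun M k p hkp y => ?_⟩
  set m := M + p
  set t := 1 + 2 ^ m * ‖a m‖ * D m with ht
  have ht1 : 1 ≤ t := by
    have := hD0 m; have : 0 ≤ 2 ^ m * ‖a m‖ * D m := by positivity
    linarith
  have ht0 : 0 < t := by linarith
  have htc : (t : ℂ) ≠ 0 := by exact_mod_cast ht0.ne'
  have e : (fun y : ℝ => a m * ((y : ℂ) ^ p * cutoff (t * y)))
      = fun y : ℝ => (a m * ((t : ℂ) ^ p)⁻¹) * (((t * y : ℝ) : ℂ) ^ p * cutoff (t * y)) := by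
    ext y; push_cast; rw [mul_pow]; field_simp
  rw [e, iteratedDeriv_const_mul_field, iteratedDeriv_comp_const_smul
    (f := fun y : ℝ => (y : ℂ) ^ p * cutoff y) ((hψ p).of_le (by exact_mod_cast le_top)) t]
  rw [norm_mul, norm_mul, norm_smul, norm_inv, norm_pow, norm_pow, Complex.norm_real,
    Real.norm_of_nonneg ht0.le]
  have h1 : t ^ k * (t ^ p)⁻¹ ≤ t⁻¹ := by
    rw [← div_eq_mul_inv, div_le_iff₀ (by positivity), ← div_eq_inv_mul, le_div_iff₀ ht0,
      ← pow_succ]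
    exact pow_le_pow_right₀ ht1 hkp
  have h2 : ‖a m‖ * D m * t⁻¹ ≤ (1 / 2) ^ m := by
    rw [← div_eq_mul_inv, div_le_iff₀ ht0, one_div, inv_pow, ← div_eq_inv_mul,
      le_div_iff₀ (by positivity)]
    rw [ht]; linarith
  calc ‖a m‖ * (t ^ p)⁻¹ * (t ^ k * ‖iteratedDeriv k (fun y : ℝ => (y : ℂ) ^ p * cutoff y) (t * y)‖)
      ≤ ‖a m‖ * (t ^ p)⁻¹ * (t ^ k * D m) := by
        gcongr
        exact (hC p k _).trans (hD (Nat.le_add_left _ _) (hkp.le.trans (Nat.le_add_left _ _)))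
    _ = ‖a m‖ * D m * (t ^ k * (t ^ p)⁻¹) := by ring
    _ ≤ ‖a m‖ * D m * t⁻¹ := by have := hD0 m; gcongr
    _ ≤ (1 / 2) ^ m := h2
    _ ≤ (1 / 2) ^ p := pow_le_pow_of_le_one (by norm_num) (by norm_num) (Nat.le_add_left _ _)

/-- The **Borel lemma**: every sequence is the sequence of Taylor coefficients of a smooth
function. -/
lemma exists_contDiff_with_taylor (a : ℕ → ℂ) :
    ∃ A : ℝ → ℂ, ContDiff ℝ ∞ A ∧ ∀ M : ℕ, ∃ R : ℝ → ℂ, ContDiff ℝ ∞ R ∧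
      ∀ y : ℝ, A y = ∑ m ∈ Finset.range M, a m * (y : ℂ) ^ m + (y : ℂ) ^ M * R y := by
  obtain ⟨t, ht⟩ := exists_scales a
  -- Since `F 0 (M + p) = y^M F M p`, the tail of the series for `A` is `y^M` times the series of
  -- the `F M p`.
  let F (M p : ℕ) (y : ℝ) : ℂ := a (M + p) * ((y : ℂ) ^ p * cutoff (t (M + p) * y))
  have hF (M p : ℕ) : ContDiff ℝ ∞ (F M p) :=
    contDiff_const.mul ((contDiff_ofReal.pow p).mul (contDiff_cutoff.comp (by fun_prop)))
  have hsum : Summable fun p : ℕ => (1 / 2 : ℝ) ^ p := summable_geometric_two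
  have hA (M : ℕ) : ContDiff ℝ ∞ fun y => ∑' p, F M p y := by
    refine contDiff_tsum_of_eventually (N := ⊤) (v := fun _ p => (1 / 2 : ℝ) ^ p) (hF M)
      (fun _ _ => hsum) fun k _ => ?_
    rw [Nat.cofinite_eq_atTop]
    filter_upwards [eventually_gt_atTop k] with p hp y
    rw [norm_iteratedFDeriv_eq_norm_iteratedDeriv]
    exact ht M k p hp y
  have hS (y : ℝ) : Summable fun p => F 0 p y := by
    refine Summable.of_norm_bounded_eventually_nat hsum ?_
    filter_upwards [eventually_gt_atTop 0] with p hp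
    simpa only [iteratedDeriv_zero] using ht 0 0 p hp y
  refine ⟨fun y => ∑' p, F 0 p y, hA 0, fun M => ?_⟩
  have hsplit (y : ℝ) : ∑' p, F 0 p y
      = ∑ p ∈ Finset.range M, F 0 p y + (y : ℂ) ^ M * ∑' p, F M p y := by
    rw [← (hS y).sum_add_tsum_nat_add M, ← tsum_mul_left]
    congr 2
    ext p
    simp only [F, zero_add, add_comm p M, pow_add]
    ring
  have hpoly : ContDiff ℝ ∞ fun y : ℝ => ∑ m ∈ Finset.range M, a m * (y : ℂ) ^ m :=
    ContDiff.sum fun m _ => contDiff_const.mul (contDiff_ofReal.pow m)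
  -- The cutoffs in the first `M` terms are `1` near `0`, so the error they introduce is divisible
  -- by `y^M`.
  obtain ⟨R, hR, hR'⟩ := exists_eq_pow_mul_of_eventually_zero
    (Z := fun y => ∑ p ∈ Finset.range M, F 0 p y - ∑ m ∈ Finset.range M, a m * (y : ℂ) ^ m)
    ((ContDiff.sum fun p _ => hF 0 p).sub hpoly) (by
      have : ∀ p ∈ Finset.range M, ∀ᶠ y : ℝ in 𝓝 0, F 0 p y = a p * (y : ℂ) ^ p := by
        intro p _
        have h0 : Tendsto (fun y => |t p * y|) (𝓝 0) (𝓝 0) := by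
          have : Continuous fun y => |t p * y| := by fun_prop
          simpa using this.tendsto 0
        filter_upwards [h0.eventually (eventually_le_nhds one_pos)] with y hy
        simp only [F, zero_add, cutoff_eq_one hy, mul_one]
      filter_upwards [(Finset.range M).eventually_all.2 this] with y hy
      rw [Finset.sum_congr rfl hy, sub_self]) M
  refine ⟨fun y => (∑' p, F M p y) + R y, (hA M).add hR, fun y => ?_⟩
  beta_reduce
  rw [hsplit, mul_add, ← hR']
  ring

/-! ### Fourier transforms -/

/-- The character `e(-xy)`. -/
noncomputable def ey (y x : ℝ) : ℂ := Complex.exp (-(2 * Real.pi * Complex.I * x * y))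

lemma norm_ey (y x : ℝ) : ‖ey y x‖ = 1 := by
  rw [ey, show -(2 * Real.pi * Complex.I * x * y) = ((-(2 * Real.pi * x * y) : ℝ) : ℂ) * Complex.I by
    push_cast; ring, Complex.norm_exp_ofReal_mul_I]

lemma continuous_ey (y : ℝ) : Continuous (ey y) := by unfold ey; fun_prop

lemma fourier_eq_integral (f : ℝ → ℂ) (y : ℝ) : 𝓕 f y = ∫ x, ey y x * f x := by
  rw [Real.fourier_real_eq_integral_exp_smul]
  congr 1
  ext x
  rw [ey, smul_eq_mul]
  congr 2
  push_cast
  ring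

lemma integrable_ey_mul {f : ℝ → ℂ} (hf : Integrable f) (y : ℝ) :
    Integrable fun x => ey y x * f x :=
  hf.bdd_mul (continuous_ey y).aestronglyMeasurable (Eventually.of_forall fun x => (norm_ey y x).le)

lemma fourier_add_apply {f g : ℝ → ℂ} (hf : Integrable f) (hg : Integrable g) (y : ℝ) :
    𝓕 (fun x => f x + g x) y = 𝓕 f y + 𝓕 g y := by
  simp only [fourier_eq_integral, mul_add]
  exact integral_add (integrable_ey_mul hf y) (integrable_ey_mul hg y)

lemma fourier_const_mul_apply (a : ℂ) (f : ℝ → ℂ) (y : ℝ) :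
    𝓕 (fun x => a * f x) y = a * 𝓕 f y := by
  simp only [fourier_eq_integral]
  rw [← integral_const_mul]
  congr 1; ext x; ring

lemma fourier_sum_apply {ι : Type*} (s : Finset ι) {f : ι → ℝ → ℂ}
    (hf : ∀ i ∈ s, Integrable (f i)) (y : ℝ) :
    𝓕 (fun x => ∑ i ∈ s, f i x) y = ∑ i ∈ s, 𝓕 (f i) y := by
  simp only [fourier_eq_integral, Finset.mul_sum]
  exact integral_finsetSum _ fun i hi => integrable_ey_mul (hf i hi) y

lemma integrable_of_isBigO {f : ℝ → ℂ} (hf : Continuous f) {s : ℝ} (hs : s < -1)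
    (h : f =O[cobounded ℝ] fun x => |x| ^ s) : Integrable f := by
  have hr : Integrable fun x : ℝ => (1 + ‖x‖) ^ (-(-s)) :=
    integrable_one_add_norm (by simp; linarith)
  refine hf.locallyIntegrable.integrable_of_isBigO_cocompact
    (g := fun x : ℝ => (1 + ‖x‖) ^ (-(-s))) ?_ (hr.integrableAtFilter _)
  rw [← Metric.cobounded_eq_cocompact]
  -- The constant comes from `1 + |x| ≤ 2|x|` for `|x| ≥ 1`, raised to the negative power `s`.
  refine h.trans (IsBigO.of_bound (2 ^ (-s)) ?_)
  filter_upwards [eventually_one_le_abs_cobounded] with x hx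
  have hx0 : 0 < |x| := by linarith
  rw [neg_neg, Real.norm_of_nonneg (Real.rpow_nonneg hx0.le _),
    Real.norm_of_nonneg (Real.rpow_nonneg (by positivity) _), Real.norm_eq_abs]
  calc |x| ^ s = 2 ^ (-s) * (2 * |x|) ^ s := by
        rw [Real.mul_rpow two_pos.le hx0.le, ← mul_assoc, ← Real.rpow_add two_pos]; simp
    _ ≤ 2 ^ (-s) * (1 + |x|) ^ s := by
        gcongr 2 ^ (-s) * ?_
        exact Real.rpow_le_rpow_of_nonpos (by positivity) (by linarith) (by linarith)

/-- `c` is smooth with compact support. -/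
structure SmoothCompact (c : ℝ → ℂ) : Prop where
  smooth : ContDiff ℝ ∞ c
  supp : HasCompactSupport c

lemma SmoothCompact.rapidDecay {c : ℝ → ℂ} (hc : SmoothCompact c) : RapidDecay c :=
  .of_hasCompactSupport hc.smooth hc.supp

lemma SmoothCompact.euler {c : ℝ → ℂ} (hc : SmoothCompact c) : SmoothCompact (euler c) where
  smooth := contDiff_ofReal.mul (contDiff_infty_iff_deriv.1 hc.smooth).2
  supp := hc.supp.deriv.mul_left

lemma SmoothCompact.iteratedDeriv {c : ℝ → ℂ} (hc : SmoothCompact c) (k : ℕ) :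
    SmoothCompact (iteratedDeriv k c) := by
  induction k with
  | zero => simpa
  | succ k ih =>
    rw [iteratedDeriv_succ]
    exact ⟨(contDiff_infty_iff_deriv.1 ih.smooth).2, ih.supp.deriv⟩

lemma SmoothCompact.integrable {c : ℝ → ℂ} (hc : SmoothCompact c) : Integrable c :=
  hc.smooth.continuous.integrable_of_hasCompactSupport hc.supp

lemma smoothCompact_cutoff : SmoothCompact cutoff := ⟨contDiff_cutoff, hasCompactSupport_cutoff⟩

lemma SmoothCompact.contDiff_fourier {c : ℝ → ℂ} (hc : SmoothCompact c) :
    ContDiff ℝ ∞ (𝓕 c) := by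
  refine Real.contDiff_fourier (N := ⊤) fun n _ => ?_
  have : Continuous fun v : ℝ => ‖v‖ ^ n * ‖c v‖ := by
    have := hc.smooth.continuous; fun_prop
  exact this.integrable_of_hasCompactSupport hc.supp.norm.mul_left

lemma Kf_isBigO_cobounded {β : ℂ} (δ : ZMod 2) (j : ℕ) {c : ℝ → ℂ} (hc : ContinuousAt c 0) {a : ℝ}
    (ha : -β.re < a) : Kf β δ j c =O[cobounded ℝ] fun x => |x| ^ a := by
  have h1 : pw (-β) δ j =O[cobounded ℝ] fun x => |x| ^ a :=
    pw_isBigO_cobounded δ j (by simpa using ha)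
  have h2 : (fun x : ℝ => c x⁻¹) =O[cobounded ℝ] fun _ => (1 : ℝ) :=
    (hc.tendsto.comp (tendsto_inv₀_cobounded (α := ℝ))).isBigO_one ℝ
  exact (h1.mul h2).congr (fun _ => rfl) fun _ => mul_one _

lemma integrable_pow_mul_Kf {β : ℂ} (δ : ZMod 2) (j : ℕ) {c : ℝ → ℂ} (hc : SmoothCompact c) {n : ℕ}
    (h : n + 1 < β.re) : Integrable fun x : ℝ => (x : ℂ) ^ n * Kf β δ j c x := by
  -- The exponent is the midpoint of `-Re β` and `-(n + 1)`.
  have hK := Kf_isBigO_cobounded (β := β) δ j hc.smooth.continuous.continuousAt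
    (a := -(β.re + n + 1) / 2) (by linarith)
  have hx : (fun x : ℝ => (x : ℂ) ^ n) =O[cobounded ℝ] fun x => |x| ^ (n : ℝ) :=
    IsBigO.of_bound 1 (Eventually.of_forall fun x => by simp)
  refine integrable_of_isBigO (s := n + -(β.re + n + 1) / 2)
    ((Complex.continuous_ofReal.pow n).mul (contDiff_Kf β δ j hc.rapidDecay).continuous)
    (by linarith) ((hx.mul hK).congr' .rfl ?_)
  filter_upwards [eventually_ne_cobounded (0 : ℝ)] with x hx
  rw [Real.rpow_add (abs_pos.2 hx)]

lemma integrable_Kf {β : ℂ} (δ : ZMod 2) (j : ℕ) {c : ℝ → ℂ} (hc : SmoothCompact c)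
    (h : 1 < β.re) : Integrable (Kf β δ j c) := by
  simpa using integrable_pow_mul_Kf δ j hc (n := 0) (by simpa using h)

lemma contDiff_fourier_Kf {β : ℂ} (δ : ZMod 2) (j : ℕ) {c : ℝ → ℂ} (hc : SmoothCompact c) {n : ℕ}
    (h : n + 1 < β.re) : ContDiff ℝ n (𝓕 (Kf β δ j c)) := by
  refine Real.contDiff_fourier (N := n) fun m hm => ?_
  have hm' : (m : ℝ) ≤ n := by exact_mod_cast hm
  have := (integrable_pow_mul_Kf δ j hc (n := m) (by linarith : (m : ℝ) + 1 < β.re)).norm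
  simpa using this

lemma Kf_succ_mul (β : ℂ) (δ : ZMod 2) (j : ℕ) (c : ℝ → ℂ) (x : ℝ) :
    (x : ℂ) * Kf (β + 1) (δ + 1) j c x = Kf β δ j c x := by
  have := pw_mul_pow (-(β + 1)) (δ + 1) j 1 x
  simp only [Kf]
  rw [← mul_assoc, mul_comm (x : ℂ)]
  rw [pow_one] at this
  rw [this, Nat.cast_one, Nat.cast_one, ZMod.two_add_cancel]
  congr 2; ring

lemma ofReal_mul_KfDeriv (β : ℂ) (δ : ZMod 2) (j : ℕ) (c : ℝ → ℂ) (x : ℝ) :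
    (x : ℂ) * KfDeriv β δ j c x
      = -β * Kf β δ j c x + j * Kf β δ (j - 1) c x - Kf β δ j (euler c) x := by
  rw [KfDeriv, ← Kf_succ_mul β δ j c, ← Kf_succ_mul β δ (j - 1) c, ← Kf_succ_mul β δ j (euler c)]
  ring

/-- The differential equation satisfied by the Fourier transform of `Kf β δ j c`. -/
lemma hasDerivAt_fourier_Kf {β : ℂ} (δ : ZMod 2) (j : ℕ) {c : ℝ → ℂ} (hc : SmoothCompact c)
    (hβ : 2 < β.re) {y : ℝ} (hy : y ≠ 0) :
    HasDerivAt (𝓕 (Kf β δ j c)) (((β - 1) * 𝓕 (Kf β δ j c) y +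
      (-j * 𝓕 (Kf β δ (j - 1) c) y + 𝓕 (Kf β δ j (euler c)) y)) / y) y := by
  have hβ1 : 1 < β.re := by linarith
  have hβ2 : 1 < (β + 1).re := by simp; linarith
  have hy' : (y : ℂ) ≠ 0 := by exact_mod_cast hy
  set H := Kf β δ j c with hH
  have hH' : deriv H = KfDeriv β δ j c := deriv_Kf β δ j hc.rapidDecay
  have iH : Integrable H := integrable_Kf δ j hc hβ1
  have i1 := integrable_Kf δ j hc hβ1
  have i2 := integrable_Kf δ (j - 1) hc hβ1
  have i3 := integrable_Kf δ j hc.euler hβ1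
  have ixH : Integrable fun x : ℝ => x • H x := by
    have := integrable_pow_mul_Kf δ j hc (n := 1) (by norm_num; linarith : ((1 : ℕ) : ℝ) + 1 < β.re)
    simpa using this
  have iH' : Integrable (deriv H) := by
    rw [hH']
    exact (((integrable_Kf _ j hc hβ2).const_mul _).add
      ((integrable_Kf _ (j - 1) hc hβ2).const_mul _)).sub (integrable_Kf _ j hc.euler hβ2)
  have exH : (fun x : ℝ => x • deriv H x) = fun x =>
      (-β * Kf β δ j c x + j * Kf β δ (j - 1) c x) + (-1) * Kf β δ j (euler c) x := by
    ext x
    rw [hH', Complex.real_smul, ofReal_mul_KfDeriv]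
    ring
  have ixH' : Integrable fun x : ℝ => x • deriv H x := by
    rw [exH]
    exact ((i1.const_mul _).add (i2.const_mul _)).add (i3.const_mul _)
  have d1 := (Real.hasDerivAt_fourier iH ixH y).differentiableAt.hasDerivAt
  have d2 := Real.hasDerivAt_fourier iH' ixH' y
  rw [Real.fourier_deriv iH (fun x => (hasDerivAt_Kf β δ j hc.rapidDecay x).differentiableAt)
    iH'] at d2
  have d3 : HasDerivAt (fun x : ℝ => (2 * Real.pi * Complex.I * x) • 𝓕 H x)
      (2 * Real.pi * Complex.I * (𝓕 H y + y * deriv (𝓕 H) y)) y := by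
    refine (((Complex.ofRealCLM.hasDerivAt (x := y)).const_mul
      (2 * Real.pi * Complex.I)).mul d1).congr_deriv ?_
    simp only [Complex.ofRealCLM_apply, Complex.ofReal_one]
    ring
  -- Two expressions for the derivative of `2πi y 𝓕H(y) = 𝓕(H')(y)`: the product rule, and the
  -- transform of `-2πi x H'`, where `x H'` is again a combination of functions of the same kind.
  have e := d3.unique d2
  have e2 : (fun x : ℝ => (-2 * Real.pi * Complex.I * x) • deriv H x)
      = fun x => (-2 * Real.pi * Complex.I) *
        ((-β * Kf β δ j c x + j * Kf β δ (j - 1) c x) + (-1) * Kf β δ j (euler c) x) := by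
    ext x
    rw [← congrFun exH x]
    simp only [smul_eq_mul, Complex.real_smul]
    ring
  have i12 : Integrable fun x => -β * Kf β δ j c x + j * Kf β δ (j - 1) c x :=
    (i1.const_mul _).add (i2.const_mul _)
  rw [e2, fourier_const_mul_apply, fourier_add_apply i12 (i3.const_mul _), fourier_add_apply (i1.const_mul _) (i2.const_mul _),
    fourier_const_mul_apply, fourier_const_mul_apply, fourier_const_mul_apply] at e
  refine d1.congr_deriv ?_
  rw [eq_div_iff hy']
  have hpi : (2 * Real.pi * Complex.I : ℂ) ≠ 0 := Complex.two_pi_I_ne_zero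
  refine mul_left_cancel₀ hpi ?_
  rw [← hH] at e
  linear_combination e

/-! ### The singularity at `0` of the Fourier transform of `Kf β δ j c` -/

/-- Off `0`, `u` is the sum of `|y|^γ` times a combination of `(sg y)^δ (log |y|)^i`, `i < n`, and of
a smooth function. -/
def LogForm (γ : ℂ) (n : ℕ) (u : ℝ → ℂ) : Prop :=
  ∃ (a b : ℕ → ℂ) (B : ℝ → ℂ), ContDiff ℝ ∞ B ∧ ∀ y : ℝ, y ≠ 0 →
    u y = ∑ i ∈ Finset.range n, (a i * pw γ 0 i y + b i * pw γ 1 i y) + B y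

lemma LogForm.of_contDiff (γ : ℂ) (n : ℕ) {u : ℝ → ℂ} (hu : ContDiff ℝ ∞ u) : LogForm γ n u :=
  ⟨0, 0, u, hu, by simp⟩

lemma LogForm.add {γ : ℂ} {n : ℕ} {u v : ℝ → ℂ} (hu : LogForm γ n u) (hv : LogForm γ n v) :
    LogForm γ n fun y => u y + v y := by
  obtain ⟨a, b, B, hB, h⟩ := hu
  obtain ⟨a', b', B', hB', h'⟩ := hv
  refine ⟨a + a', b + b', fun y => B y + B' y, hB.add hB', fun y hy => ?_⟩
  beta_reduce
  rw [h y hy, h' y hy, add_add_add_comm, ← Finset.sum_add_distrib]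
  congr 1
  refine Finset.sum_congr rfl fun i _ => ?_
  simp only [Pi.add_apply]
  ring

lemma LogForm.const_mul {γ : ℂ} {n : ℕ} {u : ℝ → ℂ} (hu : LogForm γ n u) (k : ℂ) :
    LogForm γ n fun y => k * u y := by
  obtain ⟨a, b, B, hB, h⟩ := hu
  refine ⟨fun i => k * a i, fun i => k * b i, fun y => k * B y, contDiff_const.mul hB,
    fun y hy => ?_⟩
  beta_reduce
  rw [h y hy, mul_add, Finset.mul_sum]
  congr 1
  exact Finset.sum_congr rfl fun i _ => by ring

lemma hasDerivAt_pw_succ (γ : ℂ) (δ : ZMod 2) (i : ℕ) {y : ℝ} (hy : y ≠ 0) :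
    HasDerivAt (pw γ δ (i + 1)) ((γ * pw γ δ (i + 1) y + (i + 1) * pw γ δ i y) / y) y := by
  refine (hasDerivAt_pw γ δ (i + 1) hy).congr_deriv ?_
  have e (k : ℕ) := pw_div_pow γ δ k 1 y
  simp only [pow_one, Nat.cast_one] at e
  rw [← e, Nat.add_sub_cancel, ← e]
  push_cast
  ring

/-- Solving `y u' = γ u + v` raises the power of the logarithm by one. -/
lemma LogForm.of_hasDerivAt {γ : ℂ} {n : ℕ} {u v : ℝ → ℂ} (hv : LogForm γ (n + 1) v)
    (hu : ∀ y : ℝ, y ≠ 0 → HasDerivAt u ((γ * u y + v y) / y) y) : LogForm γ (n + 2) u := by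
  obtain ⟨a, b, S, hS, h⟩ := hv
  obtain ⟨B, a₁, b₁, hB, hq⟩ := exists_particular_solution γ hS
  -- A source `|y|^γ (log |y|)^i` is solved by `|y|^γ (log |y|)^(i+1) / (i + 1)`.
  let p (y : ℝ) : ℂ := ∑ i ∈ Finset.range (n + 1),
    (a i / (i + 1) * pw γ 0 (i + 1) y + b i / (i + 1) * pw γ 1 (i + 1) y)
  have hp (y : ℝ) (hy : y ≠ 0) : HasDerivAt p ((γ * p y +
      ∑ i ∈ Finset.range (n + 1), (a i * pw γ 0 i y + b i * pw γ 1 i y)) / y) y := by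
    refine (HasDerivAt.fun_sum fun i _ => ((hasDerivAt_pw_succ γ 0 i hy).const_mul
      (a i / (i + 1))).add ((hasDerivAt_pw_succ γ 1 i hy).const_mul (b i / (i + 1)))).congr_deriv ?_
    rw [Finset.mul_sum, ← Finset.sum_add_distrib, Finset.sum_div]
    refine Finset.sum_congr rfl fun i _ => ?_
    have : (i : ℂ) + 1 ≠ 0 := Nat.cast_add_one_ne_zero i
    field_simp
    ring
  obtain ⟨a₀, b₀, hw⟩ := eq_of_homogeneous (γ := γ)
    (w := fun y => u y - p y - (B y + a₁ * pw γ 0 1 y + b₁ * pw γ 1 1 y)) (fun y hy => by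
      refine (((hu y hy).sub (hp y hy)).sub (hq y hy)).congr_deriv ?_
      rw [h y hy]
      ring)
  -- Index `0` carries the homogeneous solution, index `i ≥ 1` the integrated source of index `i -
  -- 1`; the logarithm caused by the smooth source enters at index `1`.
  refine ⟨fun i => if i = 0 then a₀ else a (i - 1) / i + if i = 1 then a₁ else 0,
    fun i => if i = 0 then b₀ else b (i - 1) / i + if i = 1 then b₁ else 0, B, hB,
    fun y hy => ?_⟩
  have e := hw y hy
  have e2 : u y = p y + (B y + a₁ * pw γ 0 1 y + b₁ * pw γ 1 1 y)
      + (a₀ * pw γ 0 0 y + b₀ * pw γ 1 0 y) := by linear_combination e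
  rw [e2, Finset.sum_range_succ']
  simp only [Nat.add_eq_zero_iff, one_ne_zero, and_false, if_false, if_true, Nat.add_sub_cancel,
    Nat.add_eq_right, add_mul, ite_mul, zero_mul]
  have e3 : ∑ i ∈ Finset.range (n + 1),
      (a i / ((i + 1 : ℕ) : ℂ) * pw γ 0 (i + 1) y + (if i = 0 then a₁ * pw γ 0 (i + 1) y else 0) +
        (b i / ((i + 1 : ℕ) : ℂ) * pw γ 1 (i + 1) y +
          if i = 0 then b₁ * pw γ 1 (i + 1) y else 0))
      = p y + (a₁ * pw γ 0 1 y + b₁ * pw γ 1 1 y) := by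
    simp only [p, Finset.sum_add_distrib, Finset.sum_ite_eq', Finset.mem_range, Nat.succ_pos,
      if_true, zero_add]
    push_cast
    ring
  rw [e3]
  ring

lemma SmoothCompact.Kf_of_eventually_zero (β : ℂ) (δ : ZMod 2) (j : ℕ) {c : ℝ → ℂ}
    (hc : SmoothCompact c) (h0 : ∀ᶠ u in 𝓝 0, c u = 0) : SmoothCompact (Kf β δ j c) where
  smooth := contDiff_Kf β δ j hc.rapidDecay
  supp := by
    rw [hasCompactSupport_iff_eventuallyEq, coclosedCompact_eq_cocompact,
      ← Metric.cobounded_eq_cocompact]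
    filter_upwards [(tendsto_inv₀_cobounded (α := ℝ)).eventually h0] with x hx
    simp [Kf, hx]

lemma euler_cutoff_eventually_zero : ∀ᶠ u in 𝓝 0, euler cutoff u = 0 := by
  filter_upwards [Metric.ball_mem_nhds (0 : ℝ) one_pos] with u hu
  have : cutoff =ᶠ[𝓝 u] fun _ => (1 : ℂ) := by
    filter_upwards [Metric.isOpen_ball.mem_nhds hu] with z hz
    exact cutoff_eq_one (by simpa using (Metric.ball_subset_closedBall hz))
  rw [euler, this.deriv_eq]
  simp

/-- As `euler cutoff` vanishes near `0`, its contribution to the source is the transform of a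
compactly supported smooth function, hence smooth. The only singular source is the transform for `j
- 1`, so induction on `j` applies. -/
lemma logForm_fourier_Kf_cutoff {β : ℂ} (hβ : 2 < β.re) (δ : ZMod 2) (j : ℕ) :
    LogForm (β - 1) (j + 2) (𝓕 (Kf β δ j cutoff)) := by
  have hs : ContDiff ℝ ∞ (𝓕 (Kf β δ j (euler cutoff))) :=
    (smoothCompact_cutoff.euler.Kf_of_eventually_zero β δ j
      euler_cutoff_eventually_zero).contDiff_fourier
  induction j with
  | zero =>
    refine LogForm.of_hasDerivAt (v := 𝓕 (Kf β δ 0 (euler cutoff))) (.of_contDiff _ _ hs)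
      fun y hy => (hasDerivAt_fourier_Kf δ 0 smoothCompact_cutoff hβ hy).congr_deriv ?_
    simp
  | succ j ih =>
    have ih' := ih ((smoothCompact_cutoff.euler.Kf_of_eventually_zero β δ j
      euler_cutoff_eventually_zero).contDiff_fourier)
    exact LogForm.of_hasDerivAt ((ih'.const_mul (-((j + 1 : ℕ) : ℂ))).add (.of_contDiff _ _ hs))
      fun y hy => hasDerivAt_fourier_Kf δ (j + 1) smoothCompact_cutoff hβ hy

lemma Kf_pow_mul (β : ℂ) (δ : ZMod 2) (j m : ℕ) (c : ℝ → ℂ) :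
    Kf β δ j (fun u => (u : ℂ) ^ m * c u) = Kf (β + m) (δ + m) j c := by
  ext x
  simp only [Kf]
  rw [← mul_assoc, Complex.ofReal_inv, inv_pow, pw_div_pow]
  congr 2; ring

/-- The Fourier transform of a monomial term, relative to a fixed exponent `γ = β - 1`. -/
lemma fourier_Kf_pow_cutoff {β : ℂ} (hβ : 2 < β.re) (δ : ZMod 2) (j m : ℕ) :
    ∃ (a b : ℕ → ℂ) (B : ℝ → ℂ), ContDiff ℝ ∞ B ∧ ∀ y : ℝ, y ≠ 0 →
      𝓕 (Kf β δ j (fun u => (u : ℂ) ^ m * cutoff u)) y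
        = ∑ i ∈ Finset.range (j + 2),
          (a i * pw (β - 1) 0 i y + b i * pw (β - 1) 1 i y) * (y : ℂ) ^ m + B y := by
  obtain ⟨a, b, B, hB, h⟩ := logForm_fourier_Kf_cutoff (β := β + m)
    (by simp; linarith [(Nat.cast_nonneg m : (0 : ℝ) ≤ m)]) (δ + m) j
  rw [Kf_pow_mul]
  have e (δ' : ZMod 2) (i : ℕ) (y : ℝ) :
      pw (β + m - 1) δ' i y = pw (β - 1) (δ' + m) i y * (y : ℂ) ^ m := by
    rw [pw_mul_pow, ZMod.two_add_cancel]; congr 1; ring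
  -- Extracting `y^m` from `|y|^(β+m-1)` exchanges the even and odd coefficients when `m` is odd.
  rcases ZMod.two_cases (m : ZMod 2) with hm | hm
  · refine ⟨a, b, B, hB, fun y hy => ?_⟩
    rw [h y hy]
    simp only [e, hm, add_zero]
    congr 1
    exact Finset.sum_congr rfl fun i _ => by ring
  · refine ⟨b, a, B, hB, fun y hy => ?_⟩
    rw [h y hy]
    simp only [e, hm, zero_add, show (1 : ZMod 2) + 1 = 0 from rfl]
    congr 1
    exact Finset.sum_congr rfl fun i _ => by ring

/-- Taylor expansion of a function with compact support, with a cutoff. -/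
lemma SmoothCompact.taylor {c : ℝ → ℂ} (hc : SmoothCompact c) (M : ℕ) :
    ∃ r : ℝ → ℂ, SmoothCompact r ∧ ∀ u : ℝ,
      c u = ∑ m ∈ Finset.range M, taylorCoeff c m * ((u : ℂ) ^ m * cutoff u)
        + (u : ℂ) ^ M * r u := by
  -- Inserting the cutoff changes the Taylor polynomial by a function vanishing near `0`, which is
  -- moved into the remainder.
  obtain ⟨R, hR, hR'⟩ := exists_eq_pow_mul_of_eventually_zero
    (Z := fun u => ∑ m ∈ Finset.range M, taylorCoeff c m * ((u : ℂ) ^ m * (1 - cutoff u)))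
    (ContDiff.sum fun m _ => contDiff_const.mul
      ((contDiff_ofReal.pow m).mul (contDiff_const.sub contDiff_cutoff))) (by
      filter_upwards [Metric.closedBall_mem_nhds (0 : ℝ) one_pos] with u hu
      simp [cutoff_eq_one (show |u| ≤ 1 by simpa using hu)]) M
  have key (u : ℝ) : c u = ∑ m ∈ Finset.range M, taylorCoeff c m * ((u : ℂ) ^ m * cutoff u)
      + (u : ℂ) ^ M * ((hadamardQuot^[M] c) u + R u) := by
    rw [mul_add, ← hR' u]
    conv_lhs => rw [eq_sum_taylorCoeff hc.smooth M u]
    simp only [mul_sub, mul_one, Finset.sum_sub_distrib]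
    ring
  refine ⟨fun u => (hadamardQuot^[M] c) u + R u,
    ⟨(contDiff_hadamardQuot_iterate hc.smooth M).add hR, ?_⟩, key⟩
  rw [hasCompactSupport_iff_eventuallyEq, coclosedCompact_eq_cocompact,
    ← Metric.cobounded_eq_cocompact]
  filter_upwards [eventually_cobounded_eq_zero hc.supp,
    eventually_cobounded_eq_zero hasCompactSupport_cutoff, eventually_ne_cobounded (0 : ℝ)]
    with u h1 h2 h3
  have := key u
  rw [h1.self_of_nhds, h2.self_of_nhds] at this
  simp only [mul_zero, Finset.sum_const_zero, zero_add] at this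
  exact (mul_eq_zero.1 this.symm).resolve_left (pow_ne_zero _ (by exact_mod_cast h3))

/-- A function which, for all `n`, agrees off `0` with a `C^n` function, agrees off `0` with a smooth
function. -/
lemma exists_contDiff_of_forall_nat {B : ℝ → ℂ}
    (h : ∀ n : ℕ, ∃ Bn : ℝ → ℂ, ContDiff ℝ n Bn ∧ ∀ y ≠ 0, B y = Bn y) :
    ∃ B' : ℝ → ℂ, ContDiff ℝ ∞ B' ∧ ∀ y ≠ 0, B y = B' y := by
  choose Bn hBn hB using h
  refine ⟨Bn 0, contDiff_infty.2 fun n => ?_, hB 0⟩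
  have : Bn 0 = Bn n := (hBn 0).continuous.ext_on (dense_compl_singleton (0 : ℝ))
    (hBn n).continuous fun y hy => (hB 0 y hy).symm.trans (hB n y hy)
  rw [this]; exact hBn n

/-- The Fourier transform of `Kf β δ j c` has a simple singularity at `0`. -/
lemma fourier_Kf_eq {β : ℂ} (hβ : 2 < β.re) (δ : ZMod 2) (j : ℕ) {c : ℝ → ℂ}
    (hc : SmoothCompact c) :
    ∃ (A A' : ℕ → ℝ → ℂ) (B : ℝ → ℂ), (∀ i, ContDiff ℝ ∞ (A i)) ∧ (∀ i, ContDiff ℝ ∞ (A' i)) ∧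
      ContDiff ℝ ∞ B ∧ ∀ y : ℝ, y ≠ 0 → 𝓕 (Kf β δ j c) y
        = ∑ i ∈ Finset.range (j + 2), (A i y * pw (β - 1) 0 i y + A' i y * pw (β - 1) 1 i y)
          + B y := by
  choose a b Bm hBm hm using fun m => fourier_Kf_pow_cutoff hβ δ j m
  -- Borel summation of the coefficients of `|y|^(β-1) (log |y|)^i` over all Taylor terms of `c`.
  choose A hA R hR hAR using fun i =>
    exists_contDiff_with_taylor fun m => taylorCoeff c m * a m i
  choose A' hA' R' hR' hAR' using fun i =>
    exists_contDiff_with_taylor fun m => taylorCoeff c m * b m i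
  -- Expanding `c` to order `n`, the Taylor terms cancel the partial Borel sums up to smooth
  -- functions. The remainder `u^n r` has exponent `β + n`, so its transform is `C^n`, and the Borel
  -- remainders carry exponent `β - 1 + n`, whose real part exceeds `n`.
  obtain ⟨B, hB, hBeq⟩ := exists_contDiff_of_forall_nat (B := fun y => 𝓕 (Kf β δ j c) y
      - ∑ i ∈ Finset.range (j + 2), (A i y * pw (β - 1) 0 i y + A' i y * pw (β - 1) 1 i y))
    (fun n => by
      obtain ⟨r, hr, hcr⟩ := hc.taylor n
      have hn : (0 : ℝ) ≤ n := Nat.cast_nonneg n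
      refine ⟨fun y => 𝓕 (Kf (β + n) (δ + n) j r) y
        + ∑ m ∈ Finset.range n, taylorCoeff c m * Bm m y
        - ∑ i ∈ Finset.range (j + 2), (R i n y * pw (β - 1 + n) (0 + n) i y
          + R' i n y * pw (β - 1 + n) (1 + n) i y), ?_, fun y hy => ?_⟩
      · have hp (δ' : ZMod 2) (i : ℕ) : ContDiff ℝ n (pw (β - 1 + n) δ' i) :=
          contDiff_pw δ' i (by simp; linarith)
        refine ((contDiff_fourier_Kf _ j hr (by simp; linarith)).add (ContDiff.sum fun m _ =>
          contDiff_const.mul ((hBm m).of_le (by exact_mod_cast le_top)))).sub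
          (ContDiff.sum fun i _ => ?_)
        exact (((hR i n).of_le (by exact_mod_cast le_top)).mul (hp _ i)).add
          (((hR' i n).of_le (by exact_mod_cast le_top)).mul (hp _ i))
      · have hK : Kf β δ j c = fun x => ∑ m ∈ Finset.range n, taylorCoeff c m *
            Kf β δ j (fun u => (u : ℂ) ^ m * cutoff u) x + Kf (β + n) (δ + n) j r x := by
          ext x
          rw [← Kf_pow_mul]
          simp only [Kf]
          rw [hcr x⁻¹, mul_add, Finset.mul_sum]
          congr 1
          exact Finset.sum_congr rfl fun m _ => by ring
        have i1 (m : ℕ) : Integrable fun x => taylorCoeff c m *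
            Kf β δ j (fun u => (u : ℂ) ^ m * cutoff u) x := by
          rw [Kf_pow_mul]
          refine (integrable_Kf _ j smoothCompact_cutoff ?_).const_mul _
          simp; linarith [(Nat.cast_nonneg m : (0 : ℝ) ≤ m)]
        have i2 : Integrable (Kf (β + n) (δ + n) j r) :=
          integrable_Kf _ j hr (by simp; linarith)
        have hF : 𝓕 (Kf β δ j c) y = ∑ m ∈ Finset.range n, taylorCoeff c m *
            (∑ i ∈ Finset.range (j + 2),
              (a m i * pw (β - 1) 0 i y + b m i * pw (β - 1) 1 i y) * (y : ℂ) ^ m + Bm m y)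
            + 𝓕 (Kf (β + n) (δ + n) j r) y := by
          rw [hK, fourier_add_apply (integrable_finsetSum _ fun m _ => i1 m) i2,
            fourier_sum_apply _ fun m _ => i1 m]
          congr 1
          exact Finset.sum_congr rfl fun m _ => by rw [fourier_const_mul_apply, hm m y hy]
        have hAsum : ∑ i ∈ Finset.range (j + 2),
            (A i y * pw (β - 1) 0 i y + A' i y * pw (β - 1) 1 i y)
            = ∑ m ∈ Finset.range n, taylorCoeff c m * (∑ i ∈ Finset.range (j + 2),
              (a m i * pw (β - 1) 0 i y + b m i * pw (β - 1) 1 i y) * (y : ℂ) ^ m)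
              + ∑ i ∈ Finset.range (j + 2), (R i n y * pw (β - 1 + n) (0 + n) i y
          + R' i n y * pw (β - 1 + n) (1 + n) i y) := by
          simp only [Finset.mul_sum]
          rw [Finset.sum_comm, ← Finset.sum_add_distrib]
          refine Finset.sum_congr rfl fun i _ => ?_
          rw [hAR i n y, hAR' i n y, ← pw_mul_pow, ← pw_mul_pow, add_mul, add_mul, Finset.sum_mul,
            Finset.sum_mul]
          rw [show ∑ m ∈ Finset.range n, taylorCoeff c m *
            ((a m i * pw (β - 1) 0 i y + b m i * pw (β - 1) 1 i y) * (y : ℂ) ^ m)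
            = ∑ m ∈ Finset.range n, taylorCoeff c m * a m i * (y : ℂ) ^ m * pw (β - 1) 0 i y
             + ∑ m ∈ Finset.range n, taylorCoeff c m * b m i * (y : ℂ) ^ m * pw (β - 1) 1 i y by
            rw [← Finset.sum_add_distrib]
            exact Finset.sum_congr rfl fun m _ => by ring]
          ring
        rw [hF, hAsum]
        simp only [mul_add, Finset.sum_add_distrib]
        ring)
  refine ⟨A, A', B, hA, hA', hB, fun y hy => ?_⟩
  rw [← hBeq y hy]
  ring

/-! ### Closure properties of simple singularities -/

lemma HasSimpleSingularity.congr {f g : ℝ → ℂ} (hf : HasSimpleSingularity f)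
    (h : ∀ᶠ x in 𝓝[≠] 0, g x = f x) : HasSimpleSingularity g := by
  obtain ⟨m, α, η, s, hs, ε, hε, hf⟩ := hf
  rw [eventually_nhdsWithin_iff, Metric.eventually_nhds_iff] at h
  obtain ⟨ε', hε', h⟩ := h
  refine ⟨m, α, η, s, hs, min ε ε', lt_min hε hε', fun x h0 hx => ?_⟩
  rw [h (by simpa using hx.trans_le (min_le_right _ _)) (by simpa using h0)]
  exact hf x h0 (hx.trans_le (min_le_left _ _))

lemma HasSimpleSingularity.of_contDiff_mul_pw {c : ℝ → ℂ} (hc : ContDiff ℝ ∞ c) (γ : ℂ)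
    (δ : ZMod 2) (i : ℕ) : HasSimpleSingularity fun y => c y * pw γ δ i y := by
  refine ⟨1, fun _ => γ, fun _ => δ, fun _ y => c y * pw γ δ i y, fun _ => ?_, 1, one_pos, by simp⟩
  refine ⟨1, one_pos, i, fun j => if j = i then c else 0, fun j _ => ?_, fun x h0 _ => ?_⟩
  · beta_reduce
    split_ifs
    · exact hc.contDiffOn
    · exact contDiffOn_const
  · beta_reduce
    rw [Finset.sum_range_succ, Finset.sum_eq_zero fun j hj => by
      simp [(Finset.mem_range.1 hj).ne], pw_of_ne _ _ _ (abs_pos.1 h0)]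
    simp only [if_true]
    ring

lemma HasSimpleSingularity.of_contDiff {c : ℝ → ℂ} (hc : ContDiff ℝ ∞ c) :
    HasSimpleSingularity c := by
  refine (HasSimpleSingularity.of_contDiff_mul_pw hc 0 0 0).congr ?_
  filter_upwards [self_mem_nhdsWithin] with x hx
  simp [pw_of_ne _ _ _ (show x ≠ 0 from hx), sgPow_zero_left]

lemma HasSimpleSingularity.add {f g : ℝ → ℂ} (hf : HasSimpleSingularity f)
    (hg : HasSimpleSingularity g) : HasSimpleSingularity fun x => f x + g x := by
  obtain ⟨m, α, η, s, hs, ε, hε, hf⟩ := hf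
  obtain ⟨m', α', η', s', hs', ε', hε', hg⟩ := hg
  refine ⟨m + m', Fin.append α α', Fin.append η η', Fin.append s s', fun j => ?_, min ε ε',
    lt_min hε hε', fun x h0 hx => ?_⟩
  · refine Fin.addCases (fun j => ?_) (fun j => ?_) j
    · simpa using hs j
    · simpa using hs' j
  · beta_reduce
    rw [hf x h0 (hx.trans_le (min_le_left _ _)), hg x h0 (hx.trans_le (min_le_right _ _)),
      Fin.sum_univ_add]
    simp

lemma HasSimpleSingularity.sum {ι : Type*} (s : Finset ι) {f : ι → ℝ → ℂ}
    (hf : ∀ i ∈ s, HasSimpleSingularity (f i)) :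
    HasSimpleSingularity fun x => ∑ i ∈ s, f i x := by
  classical
  induction s using Finset.induction_on with
  | empty => simpa using HasSimpleSingularity.of_contDiff (contDiff_const (c := (0 : ℂ)))
  | insert i s hi ih =>
    simp only [Finset.sum_insert hi]
    exact (hf i (Finset.mem_insert_self i s)).add
      (ih fun k hk => hf k (Finset.mem_insert_of_mem hk))

lemma HasSimpleSingularity.mul_inv_pow {f : ℝ → ℂ} (hf : HasSimpleSingularity f) (k : ℂ) (N : ℕ) :
    HasSimpleSingularity fun x => (k * (x : ℂ) ^ N)⁻¹ * f x := by
  obtain ⟨m, α, η, s, hs, ε, hε, hf⟩ := hf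
  refine ⟨m, fun j => α j - N, fun j => η j + N, fun j x => (k * (x : ℂ) ^ N)⁻¹ * s j x,
    fun j => ?_, ε, hε, fun x h0 hx => by
      beta_reduce; rw [hf x h0 hx, Finset.mul_sum]⟩
  obtain ⟨ε', hε', n, c, hc, h⟩ := hs j
  refine ⟨ε', hε', n, fun i x => k⁻¹ * c i x, fun i hi => contDiffOn_const.mul (hc i hi),
    fun x h0 hx => ?_⟩
  beta_reduce
  rw [h x h0 hx, Finset.mul_sum]
  refine Finset.sum_congr rfl fun i _ => ?_
  have hx0 := abs_pos.1 h0
  have := pw_div_pow (α j) (η j) i N x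
  rw [pw_of_ne _ _ _ hx0, pw_of_ne _ _ _ hx0] at this
  rw [← this, mul_inv]
  ring

lemma hasSimpleSingularity_fourier_Kf {β : ℂ} (hβ : 2 < β.re) (δ : ZMod 2) (j : ℕ) {c : ℝ → ℂ}
    (hc : SmoothCompact c) : HasSimpleSingularity (𝓕 (Kf β δ j c)) := by
  obtain ⟨A, A', B, hA, hA', hB, h⟩ := fourier_Kf_eq hβ δ j hc
  refine ((HasSimpleSingularity.sum (Finset.range (j + 2)) fun i _ =>
    (HasSimpleSingularity.of_contDiff_mul_pw (hA i) (β - 1) 0 i).add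
      (HasSimpleSingularity.of_contDiff_mul_pw (hA' i) (β - 1) 1 i)).add
    (HasSimpleSingularity.of_contDiff hB)).congr ?_
  filter_upwards [self_mem_nhdsWithin] with y hy using h y hy

/-! ### Symbols -/

/-- `G` is a symbol of order `a`: it is smooth, and its `k`-th derivative is `O(|x|^(a-k))`. -/
structure IsSymbol (a : ℝ) (G : ℝ → ℂ) : Prop where
  smooth : ContDiff ℝ ∞ G
  bound : ∀ k : ℕ, iteratedDeriv k G =O[cobounded ℝ] fun x => |x| ^ (a - k)

lemma rpow_isBigO_cobounded {a b : ℝ} (h : a ≤ b) :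
    (fun x : ℝ => |x| ^ a) =O[cobounded ℝ] fun x => |x| ^ b := by
  refine IsBigO.of_bound 1 ?_
  filter_upwards [eventually_one_le_abs_cobounded] with x hx
  rw [one_mul, Real.norm_of_nonneg (Real.rpow_nonneg (abs_nonneg x) _),
    Real.norm_of_nonneg (Real.rpow_nonneg (abs_nonneg x) _)]
  exact Real.rpow_le_rpow_of_exponent_le hx h

lemma contDiff_iteratedDeriv {G : ℝ → ℂ} (hG : ContDiff ℝ ∞ G) (k : ℕ) :
    ContDiff ℝ ∞ (iteratedDeriv k G) := by
  induction k with
  | zero => simpa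
  | succ k ih => rw [iteratedDeriv_succ]; exact (contDiff_infty_iff_deriv.1 ih).2

lemma contDiffAt_nat {G : ℝ → ℂ} {x : ℝ} (hG : ContDiffAt ℝ ∞ G x) (k : ℕ) : ContDiffAt ℝ k G x :=
  hG.of_le (by exact_mod_cast le_top)

lemma iteratedDeriv_fun_add_eq {F G : ℝ → ℂ} (hF : ContDiff ℝ ∞ F) (hG : ContDiff ℝ ∞ G) (k : ℕ) :
    iteratedDeriv k (fun x => F x + G x) = fun x => iteratedDeriv k F x + iteratedDeriv k G x := by
  ext x
  exact iteratedDeriv_fun_add (contDiffAt_nat hF.contDiffAt k) (contDiffAt_nat hG.contDiffAt k)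

lemma IsSymbol.mono {a b : ℝ} {G : ℝ → ℂ} (hG : IsSymbol a G) (h : a ≤ b) : IsSymbol b G :=
  ⟨hG.smooth, fun k => (hG.bound k).trans (rpow_isBigO_cobounded (by linarith))⟩

lemma IsSymbol.add {a : ℝ} {F G : ℝ → ℂ} (hF : IsSymbol a F) (hG : IsSymbol a G) :
    IsSymbol a fun x => F x + G x where
  smooth := hF.smooth.add hG.smooth
  bound k := by
    rw [iteratedDeriv_fun_add_eq hF.smooth hG.smooth]
    exact (hF.bound k).add (hG.bound k)

lemma IsSymbol.integrable_pow_mul {a : ℝ} {G : ℝ → ℂ} (hG : IsSymbol a G) {n N : ℕ}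
    (h : a + n + 1 < N) : Integrable fun x : ℝ => (x : ℂ) ^ n * iteratedDeriv N G x := by
  have hx : (fun x : ℝ => (x : ℂ) ^ n) =O[cobounded ℝ] fun x => |x| ^ (n : ℝ) :=
    IsBigO.of_bound 1 (Eventually.of_forall fun x => by simp)
  refine integrable_of_isBigO (s := n + (a - N))
    ((Complex.continuous_ofReal.pow n).mul (contDiff_iteratedDeriv hG.smooth N).continuous)
    (by linarith) ((hx.mul (hG.bound N)).congr' .rfl ?_)
  filter_upwards [eventually_ne_cobounded (0 : ℝ)] with x hx
  rw [Real.rpow_add (abs_pos.2 hx)]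

lemma IsSymbol.integrable {a : ℝ} {G : ℝ → ℂ} (hG : IsSymbol a G) {N : ℕ} (h : a + 1 < N) :
    Integrable (iteratedDeriv N G) := by
  simpa using hG.integrable_pow_mul (n := 0) (N := N) (by simpa using h)

lemma SmoothCompact.isSymbol {c : ℝ → ℂ} (hc : SmoothCompact c) (a : ℝ) : IsSymbol a c where
  smooth := hc.smooth
  bound k := by
    refine IsBigO.of_bound 0 ?_
    filter_upwards [eventually_cobounded_eq_zero (hc.iteratedDeriv k).supp] with x hx
    simp [hx.self_of_nhds]

/-- The regularized Fourier transform of a symbol. -/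
noncomputable def regFourier (N : ℕ) (G : ℝ → ℂ) (y : ℝ) : ℂ :=
  ((2 * Real.pi * Complex.I) ^ N * (y : ℂ) ^ N)⁻¹ * 𝓕 (iteratedDeriv N G) y

lemma regFourier_succ {G : ℝ → ℂ} (hG : ContDiff ℝ ∞ G) {N : ℕ}
    (h1 : Integrable (iteratedDeriv N G)) (h2 : Integrable (iteratedDeriv (N + 1) G)) {y : ℝ}
    (hy : y ≠ 0) : regFourier (N + 1) G y = regFourier N G y := by
  have hy' : (y : ℂ) ≠ 0 := by exact_mod_cast hy
  have hpi : (2 * Real.pi * Complex.I : ℂ) ≠ 0 := Complex.two_pi_I_ne_zero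
  rw [iteratedDeriv_succ] at h2
  have := Real.fourier_deriv h1 ((contDiff_iteratedDeriv hG N).differentiable (by simp)) h2
  rw [regFourier, regFourier, iteratedDeriv_succ, this]
  simp only [smul_eq_mul]
  rw [pow_succ, pow_succ]
  have e : (2 * Real.pi * Complex.I : ℂ) ^ N * (2 * Real.pi * Complex.I) * ((y : ℂ) ^ N * y)
      = (2 * Real.pi * Complex.I) ^ N * (y : ℂ) ^ N * (2 * Real.pi * Complex.I * y) := by ring
  rw [e, mul_inv, mul_assoc, inv_mul_cancel_left₀ (mul_ne_zero hpi hy')]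

/-- One more derivative multiplies the Fourier transform by `2πiy`, which the prefactor cancels. -/
lemma IsSymbol.regFourier_eq {a : ℝ} {G : ℝ → ℂ} (hG : IsSymbol a G) {N N' : ℕ}
    (hN : a + 1 < N) (h : N ≤ N') {y : ℝ} (hy : y ≠ 0) :
    regFourier N' G y = regFourier N G y := by
  induction N', h using Nat.le_induction with
  | base => rfl
  | succ k hk ih =>
    have hk' : (N : ℝ) ≤ k := by exact_mod_cast hk
    rw [regFourier_succ hG.smooth (hG.integrable (by linarith))
      (hG.integrable (by push_cast; linarith)) hy, ih]

lemma SmoothCompact.regFourier_eq {c : ℝ → ℂ} (hc : SmoothCompact c) (N : ℕ) {y : ℝ}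
    (hy : y ≠ 0) : regFourier N c y = ∫ x, ey y x * c x := by
  rw [(hc.isSymbol (-2)).regFourier_eq (N := 0) (by norm_num) N.zero_le hy,
    ← fourier_eq_integral]
  simp [regFourier]

lemma regFourier_add {a : ℝ} {F G : ℝ → ℂ} (hF : IsSymbol a F) (hG : IsSymbol a G) {N : ℕ}
    (hN : a + 1 < N) (y : ℝ) :
    regFourier N (fun x => F x + G x) y = regFourier N F y + regFourier N G y := by
  rw [regFourier, iteratedDeriv_fun_add_eq hF.smooth hG.smooth,
    fourier_add_apply (hF.integrable hN) (hG.integrable hN), mul_add]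
  rfl

/-! ### Symbols whose Fourier transform has a simple singularity -/

/-- A symbol such that the Fourier transforms of its high derivatives have a simple
singularity at `0`. -/
structure IsTame (a : ℝ) (G : ℝ → ℂ) : Prop extends IsSymbol a G where
  fourier : ∃ N₀ : ℕ, ∀ N ≥ N₀, HasSimpleSingularity (𝓕 (iteratedDeriv N G))

lemma IsTame.add {a b : ℝ} {F G : ℝ → ℂ} (hF : IsTame a F) (hG : IsTame b G) :
    IsTame (max a b) fun x => F x + G x where
  toIsSymbol := (hF.toIsSymbol.mono (le_max_left a b)).add (hG.toIsSymbol.mono (le_max_right a b))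
  fourier := by
    obtain ⟨N₁, h₁⟩ := hF.fourier
    obtain ⟨N₂, h₂⟩ := hG.fourier
    obtain ⟨N₃, h₃⟩ := exists_nat_gt (max a b + 1)
    refine ⟨max N₁ (max N₂ N₃), fun N hN => ?_⟩
    have hN₃ : (N₃ : ℝ) ≤ N := by
      exact_mod_cast (le_max_right _ _).trans ((le_max_right _ _).trans hN)
    have e : 𝓕 (iteratedDeriv N fun x => F x + G x)
        = fun y => 𝓕 (iteratedDeriv N F) y + 𝓕 (iteratedDeriv N G) y := by
      ext y
      rw [iteratedDeriv_fun_add_eq hF.smooth hG.smooth, fourier_add_apply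
        (hF.integrable (by linarith [le_max_left a b]))
        (hG.integrable (by linarith [le_max_right a b]))]
    rw [e]
    exact (h₁ N ((le_max_left _ _).trans hN)).add
      (h₂ N ((le_max_left _ _).trans ((le_max_right _ _).trans hN)))

lemma SmoothCompact.isTame {c : ℝ → ℂ} (hc : SmoothCompact c) : IsTame 0 c where
  toIsSymbol := hc.isSymbol 0
  fourier := ⟨0, fun N _ => .of_contDiff (hc.iteratedDeriv N).contDiff_fourier⟩

lemma SmoothCompact.const_mul {c : ℝ → ℂ} (hc : SmoothCompact c) (k : ℂ) :
    SmoothCompact fun u => k * c u :=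
  ⟨contDiff_const.mul hc.smooth, hc.supp.mul_left⟩

/-- Finite sums of functions `Kf β δ j c`, with `β` and `δ` fixed. -/
def KfSums (β : ℂ) (δ : ZMod 2) : AddSubmonoid (ℝ → ℂ) :=
  AddSubmonoid.closure {g | ∃ (j : ℕ) (c : ℝ → ℂ), SmoothCompact c ∧ g = Kf β δ j c}

lemma Kf_mem_KfSums (β : ℂ) (δ : ZMod 2) (j : ℕ) {c : ℝ → ℂ} (hc : SmoothCompact c) :
    Kf β δ j c ∈ KfSums β δ :=
  AddSubmonoid.subset_closure ⟨j, c, hc, rfl⟩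

lemma const_mul_Kf_mem_KfSums (k β : ℂ) (δ : ZMod 2) (j : ℕ) {c : ℝ → ℂ} (hc : SmoothCompact c) :
    (fun x => k * Kf β δ j c x) ∈ KfSums β δ := by
  have : (fun x => k * Kf β δ j c x) = Kf β δ j fun u => k * c u := by
    ext x; simp only [Kf]; ring
  rw [this]
  exact Kf_mem_KfSums β δ j (hc.const_mul k)

lemma contDiff_of_mem_KfSums {β : ℂ} {δ : ZMod 2} {g : ℝ → ℂ} (hg : g ∈ KfSums β δ) :
    ContDiff ℝ ∞ g := by
  induction hg using AddSubmonoid.closure_induction with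
  | mem g hg => obtain ⟨j, c, hc, rfl⟩ := hg; exact contDiff_Kf β δ j hc.rapidDecay
  | zero => exact contDiff_const
  | add f g _ _ hf hg => exact hf.add hg

/-- Each derivative raises `β` by one. This yields the symbol estimates, and brings high derivatives
into the range `Re β > 2` where the singularity of the transform is known. -/
lemma deriv_mem_KfSums {β : ℂ} {δ : ZMod 2} {g : ℝ → ℂ} (hg : g ∈ KfSums β δ) :
    deriv g ∈ KfSums (β + 1) (δ + 1) := by
  induction hg using AddSubmonoid.closure_induction with
  | mem g hg =>
    obtain ⟨j, c, hc, rfl⟩ := hg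
    rw [deriv_Kf β δ j hc.rapidDecay]
    have e : KfDeriv β δ j c = (fun x => -β * Kf (β + 1) (δ + 1) j c x)
        + (fun x => (j : ℂ) * Kf (β + 1) (δ + 1) (j - 1) c x)
        + (fun x => -1 * Kf (β + 1) (δ + 1) j (euler c) x) := by
      ext x; simp only [KfDeriv, Pi.add_apply]; ring
    rw [e]
    exact add_mem (add_mem (const_mul_Kf_mem_KfSums _ _ _ _ hc) (const_mul_Kf_mem_KfSums _ _ _ _ hc))
      (const_mul_Kf_mem_KfSums _ _ _ _ hc.euler)
  | zero =>
    have : deriv (0 : ℝ → ℂ) = 0 := by ext x; simp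
    rw [this]; exact zero_mem _
  | add f g hf' hg' hf hg =>
    have : deriv (f + g) = deriv f + deriv g := by
      ext x
      exact deriv_add ((contDiff_of_mem_KfSums hf').differentiable (by simp) x)
        ((contDiff_of_mem_KfSums hg').differentiable (by simp) x)
    rw [this]; exact add_mem hf hg

lemma iteratedDeriv_mem_KfSums {β : ℂ} {δ : ZMod 2} {g : ℝ → ℂ} (hg : g ∈ KfSums β δ) (k : ℕ) :
    iteratedDeriv k g ∈ KfSums (β + k) (δ + k) := by
  induction k with
  | zero => simpa using hg
  | succ k ih =>
    rw [iteratedDeriv_succ]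
    push_cast
    rw [← add_assoc, ← add_assoc]
    exact deriv_mem_KfSums ih

lemma isBigO_of_mem_KfSums {β : ℂ} {δ : ZMod 2} {g : ℝ → ℂ} (hg : g ∈ KfSums β δ) {a : ℝ}
    (ha : -β.re < a) : g =O[cobounded ℝ] fun x => |x| ^ a := by
  induction hg using AddSubmonoid.closure_induction with
  | mem g hg =>
    obtain ⟨j, c, hc, rfl⟩ := hg
    exact Kf_isBigO_cobounded δ j hc.smooth.continuous.continuousAt ha
  | zero => exact isBigO_zero _ _
  | add f g _ _ hf hg => exact hf.add hg

lemma fourier_of_mem_KfSums {β : ℂ} (hβ : 2 < β.re) {δ : ZMod 2} {g : ℝ → ℂ}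
    (hg : g ∈ KfSums β δ) : Integrable g ∧ HasSimpleSingularity (𝓕 g) := by
  induction hg using AddSubmonoid.closure_induction with
  | mem g hg =>
    obtain ⟨j, c, hc, rfl⟩ := hg
    exact ⟨integrable_Kf δ j hc (by linarith), hasSimpleSingularity_fourier_Kf hβ δ j hc⟩
  | zero =>
    refine ⟨integrable_zero _ _ _, ?_⟩
    have : 𝓕 (0 : ℝ → ℂ) = fun _ => (0 : ℂ) := by
      ext y; rw [fourier_eq_integral]; simp
    rw [this]
    exact .of_contDiff contDiff_const
  | add f g _ _ hf hg =>
    refine ⟨hf.1.add hg.1, ?_⟩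
    have : 𝓕 (f + g) = fun y => 𝓕 f y + 𝓕 g y := by
      ext y; exact fourier_add_apply hf.1 hg.1 y
    rw [this]
    exact hf.2.add hg.2

/-- The extra `1` in the order leaves room for the logarithms. -/
lemma isTame_Kf (β : ℂ) (δ : ZMod 2) (j : ℕ) {c : ℝ → ℂ} (hc : SmoothCompact c) :
    IsTame (-β.re + 1) (Kf β δ j c) where
  smooth := contDiff_Kf β δ j hc.rapidDecay
  bound k := isBigO_of_mem_KfSums (iteratedDeriv_mem_KfSums (Kf_mem_KfSums β δ j hc) k)
    (by simp; linarith)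
  fourier := by
    obtain ⟨N₀, h⟩ := exists_nat_gt (2 - β.re)
    refine ⟨N₀, fun N hN => (fourier_of_mem_KfSums ?_
      (iteratedDeriv_mem_KfSums (Kf_mem_KfSums β δ j hc) N)).2⟩
    have : (N₀ : ℝ) ≤ N := by exact_mod_cast hN
    simp; linarith

/-! ### Inversion of functions with a simple singularity -/

lemma exists_smoothCompact_eventuallyEq {c : ℝ → ℂ} {ε : ℝ} (hε : 0 < ε)
    (hc : ContDiffOn ℝ ∞ c (Set.Ioo (-ε) ε)) :
    ∃ c' : ℝ → ℂ, SmoothCompact c' ∧ ∀ᶠ u in 𝓝 0, c' u = c u := by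
  -- At this scale the cutoff is `1` for `|u| ≤ ε/4` and vanishes for `|u| ≥ ε/2`, well inside the
  -- interval where `c` is smooth.
  have hcut (u : ℝ) (hu : ε / 2 ≤ |u|) : cutoff (4 / ε * u) = 0 := by
    rw [cutoff, ContDiffBump.zero_of_le_dist]
    · simp
    · have : 2 ≤ 4 / ε * |u| := by
        rw [div_mul_eq_mul_div, le_div_iff₀ hε]; linarith
      simpa [abs_mul, abs_of_pos hε] using this
  refine ⟨fun u => cutoff (4 / ε * u) * c u, ⟨?_, ?_⟩, ?_⟩
  · refine contDiff_iff_contDiffAt.2 fun u => ?_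
    by_cases hu : |u| < ε
    · exact (contDiff_cutoff.comp (by fun_prop : ContDiff ℝ ∞ fun u : ℝ => 4 / ε * u)).contDiffAt.mul
        (hc.contDiffAt (Ioo_mem_nhds (abs_lt.1 hu).1 (abs_lt.1 hu).2))
    · refine (contDiffAt_const (c := (0 : ℂ))).congr_of_eventuallyEq ?_
      have : ∀ᶠ z : ℝ in 𝓝 u, ε / 2 < |z| :=
        continuous_abs.continuousAt.eventually_const_lt (by linarith)
      filter_upwards [this] with z hz
      simp [hcut z hz.le]
  · refine HasCompactSupport.intro (isCompact_Icc (a := -ε) (b := ε)) fun u hu => ?_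
    have : ε < |u| := by
      by_contra h
      exact hu (abs_le.1 (not_lt.1 h))
    simp [hcut u (by linarith)]
  · filter_upwards [Metric.ball_mem_nhds (0 : ℝ) (show 0 < ε / 4 by linarith)] with u hu
    rw [cutoff_eq_one, one_mul]
    have hu' : |u| < ε / 4 := by simpa using hu
    rw [abs_mul, abs_of_pos (by positivity : 0 < 4 / ε), div_mul_eq_mul_div, div_le_one hε]
    linarith

lemma exists_isTame_sum {ι : Type*} (s : Finset ι) {g : ι → ℝ → ℂ}
    (hg : ∀ i ∈ s, ∃ (a : ℝ) (G : ℝ → ℂ), IsTame a G ∧ ∀ᶠ x in cobounded ℝ, g i x = G x) :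
    ∃ (a : ℝ) (G : ℝ → ℂ), IsTame a G ∧ ∀ᶠ x in cobounded ℝ, ∑ i ∈ s, g i x = G x := by
  classical
  induction s using Finset.induction_on with
  | empty =>
    exact ⟨0, fun _ => 0, SmoothCompact.isTame ⟨contDiff_const, HasCompactSupport.zero⟩, by simp⟩
  | insert i s hi ih =>
    obtain ⟨a, G, hG, h⟩ := hg i (Finset.mem_insert_self i s)
    obtain ⟨a', G', hG', h'⟩ := ih fun k hk => hg k (Finset.mem_insert_of_mem hk)
    refine ⟨_, _, hG.add hG', ?_⟩
    filter_upwards [h, h'] with x hx hx'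
    rw [Finset.sum_insert hi, hx, hx']

lemma eventually_nhdsNE_of_abs_lt {p : ℝ → Prop} {ε : ℝ} (hε : 0 < ε)
    (h : ∀ x : ℝ, 0 < |x| → |x| < ε → p x) : ∀ᶠ x in 𝓝[≠] (0 : ℝ), p x := by
  rw [eventually_nhdsWithin_iff]
  filter_upwards [Metric.ball_mem_nhds (0 : ℝ) hε] with x hx hx0
  exact h x (abs_pos.2 hx0) (by simpa using hx)

/-- Near infinity each term of the singular expansion becomes, under inversion, a function `Kf` of
the localized coefficient, with a sign `(-1)^j` from `log |1/x| = -log |x|`. -/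
lemma HasSimpleSingularity.exists_isTame {f : ℝ → ℂ} (hf : HasSimpleSingularity f) (γ : ℂ)
    (δ : ZMod 2) : ∃ (a : ℝ) (G : ℝ → ℂ), IsTame a G ∧
      ∀ᶠ x in cobounded ℝ, pw γ δ 0 x * f x⁻¹ = G x := by
  obtain ⟨m, α, η, g, hg, ε, hε, hf⟩ := hf
  obtain ⟨a, G, hG, h⟩ := exists_isTame_sum (Finset.univ : Finset (Fin m))
    (g := fun p x => pw γ δ 0 x * g p x⁻¹) (fun p _ => by
      obtain ⟨ε', hε', n, c, hc, hs⟩ := hg p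
      obtain ⟨a, G, hG, h⟩ := exists_isTame_sum (Finset.range (n + 1))
        (g := fun j x => pw γ δ 0 x * (pw (α p) (η p) j x⁻¹ * c j x⁻¹)) (fun j hj => by
          obtain ⟨c', hc', hcc⟩ := exists_smoothCompact_eventuallyEq hε'
            (hc j (Nat.lt_succ_iff.1 (Finset.mem_range.1 hj)))
          refine ⟨_, _, isTame_Kf (α p - γ) (δ + η p) j (hc'.const_mul ((-1) ^ j)), ?_⟩
          filter_upwards [(tendsto_inv₀_cobounded (α := ℝ)).eventually hcc] with x hx
          rw [← hx, pw_inv, Kf]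
          have := pw_mul_pw γ (-α p) δ (η p) 0 j x
          rw [zero_add] at this
          rw [show -(α p - γ) = γ + -α p by ring, ← this]
          ring)
      refine ⟨a, G, hG, ?_⟩
      filter_upwards [h, (tendsto_inv₀_cobounded' (α := ℝ)).eventually
        (eventually_nhdsNE_of_abs_lt hε' hs), eventually_ne_cobounded (0 : ℝ)] with x hx hx' hx0
      rw [← hx, hx', Finset.mul_sum]
      refine Finset.sum_congr rfl fun j _ => ?_
      rw [pw_of_ne (α p) (η p) j (inv_ne_zero hx0)])
  refine ⟨a, G, hG, ?_⟩
  filter_upwards [h, (tendsto_inv₀_cobounded' (α := ℝ)).eventually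
    (eventually_nhdsNE_of_abs_lt hε hf)] with x hx hx'
  rw [← hx, hx', Finset.mul_sum]

/-- The function `x ↦ f(1/x) (sg x)^η |x|^(-α-1)` attached to `f ∈ S_sis`. -/
lemma exists_isTame_Kf_of_mem_Ssis {f : ℝ → ℂ} (hf : f ∈ Ssis) (β : ℂ) (δ : ZMod 2) :
    ∃ a : ℝ, IsTame a (Kf β δ 0 f) := by
  obtain ⟨h1, h2, h3⟩ := hf
  obtain ⟨a, G, hG, h⟩ := h2.exists_isTame (-β) δ
  have hK : ContDiff ℝ ∞ (Kf β δ 0 f) := contDiff_Kf β δ 0 (.of_decaysRapidly h1 h3)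
  -- Both functions are smooth on the whole line and agree near infinity.
  have hD : SmoothCompact fun x => Kf β δ 0 f x - G x := by
    refine ⟨hK.sub hG.smooth, ?_⟩
    rw [hasCompactSupport_iff_eventuallyEq, coclosedCompact_eq_cocompact,
      ← Metric.cobounded_eq_cocompact]
    filter_upwards [h] with x hx
    simp [Kf, hx]
  refine ⟨max a 0, ?_⟩
  have e : Kf β δ 0 f = fun x => G x + (Kf β δ 0 f x - G x) := by ext x; ring
  rw [e]
  exact hG.add hD.isTame

/-! ### The regularized Fourier transform of a tame symbol -/

lemma iteratedDeriv_pw (γ : ℂ) (δ : ZMod 2) (k : ℕ) :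
    ∃ κ : ℂ, ∀ x : ℝ, x ≠ 0 → iteratedDeriv k (pw γ δ 0) x = κ * pw (γ - k) (δ + k) 0 x := by
  induction k with
  | zero => exact ⟨1, fun x _ => by simp⟩
  | succ k ih =>
    obtain ⟨κ, h⟩ := ih
    refine ⟨κ * (γ - k), fun x hx => ?_⟩
    have he : iteratedDeriv k (pw γ δ 0) =ᶠ[𝓝 x] fun z => κ * pw (γ - k) (δ + k) 0 z := by
      filter_upwards [eventually_nhds_ne hx] with z hz using h z hz
    rw [iteratedDeriv_succ, he.deriv_eq, ((hasDerivAt_pw _ _ _ hx).const_mul κ).deriv]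
    push_cast
    rw [zero_mul, add_zero, ← add_assoc, sub_sub]
    ring

lemma norm_fourier_le (f : ℝ → ℂ) (y : ℝ) : ‖𝓕 f y‖ ≤ ∫ x, ‖f x‖ := by
  rw [fourier_eq_integral]
  refine (norm_integral_le_integral_norm _).trans (le_of_eq ?_)
  simp [norm_ey]

lemma IsSymbol.contDiff_fourier {a : ℝ} {G : ℝ → ℂ} (hG : IsSymbol a G) {n N : ℕ}
    (h : a + n + 1 < N) : ContDiff ℝ n (𝓕 (iteratedDeriv N G)) := by
  refine Real.contDiff_fourier (N := n) fun m hm => ?_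
  have hm' : (m : ℝ) ≤ n := by exact_mod_cast hm
  have := (hG.integrable_pow_mul (n := m) (N := N) (by linarith)).norm
  simpa using this

lemma IsSymbol.iteratedDeriv_fourier_bound {a : ℝ} {G : ℝ → ℂ} (hG : IsSymbol a G) {n N : ℕ}
    (h : a + n + 1 < N) : ∃ C : ℝ, 0 ≤ C ∧
      ∀ y, ‖iteratedDeriv n (𝓕 (iteratedDeriv N G)) y‖ ≤ C := by
  refine ⟨∫ x : ℝ, ‖(-2 * Real.pi * Complex.I * x) ^ n • iteratedDeriv N G x‖,
    integral_nonneg fun x => norm_nonneg _, fun y => ?_⟩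
  rw [Real.iteratedDeriv_fourier (N := n) (fun m hm => ?_) le_rfl]
  · exact norm_fourier_le _ y
  · have hm' : (m : ℝ) ≤ n := by exact_mod_cast hm
    have := hG.integrable_pow_mul (n := m) (N := N) (by linarith)
    simpa using this

lemma regFourier_eq_pw (N : ℕ) (G : ℝ → ℂ) {y : ℝ} (hy : y ≠ 0) :
    regFourier N G y = ((2 * Real.pi * Complex.I) ^ N)⁻¹ *
      (pw (-N) N 0 y * 𝓕 (iteratedDeriv N G) y) := by
  have := pw_div_pow 0 0 0 N y
  rw [pw_of_ne 0 _ _ hy, sgPow_zero_left] at this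
  simp only [Complex.cpow_zero, pow_zero, one_mul, zero_add, zero_sub] at this
  rw [regFourier, ← this, mul_inv]
  ring

/-- A function which is the regularized Fourier transform of a tame symbol is in `S_sis`. -/
lemma IsTame.mem_Ssis {a : ℝ} {G : ℝ → ℂ} (hG : IsTame a G) {u : ℝ → ℂ}
    (hu : ∀ N : ℕ, a + 1 < N → ∀ y : ℝ, y ≠ 0 → u y = regFourier N G y) : u ∈ Ssis := by
  have hex (n M : ℕ) : ∃ N : ℕ, M ≤ N ∧ a + n + 1 < N := by
    obtain ⟨N, hN⟩ := exists_nat_gt (a + n + 1)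
    refine ⟨max M N, le_max_left _ _, hN.trans_le ?_⟩
    exact_mod_cast le_max_right M N
  have hev {n N : ℕ} (hN : a + n + 1 < N) {y : ℝ} (hy : y ≠ 0) :
      u =ᶠ[𝓝 y] fun y => ((2 * Real.pi * Complex.I) ^ N)⁻¹ *
        (pw (-N) N 0 y * 𝓕 (iteratedDeriv N G) y) := by
    filter_upwards [eventually_nhds_ne hy] with z hz
    rw [hu N (by linarith [(Nat.cast_nonneg n : (0 : ℝ) ≤ n)]) z hz, regFourier_eq_pw N G hz]
  refine ⟨?_, ?_, ?_⟩
  · rw [contDiffOn_infty]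
    intro n y hy
    obtain ⟨N, -, hN⟩ := hex n 0
    exact (((contDiffAt_const.mul ((contDiffAt_pw _ _ _ hy).mul
      (hG.contDiff_fourier hN).contDiffAt)).congr_of_eventuallyEq
        (hev hN hy))).contDiffWithinAt
  · obtain ⟨N₀, hN₀⟩ := hG.fourier
    obtain ⟨N, hN, hN'⟩ := hex 0 N₀
    refine ((hN₀ N hN).mul_inv_pow ((2 * Real.pi * Complex.I) ^ N) N).congr ?_
    filter_upwards [self_mem_nhdsWithin] with y hy
    rw [hu N (by simpa using hN') y hy, regFourier]
  · intro k M
    -- `N ≥ M` lets `|y|^(-N)` absorb the weight `|y|^M`; `N > a + k + 1` bounds the derivatives of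
    -- the transform up to order `k`.
    obtain ⟨N, hM, hN⟩ := hex k M
    choose κ hκ using fun i => iteratedDeriv_pw (-N) N i
    choose C hC0 hC using fun i : ℕ => fun h : i ≤ k =>
      hG.iteratedDeriv_fourier_bound (n := k - i) (N := N) (by
        have : ((k - i : ℕ) : ℝ) ≤ k := by exact_mod_cast Nat.sub_le k i
        linarith)
    refine ⟨‖((2 * Real.pi * Complex.I) ^ N : ℂ)⁻¹‖ * ∑ i ∈ (Finset.range (k + 1)).attach,
      k.choose i * ‖κ i‖ * C i (Nat.lt_succ_iff.1 (Finset.mem_range.1 i.2)), fun y hy => ?_⟩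
    have hy0 : 0 < |y| := by linarith
    have hy' : y ≠ 0 := abs_pos.1 hy0
    rw [(hev hN hy').iteratedDeriv_eq, iteratedDeriv_const_mul_field, iteratedDeriv_fun_mul
      (contDiffAt_pw _ _ _ hy') (hG.contDiff_fourier hN).contDiffAt, norm_mul,
      mul_left_comm]
    refine mul_le_mul_of_nonneg_left ?_ (norm_nonneg _)
    rw [← Finset.sum_attach]
    refine (mul_le_mul_of_nonneg_left (norm_sum_le _ _) (by positivity)).trans ?_
    rw [Finset.mul_sum]
    refine Finset.sum_le_sum fun i _ => ?_
    rw [norm_mul, norm_mul, hκ i y hy', norm_mul, norm_pw _ _ _ hy', pow_zero, mul_one]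
    have h1 : |y| ^ M * |y| ^ (-(N : ℂ) - (i : ℕ)).re ≤ 1 := by
      rw [← Real.rpow_natCast, ← Real.rpow_add hy0]
      refine Real.rpow_le_one_of_one_le_of_nonpos hy ?_
      have : (M : ℝ) ≤ N := by exact_mod_cast hM
      have : (0 : ℝ) ≤ (i : ℕ) := Nat.cast_nonneg _
      simp; linarith
    have h2 := hC i (Nat.lt_succ_iff.1 (Finset.mem_range.1 i.2)) y
    rw [Complex.norm_natCast]
    calc |y| ^ M * (k.choose i * (‖κ i‖ * |y| ^ (-(N : ℂ) - (i : ℕ)).re) *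
          ‖iteratedDeriv (k - i) (𝓕 (iteratedDeriv N G)) y‖)
        = (|y| ^ M * |y| ^ (-(N : ℂ) - (i : ℕ)).re) * (k.choose i * ‖κ i‖ *
          ‖iteratedDeriv (k - i) (𝓕 (iteratedDeriv N G)) y‖) := by ring
      _ ≤ 1 * (k.choose i * ‖κ i‖ *
          ‖iteratedDeriv (k - i) (𝓕 (iteratedDeriv N G)) y‖) := by gcongr
      _ ≤ _ := by rw [one_mul]; gcongr

/-! ### Derivatives of `G(x) ψ(1/x)` -/

/-- The span of the functions `x⁻ᵖ G⁽ᵠ⁾(x)` with `p + q = d`. -/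
inductive InvCoeff (G : ℝ → ℂ) : ℕ → (ℝ → ℂ) → Prop
  | base (c : ℂ) (p q : ℕ) :
      InvCoeff G (p + q) fun x => c * ((x : ℂ) ^ p)⁻¹ * iteratedDeriv q G x
  | add {d : ℕ} {V W : ℝ → ℂ} (hV : InvCoeff G d V) (hW : InvCoeff G d W) :
      InvCoeff G d fun x => V x + W x

namespace InvCoeff

variable {G V W : ℝ → ℂ} {d : ℕ}

lemma zero (G : ℝ → ℂ) (d : ℕ) : InvCoeff G d fun _ => 0 := by
  simpa using base (G := G) 0 d 0

lemma inv_sq_mul (h : InvCoeff G d V) :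
    InvCoeff G (d + 2) fun x => -((x : ℂ) ^ 2)⁻¹ * V x := by
  induction h with
  | base c p q =>
    have := base (G := G) (-c) (p + 2) q
    rw [show p + 2 + q = p + q + 2 by ring] at this
    refine (funext fun x => ?_ : (fun x : ℝ => _) = _) ▸ this
    rw [pow_add, mul_inv]; ring
  | add _ _ hV hW => simpa only [mul_add] using hV.add hW

lemma exists_hasDerivAt (hG : ContDiff ℝ ∞ G) (h : InvCoeff G d V) :
    ∃ W, InvCoeff G (d + 1) W ∧ ∀ x ≠ 0, HasDerivAt V (W x) x := by
  induction h with
  | base c p q =>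
    refine ⟨fun x => c * (-p) * ((x : ℂ) ^ (p + 1))⁻¹ * iteratedDeriv q G x +
      c * ((x : ℂ) ^ p)⁻¹ * iteratedDeriv (q + 1) G x, .add ?_ (base c p (q + 1)), ?_⟩
    · have := base (G := G) (c * (-p)) (p + 1) q
      rwa [show p + 1 + q = p + q + 1 by ring] at this
    · intro x hx
      have hx' : (x : ℂ) ≠ 0 := by exact_mod_cast hx
      have h1 : HasDerivAt (fun x : ℝ => ((x : ℂ) ^ p)⁻¹)
          (-(p * (x : ℂ) ^ (p - 1)) / ((x : ℂ) ^ p) ^ 2) x :=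
        ((hasDerivAt_pow p (x : ℂ)).fun_inv (pow_ne_zero p hx')).comp_ofReal
      have h2 : HasDerivAt (iteratedDeriv q G) (iteratedDeriv (q + 1) G x) x := by
        rw [iteratedDeriv_succ]
        exact ((contDiff_iteratedDeriv hG q).differentiable (by simp) x).hasDerivAt
      refine ((h1.const_mul c).mul h2).congr_deriv ?_
      congr 1
      rcases p with _ | p
      · simp
      · simp only [Nat.cast_add, Nat.cast_one, Nat.add_sub_cancel]
        field_simp
        ring
  | add _ _ hV hW =>
    obtain ⟨V', h1, h2⟩ := hV
    obtain ⟨W', h3, h4⟩ := hW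
    exact ⟨_, h1.add h3, fun x hx => (h2 x hx).add (h4 x hx)⟩

lemma continuousOn (hG : ContDiff ℝ ∞ G) (h : InvCoeff G d V) : ContinuousOn V {0}ᶜ := by
  obtain ⟨W, -, hW⟩ := h.exists_hasDerivAt hG
  exact fun x hx => (hW x hx).continuousAt.continuousWithinAt

lemma isBigO {a : ℝ} (hG : IsSymbol a G) (h : InvCoeff G d V) :
    V =O[cobounded ℝ] fun x => |x| ^ (a - d) := by
  induction h with
  | base c p q =>
    have hx : (fun x : ℝ => c * ((x : ℂ) ^ p)⁻¹) =O[cobounded ℝ] fun x => |x| ^ (-p : ℝ) :=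
      IsBigO.of_bound ‖c‖ (Eventually.of_forall fun x => by
        simp [Real.rpow_neg, abs_of_nonneg])
    refine (hx.mul (hG.bound q)).congr' .rfl ?_
    filter_upwards [eventually_ne_cobounded (0 : ℝ)] with x hx
    rw [← Real.rpow_add (abs_pos.2 hx)]
    congr 1; push_cast; ring
  | add _ _ hV hW => exact hV.add hW

end InvCoeff

lemma hasDerivAt_comp_inv {ψ : ℝ → ℂ} (hψ : ContDiff ℝ ∞ ψ) (j : ℕ) {x : ℝ} (hx : x ≠ 0) :
    HasDerivAt (fun x : ℝ => iteratedDeriv j ψ x⁻¹)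
      (-((x : ℂ) ^ 2)⁻¹ * iteratedDeriv (j + 1) ψ x⁻¹) x := by
  have h2 : HasDerivAt (iteratedDeriv j ψ) (iteratedDeriv (j + 1) ψ x⁻¹) x⁻¹ := by
    rw [iteratedDeriv_succ]
    exact ((contDiff_iteratedDeriv hψ j).differentiable (by simp) _).hasDerivAt
  refine (h2.scomp x (hasDerivAt_inv hx)).congr_deriv ?_
  simp

/-- A derivative falling on `V` raises the degree by one; one falling on `ψ(1/x)` brings out `-x⁻²`
and raises it by two. After `N` derivatives, `j` of them on `ψ`, the degree is `N + j`. The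
coefficients do not depend on `ψ`. -/
lemma exists_iteratedDeriv_mul_comp_inv {G : ℝ → ℂ} (hG : ContDiff ℝ ∞ G) (N : ℕ) :
    ∃ V : ℕ → ℝ → ℂ, (∀ j, InvCoeff G (N + j) (V j)) ∧ (∀ j > N, ∀ x ≠ 0, V j x = 0) ∧
      ∀ ψ : ℝ → ℂ, ContDiff ℝ ∞ ψ → ∀ x ≠ 0, iteratedDeriv N (fun x => G x * ψ x⁻¹) x =
        ∑ j ∈ Finset.range (N + 1), V j x * iteratedDeriv j ψ x⁻¹ := by
  induction N with
  | zero =>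
    refine ⟨fun j => if j = 0 then G else fun _ => 0, fun j => ?_, fun j hj x _ => ?_,
      fun ψ hψ x hx => by simp⟩
    · rcases j with _ | j
      · simpa using InvCoeff.base (G := G) 1 0 0
      · simpa using InvCoeff.zero G _
    · simp [Nat.ne_of_gt hj]
  | succ N ih =>
    obtain ⟨V, hV, hV0, hD⟩ := ih
    choose W hW hWd using fun j => (hV j).exists_hasDerivAt hG
    have hW0 : ∀ j > N, ∀ x ≠ 0, W j x = 0 := fun j hj x hx =>
      (hWd j x hx).unique ((hasDerivAt_const x (0 : ℂ)).congr_of_eventuallyEq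
        ((eventually_nhds_ne hx).mono fun z hz => hV0 j hj z hz))
    refine ⟨fun j => match j with
      | 0 => W 0
      | j + 1 => fun x => W (j + 1) x + -((x : ℂ) ^ 2)⁻¹ * V j x, fun j => ?_, fun j hj x hx => ?_,
      fun ψ hψ x hx => ?_⟩
    · rcases j with _ | j
      · exact hW 0
      · have h1 := hW (j + 1)
        have h2 := (hV j).inv_sq_mul
        rw [show N + (j + 1) + 1 = N + 1 + (j + 1) by ring] at h1
        rw [show N + j + 2 = N + 1 + (j + 1) by ring] at h2
        exact h1.add h2
    · rcases j with _ | j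
      · omega
      · simp [hW0 (j + 1) (by omega) x hx, hV0 j (by omega) x hx]
    · rw [iteratedDeriv_succ]
      have h1 : iteratedDeriv N (fun x => G x * ψ x⁻¹) =ᶠ[𝓝 x]
          fun x => ∑ j ∈ Finset.range (N + 1), V j x * iteratedDeriv j ψ x⁻¹ :=
        (eventually_nhds_ne hx).mono fun z hz => hD ψ hψ z hz
      have h2 := HasDerivAt.fun_sum (u := Finset.range (N + 1)) fun j _ =>
        (hWd j x hx).fun_mul (hasDerivAt_comp_inv hψ j hx)
      rw [h1.deriv_eq, h2.deriv, Finset.sum_range_succ' _ (N + 1), Finset.sum_add_distrib,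
        Finset.sum_range_succ' (fun j => W j x * _) N]
      simp only [add_mul, Finset.sum_add_distrib]
      rw [Finset.sum_range_succ (fun j => W (j + 1) x * _) N, hW0 (N + 1) (by omega) x hx,
        show (∑ j ∈ Finset.range (N + 1), -((x : ℂ) ^ 2)⁻¹ * V j x * iteratedDeriv (j + 1) ψ x⁻¹) =
          ∑ j ∈ Finset.range (N + 1), V j x * (-((x : ℂ) ^ 2)⁻¹ * iteratedDeriv (j + 1) ψ x⁻¹) from
          Finset.sum_congr rfl fun j _ => by ring]
      ring

lemma eventually_nhds_zero_comp_inv_eq_zero {ψ : ℝ → ℂ} (hψ : HasCompactSupport ψ) :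
    ∀ᶠ x in 𝓝 (0 : ℝ), x ≠ 0 → ψ x⁻¹ = 0 := by
  have h : Tendsto (fun x : ℝ => x⁻¹) (𝓝[≠] 0) (cobounded ℝ) := tendsto_inv₀_nhdsNE_zero
  exact eventually_nhdsWithin_iff.1
    (h.eventually ((eventually_cobounded_eq_zero hψ).mono fun x hx => hx.self_of_nhds))

/-- As `x → 0`, `1/x` leaves the support of `ψ`. The condition `G 0 = 0` handles the point `x = 0`
itself, where the convention `0⁻¹ = 0` gives the factor `ψ 0`. -/
lemma contDiff_mul_comp_inv {G ψ : ℝ → ℂ} (hG : ContDiff ℝ ∞ G) (h0 : G 0 = 0)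
    (hψ : SmoothCompact ψ) : ContDiff ℝ ∞ fun x => G x * ψ x⁻¹ := by
  rw [contDiff_iff_contDiffAt]
  intro x
  rcases eq_or_ne x 0 with rfl | hx
  · refine (contDiffAt_const (c := (0 : ℂ))).congr_of_eventuallyEq ?_
    filter_upwards [eventually_nhds_zero_comp_inv_eq_zero hψ.supp] with x hx
    rcases eq_or_ne x 0 with rfl | h
    · simp [h0]
    · simp [hx h]
  · exact hG.contDiffAt.mul (hψ.smooth.contDiffAt.comp x (contDiffAt_inv ℝ hx))

lemma IsSymbol.mul_comp_inv {a : ℝ} {G ψ : ℝ → ℂ} (hG : IsSymbol a G) (h0 : G 0 = 0)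
    (hψ : SmoothCompact ψ) : IsSymbol a fun x => G x * ψ x⁻¹ where
  smooth := contDiff_mul_comp_inv hG.smooth h0 hψ
  bound k := by
    obtain ⟨V, hV, -, hD⟩ := exists_iteratedDeriv_mul_comp_inv hG.smooth k
    have h1 : (fun x => ∑ j ∈ Finset.range (k + 1), V j x * iteratedDeriv j ψ x⁻¹)
        =O[cobounded ℝ] fun x => |x| ^ (a - k) := by
      refine IsBigO.fun_sum fun j _ => ?_
      obtain ⟨C, -, hC⟩ := exists_bound_iteratedDeriv hψ.smooth hψ.supp j
      have h2 : (fun x : ℝ => iteratedDeriv j ψ x⁻¹) =O[cobounded ℝ] fun _ => (1 : ℝ) :=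
        IsBigO.of_bound C (Eventually.of_forall fun x => by simpa using hC x⁻¹)
      have h3 := (((hV j).isBigO hG).trans (rpow_isBigO_cobounded (b := a - k) (by
        push_cast; linarith [(Nat.cast_nonneg j : (0 : ℝ) ≤ j)]))).mul h2
      simpa using h3
    refine h1.congr' ?_ .rfl
    filter_upwards [eventually_ne_cobounded (0 : ℝ)] with x hx
    exact (hD ψ hψ.smooth x hx).symm

/-! ### The change of variables `x = 1/u` -/

lemma integral_comp_inv (F : ℝ → ℂ) :
    ∫ x, F x = ∫ u : ℝ, ((u : ℂ) ^ 2)⁻¹ * F u⁻¹ := by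
  have hne : ({0}ᶜ : Set ℝ) =ᵐ[volume] Set.univ := by simp [ae_eq_univ]
  have himg : (fun x : ℝ => x⁻¹) '' {0}ᶜ = {0}ᶜ := by
    ext x
    constructor
    · rintro ⟨z, hz, rfl⟩; exact inv_ne_zero hz
    · exact fun hx => ⟨x⁻¹, inv_ne_zero hx, inv_inv x⟩
  have := integral_image_eq_integral_abs_deriv_smul (s := {0}ᶜ) (f := fun x : ℝ => x⁻¹)
    (f' := fun x => -(x ^ 2)⁻¹) (measurableSet_singleton 0).compl
    (fun x hx => (hasDerivAt_inv hx).hasDerivWithinAt) (inv_injective.injOn) F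
  rw [himg, setIntegral_congr_set hne, setIntegral_congr_set hne, setIntegral_univ,
    setIntegral_univ] at this
  rw [this]
  refine integral_congr_ae (Eventually.of_forall fun u => ?_)
  simp

/-! ### Test functions -/

lemma smoothCompact_testFunction (φ : 𝓣) : SmoothCompact fun t => ((φ t : ℝ) : ℂ) where
  smooth := contDiff_ofReal.comp φ.contDiff
  supp := φ.hasCompactSupport.comp_left Complex.ofReal_zero

/-- The derivative of test functions. -/
noncomputable def derivCLM : 𝓣 →L[ℝ] 𝓣 := TestFunction.lineDerivCLM ℝ (1 : ℝ)

lemma derivCLM_apply (φ : 𝓣) (x : ℝ) : derivCLM φ x = deriv φ x := by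
  rw [derivCLM, TestFunction.lineDerivCLM_apply_of_le le_top,
    DifferentiableAt.lineDeriv_eq_fderiv, fderiv_apply_one_eq_deriv]
  exact φ.contDiff.differentiable (by simp) x

lemma iteratedDeriv_testFunction (j : ℕ) (φ : 𝓣) :
    iteratedDeriv j (fun t => ((φ t : ℝ) : ℂ)) = fun t => (((derivCLM ^ j) φ t : ℝ) : ℂ) := by
  induction j generalizing φ with
  | zero => simp
  | succ j ih =>
    have : deriv (fun t => ((φ t : ℝ) : ℂ)) = fun t => ((derivCLM φ t : ℝ) : ℂ) := by
      ext t
      rw [derivCLM_apply]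
      exact ((φ.contDiff.differentiable (by simp) t).hasDerivAt.ofReal_comp).deriv
    rw [iteratedDeriv_succ', this, ih, pow_succ]
    rfl

lemma exists_distribution_eq_integral {H : ℝ → ℂ} (hH : LocallyIntegrable H) (j : ℕ) :
    ∃ L : 𝓣 →L[ℝ] ℂ, ∀ φ : 𝓣, L φ = ∫ u, H u * iteratedDeriv j (fun t => ((φ t : ℝ) : ℂ)) u := by
  refine ⟨(TestFunction.integralAgainstBilinCLM
    (ContinuousLinearMap.lsmul ℝ ℝ : ℝ →L[ℝ] ℂ →L[ℝ] ℂ) volume H).comp (derivCLM ^ j),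
    fun φ => ?_⟩
  rw [ContinuousLinearMap.comp_apply, TestFunction.integralAgainstBilinCLM_eq_integral
    (hH.locallyIntegrableOn _), iteratedDeriv_testFunction]
  refine integral_congr_ae (Eventually.of_forall fun u => ?_)
  simp [mul_comm]

/-! ### Continuous functions on `ℝ ∖ {0}` -/

lemma aestronglyMeasurable_of_continuousOn_compl {H : ℝ → ℂ} (hH : ContinuousOn H {0}ᶜ) :
    AEStronglyMeasurable H := by
  have hne : ({0}ᶜ : Set ℝ) =ᵐ[volume] Set.univ := by simp [ae_eq_univ]
  have := hH.aestronglyMeasurable (μ := volume) (measurableSet_singleton 0).compl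
  rwa [Measure.restrict_congr_set hne, Measure.restrict_univ] at this

lemma locallyIntegrableOn_compl {H : ℝ → ℂ} (hH : ContinuousOn H {0}ᶜ) :
    LocallyIntegrableOn H {0}ᶜ :=
  hH.locallyIntegrableOn (measurableSet_singleton 0).compl

lemma locallyIntegrable_of_isBigO {H : ℝ → ℂ} (hH : ContinuousOn H {0}ᶜ)
    (h : H =O[𝓝[≠] 0] fun _ => (1 : ℝ)) : LocallyIntegrable H := by
  intro x
  rcases eq_or_ne x 0 with rfl | hx
  · obtain ⟨C, hC⟩ := h.bound
    obtain ⟨ε, hε, hb⟩ := Metric.eventually_nhds_iff.1 (eventually_nhdsWithin_iff.1 hC)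
    refine ⟨Metric.ball 0 ε, Metric.ball_mem_nhds 0 hε, ?_⟩
    refine Measure.integrableOn_of_bounded (M := C) measure_ball_lt_top.ne
      (aestronglyMeasurable_of_continuousOn_compl hH) ?_
    have hne : ∀ᵐ u : ℝ, u ≠ 0 := by simp [ae_iff]
    filter_upwards [ae_restrict_of_ae hne, ae_restrict_mem measurableSet_ball] with u hu hu'
    simpa using hb hu' hu
  · have := locallyIntegrableOn_compl hH x hx
    rwa [isOpen_compl_singleton.nhdsWithin_eq hx] at this

/-! ### Terms of the canonical extension -/

/-- Vanishing to order `k` is tested with the powers inside the derivatives, whereas the estimates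
put them outside; this commutes them, with coefficients independent of `ψ`. -/
lemma exists_pow_mul_iteratedDeriv_eq (n : ℕ) : ∀ k : ℕ, ∃ c : ℕ → ℂ, (∀ p > n, c p = 0) ∧
    ∀ ψ : ℝ → ℂ, ContDiff ℝ ∞ ψ → ∀ x : ℝ, (x : ℂ) ^ (k + n) * iteratedDeriv n ψ x =
      ∑ p ∈ Finset.range (n + 1), c p * iteratedDeriv p (fun t : ℝ => (t : ℂ) ^ (k + p) * ψ t) x := by
  induction n with
  | zero => exact fun k => ⟨fun p => if p = 0 then 1 else 0, fun p hp => by simp [Nat.ne_of_gt hp],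
      fun ψ _ x => by simp⟩
  | succ n ih =>
    intro k
    obtain ⟨c, hc0, hc⟩ := ih (k + 1)
    -- The case `k + 1` is applied to `ψ'`, with `t^(k+1+p) ψ' = (t^(k+p+1) ψ)' - (k+1+p) t^(k+p)
    -- ψ`.
    refine ⟨fun p => (match p with | 0 => 0 | p + 1 => c p) - (k + 1 + p) * c p, fun p hp => ?_,
      fun ψ hψ x => ?_⟩
    · rcases p with _ | p
      · omega
      · simp [hc0 p (by omega), hc0 (p + 1) (by omega)]
    · have hψ' := (contDiff_infty_iff_deriv.1 hψ).2
      have hs (p : ℕ) : ContDiff ℝ ∞ fun t : ℝ => (t : ℂ) ^ p * ψ t := (contDiff_ofReal.pow p).mul hψ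
      have hd (p : ℕ) : (fun t : ℝ => (t : ℂ) ^ (k + 1 + p) * deriv ψ t) = fun t =>
          deriv (fun t : ℝ => (t : ℂ) ^ (k + (p + 1)) * ψ t) t +
            -(k + 1 + p : ℂ) * ((t : ℂ) ^ (k + p) * ψ t) := by
        ext t
        have h1 := ((hasDerivAt_pow (k + (p + 1)) (t : ℂ)).comp_ofReal).fun_mul
          (hψ.differentiable (by simp) t).hasDerivAt
        rw [h1.deriv, show k + (p + 1) - 1 = k + p by omega, show k + 1 + p = k + (p + 1) by ring]
        push_cast
        ring
      have hi (p : ℕ) : iteratedDeriv p (fun t : ℝ => (t : ℂ) ^ (k + 1 + p) * deriv ψ t) x =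
          iteratedDeriv (p + 1) (fun t : ℝ => (t : ℂ) ^ (k + (p + 1)) * ψ t) x +
            -(k + 1 + p : ℂ) * iteratedDeriv p (fun t : ℝ => (t : ℂ) ^ (k + p) * ψ t) x := by
        rw [hd, iteratedDeriv_fun_add_eq (contDiff_infty_iff_deriv.1 (hs _)).2
          (contDiff_const.mul (hs _)), iteratedDeriv_succ']
        simp only [iteratedDeriv_const_mul_field]
      rw [show k + (n + 1) = k + 1 + n by ring, iteratedDeriv_succ', hc _ hψ']
      simp only [hi, sub_mul, Finset.sum_sub_distrib, mul_add, Finset.sum_add_distrib]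
      rw [Finset.sum_range_succ' _ (n + 1), Finset.sum_range_succ (fun p => _ * c p * _) (n + 1),
        hc0 (n + 1) (by omega)]
      simp only [zero_mul, mul_zero, add_zero, sub_eq_add_neg, ← Finset.sum_neg_distrib]
      congr 1
      refine Finset.sum_congr rfl fun p _ => ?_
      ring

lemma SmoothCompact.integrable_mul {ψ H : ℝ → ℂ} (hψ : SmoothCompact ψ)
    (hH : LocallyIntegrable H) : Integrable fun u => H u * ψ u := by
  simpa [mul_comm] using hH.integrable_smul_left_of_hasCompactSupport hψ.smooth.continuous hψ.supp

lemma isBigO_one_of_isBigO_pow {H : ℝ → ℂ} {n : ℕ} (h : H =O[𝓝[≠] 0] fun u => |u| ^ n) :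
    H =O[𝓝[≠] 0] fun _ => (1 : ℝ) := by
  refine h.trans (Tendsto.isBigO_one (c := |(0 : ℝ)| ^ n) ℝ ?_)
  exact ((continuous_abs.pow n).tendsto 0).mono_left nhdsWithin_le_nhds

/-- The coefficient of `ψ^(j)(1/x)` in the `N`-th derivative has order `a - N - j`, hence is
`O(|u|^(N+j-a))` in `u = 1/x`. The Jacobian `u⁻²` costs two powers, which explains the condition on
`N`. -/
lemma IsSymbol.exists_regFourier_mul_comp_inv_eq {a : ℝ} {G : ℝ → ℂ} (hG : IsSymbol a G)
    (y : ℝ) {k N : ℕ} (hN : k + a + 2 ≤ N) :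
    ∃ H : ℕ → ℝ → ℂ, (∀ j, ContinuousOn (H j) {0}ᶜ) ∧
      (∀ j, H j =O[𝓝[≠] 0] fun u => |u| ^ (k + j)) ∧
      ∀ ψ, SmoothCompact ψ → regFourier N (fun x => G x * ψ x⁻¹) y =
        ∑ j ∈ Finset.range (N + 1), ∫ u, H j u * iteratedDeriv j ψ u := by
  obtain ⟨V, hV, -, hD⟩ := exists_iteratedDeriv_mul_comp_inv hG.smooth N
  set K : ℂ := ((2 * Real.pi * Complex.I) ^ N * (y : ℂ) ^ N)⁻¹ with hK
  have hinv : ContinuousOn (fun u : ℝ => u⁻¹) {0}ᶜ := continuousOn_inv₀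
  have hinv' : Set.MapsTo (fun u : ℝ => u⁻¹) {0}ᶜ {0}ᶜ := fun u hu => inv_ne_zero hu
  have hc (j : ℕ) : ContinuousOn (fun u : ℝ => K * (((u : ℂ) ^ 2)⁻¹ * (ey y u⁻¹ * V j u⁻¹))) {0}ᶜ := by
    refine continuousOn_const.mul (ContinuousOn.mul ?_ (.mul ?_ ?_))
    · exact (Complex.continuous_ofReal.pow 2).continuousOn.inv₀ fun u hu =>
        pow_ne_zero 2 (by exact_mod_cast hu)
    · exact (continuous_ey y).comp_continuousOn hinv
    · exact ((hV j).continuousOn hG.smooth).comp hinv hinv'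
  have hb (j : ℕ) : (fun u : ℝ => K * (((u : ℂ) ^ 2)⁻¹ * (ey y u⁻¹ * V j u⁻¹))) =O[𝓝[≠] 0]
      fun u => |u| ^ (k + j) := by
    have hT : Tendsto (fun x : ℝ => x⁻¹) (𝓝[≠] 0) (cobounded ℝ) := tendsto_inv₀_nhdsNE_zero
    obtain ⟨C, hC⟩ := (((hV j).isBigO hG).comp_tendsto hT).bound
    refine IsBigO.const_mul_left (IsBigO.of_bound C ?_) K
    have h1 : ∀ᶠ u : ℝ in 𝓝[≠] 0, |u| ≤ 1 := nhdsWithin_le_nhds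
      (mem_of_superset (Metric.closedBall_mem_nhds (0 : ℝ) one_pos) fun u hu => by simpa using hu)
    filter_upwards [hC, h1, self_mem_nhdsWithin] with u hu hu1 hu0
    have hu' : 0 < |u| := abs_pos.2 hu0
    simp only [Function.comp_apply] at hu
    rw [Real.norm_of_nonneg (Real.rpow_nonneg (abs_nonneg _) _), abs_inv,
      Real.inv_rpow hu'.le, ← Real.rpow_neg hu'.le] at hu
    rw [norm_mul, norm_mul, norm_ey, one_mul, norm_inv, norm_pow, Complex.norm_real,
      Real.norm_eq_abs, Real.norm_of_nonneg (by positivity)]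
    have hC0 : 0 ≤ C := by
      by_contra h
      have : C * |u| ^ (-(a - ((N + j : ℕ) : ℝ))) < 0 :=
        mul_neg_of_neg_of_pos (not_le.1 h) (Real.rpow_pos_of_pos hu' _)
      linarith [norm_nonneg (V j u⁻¹)]
    calc (|u| ^ 2)⁻¹ * ‖V j u⁻¹‖
        ≤ (|u| ^ 2)⁻¹ * (C * |u| ^ (-(a - ((N + j : ℕ) : ℝ)))) := by gcongr
      _ = C * |u| ^ (-2 + (-(a - ((N + j : ℕ) : ℝ)))) := by
        rw [Real.rpow_add hu', Real.rpow_neg hu'.le 2, Real.rpow_two]; ring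
      _ ≤ C * |u| ^ (((k + j : ℕ) : ℝ)) := by
        refine mul_le_mul_of_nonneg_left ?_ hC0
        refine Real.rpow_le_rpow_of_exponent_ge hu' hu1 ?_
        push_cast; linarith
      _ = C * |u| ^ (k + j) := by rw [Real.rpow_natCast]
  refine ⟨fun j u => K * (((u : ℂ) ^ 2)⁻¹ * (ey y u⁻¹ * V j u⁻¹)), hc, hb, fun ψ hψ => ?_⟩
  rw [← integral_finsetSum _ fun j _ => (hψ.iteratedDeriv j).integrable_mul
    (locallyIntegrable_of_isBigO (hc j) (isBigO_one_of_isBigO_pow (hb j))), regFourier,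
    fourier_eq_integral, integral_comp_inv, ← integral_const_mul]
  refine integral_congr_ae (Eventually.of_forall fun u => ?_)
  rcases eq_or_ne u 0 with rfl | hu
  · simp
  · simp only
    rw [hD ψ hψ.smooth u⁻¹ (inv_ne_zero hu), inv_inv, Finset.mul_sum, Finset.mul_sum,
      Finset.mul_sum]
    exact Finset.sum_congr rfl fun j _ => by ring

lemma IsSymbol.exists_distribution {a : ℝ} {G : ℝ → ℂ} (hG : IsSymbol a G) (y : ℝ) {N : ℕ}
    (hN : a + 2 ≤ N) : ∃ σ : 𝓓'((⊤ : TopologicalSpace.Opens ℝ), ℂ), ∀ φ : 𝓣,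
      σ φ = regFourier N (fun x => G x * ((φ x⁻¹ : ℝ) : ℂ)) y := by
  obtain ⟨H, hc, hb, hH⟩ := hG.exists_regFourier_mul_comp_inv_eq y (k := 0) (N := N) (by simpa using hN)
  choose L hL using fun j => exists_distribution_eq_integral
    (locallyIntegrable_of_isBigO (hc j) (isBigO_one_of_isBigO_pow (hb j))) j
  let S : 𝓣 →L[ℝ] ℂ := ∑ j ∈ Finset.range (N + 1), L j
  refine ⟨{ toFun := S, map_add' := S.map_add, map_smul' := S.map_smul, cont := S.continuous },
    fun φ => ?_⟩
  refine Eq.trans ?_ (hH _ (smoothCompact_testFunction φ)).symm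
  change S φ = _
  simp [S, hL]

lemma tsupport_iteratedDeriv_subset (n : ℕ) (ψ : ℝ → ℂ) :
    tsupport (iteratedDeriv n ψ) ⊆ tsupport ψ := by
  induction n with
  | zero => simp
  | succ n ih =>
    rw [iteratedDeriv_succ]
    exact tsupport_deriv_subset.trans ih

lemma integrable_mul_of_tsupport_subset {ε : ℝ} {h ψ : ℝ → ℂ} (hψ : SmoothCompact ψ)
    (hs : tsupport ψ ⊆ Set.Ioo (-ε) ε)
    (hh : MemLp h ⊤ (volume.restrict (Set.Ioo (-ε) ε))) : Integrable fun u => h u * ψ u := by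
  have h1 : Integrable (fun u => h u * ψ u) (volume.restrict (Set.Ioo (-ε) ε)) :=
    hψ.integrable.restrict.mul_of_top_right hh
  refine (integrableOn_iff_integrable_of_support_subset fun u hu => ?_).1 h1
  exact hs (subset_tsupport ψ fun h0 => hu (by simp [h0]))

/-- Near `0`, `H j = u^(k+j) h j` with `h j` bounded; moving the power inside the derivatives gives
the required form. -/
lemma vanishesToOrder_of_eq_sum {k M : ℕ} {σ : 𝓓'((⊤ : TopologicalSpace.Opens ℝ), ℂ)}
    {H : ℕ → ℝ → ℂ} (hc : ∀ j, ContinuousOn (H j) {0}ᶜ)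
    (hb : ∀ j, H j =O[𝓝[≠] 0] fun u => |u| ^ (k + j))
    (hσ : ∀ φ : 𝓣, σ φ = ∑ j ∈ Finset.range M,
      ∫ u, H j u * iteratedDeriv j (fun t => ((φ t : ℝ) : ℂ)) u) :
    VanishesToOrder k σ := by
  choose C hC using fun j => (hb j).bound
  have hall : ∀ᶠ u : ℝ in 𝓝 0, ∀ j ∈ Finset.range M, u ≠ 0 → ‖H j u‖ ≤ C j * ‖|u| ^ (k + j)‖ :=
    (Finset.eventually_all _).2 fun j _ => eventually_nhdsWithin_iff.1 (hC j)
  obtain ⟨ε, hε, hE⟩ := Metric.eventually_nhds_iff.1 hall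
  choose c hc0 hcD using fun j => exists_pow_mul_iteratedDeriv_eq j k
  let h (j : ℕ) (u : ℝ) : ℂ := H j u * ((u : ℂ) ^ (k + j))⁻¹
  have hne : ∀ᵐ u : ℝ, u ≠ 0 := by simp [ae_iff]
  have hmem (j : ℕ) (hj : j < M) : MemLp (h j) ⊤ (volume.restrict (Set.Ioo (-ε) ε)) := by
    refine memLp_top_of_bound (C := C j) ?_ ?_
    · refine (aestronglyMeasurable_of_continuousOn_compl ((hc j).mul ?_)).restrict
      exact (Complex.continuous_ofReal.pow _).continuousOn.inv₀ fun u hu =>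
        pow_ne_zero _ (by exact_mod_cast hu)
    · filter_upwards [ae_restrict_of_ae hne, ae_restrict_mem measurableSet_Ioo] with u hu hu'
      have := hE (y := u) (by simpa [abs_lt] using hu') j (Finset.mem_range.2 hj) hu
      have hp : 0 < |u| ^ (k + j) := pow_pos (abs_pos.2 hu) _
      rw [Real.norm_of_nonneg hp.le] at this
      simp only [h, norm_mul, norm_inv, norm_pow, Complex.norm_real, Real.norm_eq_abs]
      rwa [← div_eq_mul_inv, div_le_iff₀ hp]
  let e := finProdFinEquiv (m := M) (n := M)
  -- The terms are indexed by pairs `(j, p)`, and the constant `(-1)^p` cancels the sign from moving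
  -- derivatives to the test function.
  refine ⟨ε, hε, M * M, fun l => (e.symm l).2, fun l _ => (-1) ^ ((e.symm l).2 : ℕ) *
    c (e.symm l).1 (e.symm l).2, fun l => h (e.symm l).1, fun l => contDiffOn_const,
    fun l => hmem _ (e.symm l).1.2, fun φ hφ => ?_⟩
  have hψ := smoothCompact_testFunction φ
  set ψ : ℝ → ℂ := fun t => ((φ t : ℝ) : ℂ) with hψdef
  have hs : tsupport ψ ⊆ Set.Ioo (-ε) ε := by
    refine (closure_mono fun t ht => ?_).trans hφ
    simpa [ψ] using ht
  have hpsi (p : ℕ) : SmoothCompact fun t : ℝ => (t : ℂ) ^ (k + p) * ψ t :=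
    ⟨(contDiff_ofReal.pow _).mul hψ.smooth, hψ.supp.mul_left⟩
  have hintegrable (j p : ℕ) (hj : j < M) :
      Integrable fun u => h j u * iteratedDeriv p (fun t : ℝ => (t : ℂ) ^ (k + p) * ψ t) u := by
    refine integrable_mul_of_tsupport_subset ((hpsi p).iteratedDeriv p) ?_ (hmem j hj)
    exact (tsupport_iteratedDeriv_subset _ _).trans ((tsupport_mul_subset_right).trans hs)
  rw [hσ, ← Equiv.sum_comp e, Fintype.sum_prod_type, ← Fin.sum_univ_eq_sum_range
    (fun j => ∫ u, H j u * iteratedDeriv j ψ u)]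
  refine Finset.sum_congr rfl fun j _ => ?_
  have e1 : (∫ u, H j u * iteratedDeriv j ψ u) = ∫ u, ∑ p ∈ Finset.range M, c j p *
      (h j u * iteratedDeriv p (fun t : ℝ => (t : ℂ) ^ (k + p) * ψ t) u) := by
    refine integral_congr_ae (hne.mono fun u hu => ?_)
    have hu' : (u : ℂ) ≠ 0 := by exact_mod_cast hu
    have e2 : H j u * iteratedDeriv j ψ u = h j u * ((u : ℂ) ^ (k + j) * iteratedDeriv j ψ u) := by
      simp only [h]; field_simp
    simp only
    rw [e2, hcD j ψ hψ.smooth u, Finset.mul_sum,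
      ← Finset.sum_subset (Finset.range_subset_range.2 (show (j : ℕ) + 1 ≤ M from j.2))]
    · exact Finset.sum_congr rfl fun p _ => by ring
    · intro p _ hp
      rw [hc0 j p (by simpa using hp), zero_mul]
  rw [e1, integral_finsetSum _ fun p _ => (hintegrable j p j.2).const_mul _,
    ← Fin.sum_univ_eq_sum_range (fun p => ∫ u, c j p *
      (h j u * iteratedDeriv p (fun t : ℝ => (t : ℂ) ^ (k + p) * ψ t) u))]
  refine Finset.sum_congr rfl fun p _ => ?_
  simp only [Equiv.symm_apply_apply]
  rw [← integral_const_mul]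
  refine integral_congr_ae (Eventually.of_forall fun u => ?_)
  have e3 : (fun t : ℝ => (t : ℂ) ^ (k + (p : ℕ)) * ((-1) ^ (p : ℕ) * c j p) * ((φ t : ℝ) : ℂ)) =
      fun t : ℝ => ((-1) ^ (p : ℕ) * c j p) * ((t : ℂ) ^ (k + (p : ℕ)) * ψ t) := by
    ext t; simp only [ψ]; ring
  have e4 : ((-1 : ℂ) ^ (p : ℕ)) * (-1) ^ (p : ℕ) = 1 := by rw [← mul_pow]; simp
  simp only [e3, iteratedDeriv_const_mul_field]
  linear_combination (-(c j p * h j u *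
    iteratedDeriv p (fun t : ℝ => (t : ℂ) ^ (k + (p : ℕ)) * ψ t) u)) * e4

/-! ### Existence of the canonical integral -/

lemma hasCompactSupport_of_eventually_cobounded {c : ℝ → ℂ} (h : ∀ᶠ x in cobounded ℝ, c x = 0) :
    HasCompactSupport c := by
  rw [hasCompactSupport_iff_eventuallyEq, coclosedCompact_eq_cocompact,
    ← Metric.cobounded_eq_cocompact]
  exact h

/-- The part `G(x) φ(1/x)` near infinity is handled by `σ`, defined as its regularized transform.
The rest has compact support, where the regularized transform is the ordinary one, and additivity
puts the two together. -/
theorem IsSymbol.hasCanonicalIntegral {a : ℝ} {G : ℝ → ℂ} (hG : IsSymbol a G) (h0 : G 0 = 0)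
    {y : ℝ} (hy : y ≠ 0) {N : ℕ} (hN : a + 1 < N) :
    HasCanonicalIntegral (fun x => G x * ey y x) (regFourier N G y) := by
  -- Independence of `N` allows it to be enlarged until `σ` is continuous on test functions.
  obtain ⟨M, hM⟩ := exists_nat_ge (a + 2)
  rw [← hG.regFourier_eq hN (le_max_left N M) hy]
  have hM' : a + 2 ≤ (max N M : ℕ) := hM.trans (by exact_mod_cast le_max_right N M)
  clear hN hM
  generalize max N M = N at hM'
  obtain ⟨σ, hσ⟩ := hG.exists_distribution y hM'
  have hinv : ContinuousOn (fun u : ℝ => 1 / u) {0}ᶜ := by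
    simpa only [one_div] using continuousOn_inv₀
  refine ⟨σ, ⟨locallyIntegrableOn_compl ?_, fun φ hφ => ?_, fun k => ?_⟩, fun φ hφ => ?_⟩
  · refine ContinuousOn.mul ?_ ((hG.smooth.continuous.mul (continuous_ey y)).comp_continuousOn hinv)
    exact (Complex.continuous_ofReal.pow 2).continuousOn.inv₀ fun u hu =>
      pow_ne_zero 2 (by exact_mod_cast hu)
  · have hφ0 : ∀ᶠ u in 𝓝 (0 : ℝ), φ u = 0 := notMem_tsupport_iff_eventuallyEq.1 hφ
    have hc : SmoothCompact fun x => G x * ((φ x⁻¹ : ℝ) : ℂ) :=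
      ⟨contDiff_mul_comp_inv hG.smooth h0 (smoothCompact_testFunction φ),
        hasCompactSupport_of_eventually_cobounded (by
          filter_upwards [(tendsto_inv₀_cobounded (α := ℝ)).eventually hφ0] with x hx
          simp [hx])⟩
    rw [hσ, hc.regFourier_eq N hy, integral_comp_inv]
    refine integral_congr_ae (Eventually.of_forall fun u => ?_)
    simp only [inv_inv, one_div]
    ring
  -- The same `σ` may be computed with as many derivatives as order `k` demands.
  · obtain ⟨P, hP⟩ := exists_nat_ge (k + a + 2)
    obtain ⟨H, hc, hb, hH⟩ := hG.exists_regFourier_mul_comp_inv_eq y (k := k) (N := max N P)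
      (hP.trans (by exact_mod_cast le_max_right N P))
    refine vanishesToOrder_of_eq_sum (M := max N P + 1) hc hb fun φ => ?_
    have hφ := smoothCompact_testFunction φ
    rw [hσ, ← hH _ hφ,
      (hG.mul_comp_inv h0 hφ).regFourier_eq (by linarith) (le_max_left N P) hy]
  · have hψ := smoothCompact_testFunction φ
    have hR : SmoothCompact fun x => (1 - ((φ (1 / x) : ℝ) : ℂ)) * G x := by
      refine ⟨?_, hasCompactSupport_of_eventually_cobounded ?_⟩
      · have := hG.smooth.sub (contDiff_mul_comp_inv hG.smooth h0 hψ)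
        refine (funext fun x => ?_ : (fun x => _) = _) ▸ this
        simp only [one_div]
        ring
      · filter_upwards [(tendsto_inv₀_cobounded (α := ℝ)).eventually hφ] with x hx
        simp [hx]
    have e : (fun x => (1 - ((φ (1 / x) : ℝ) : ℂ)) * (G x * ey y x)) =
        fun x => ey y x * ((1 - ((φ (1 / x) : ℝ) : ℂ)) * G x) := by
      ext x; ring
    simp only [e]
    refine ⟨integrable_ey_mul hR.integrable y, ?_⟩
    rw [hσ, ← hR.regFourier_eq N hy,
      ← regFourier_add (hG.mul_comp_inv h0 hψ) (hR.isSymbol a) (by linarith)]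
    congr 1
    ext x
    simp only [one_div]
    ring

/-! ### Uniqueness of the canonical extension -/

/-- The test function `x ↦ χ(s x)`, with `χ` equal to `1` near `0`. -/
noncomputable def scaledCutoff (s : ℝ) (hs : s ≠ 0) : 𝓣 where
  toFun x := (⟨1, 2, one_pos, one_lt_two⟩ : ContDiffBump (0 : ℝ)) (s * x)
  contDiff' := (ContDiffBump.contDiff _).comp (contDiff_const.mul contDiff_id)
  hasCompactSupport' := (ContDiffBump.hasCompactSupport _).comp_homeomorph (Homeomorph.mulLeft₀ s hs)
  tsupport_subset' := by simp

lemma ofReal_scaledCutoff (s : ℝ) (hs : s ≠ 0) (x : ℝ) :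
    ((scaledCutoff s hs x : ℝ) : ℂ) = cutoff (s * x) := rfl

lemma scaledCutoff_eventually_eq_one (s : ℝ) (hs : s ≠ 0) :
    ∀ᶠ x in 𝓝 0, scaledCutoff s hs x = 1 := by
  have h : Tendsto (fun x : ℝ => |s * x|) (𝓝 0) (𝓝 0) := by
    have : Continuous fun x : ℝ => |s * x| := by fun_prop
    simpa using this.tendsto 0
  filter_upwards [h.eventually (eventually_le_nhds one_pos)] with x hx
  have := cutoff_eq_one hx
  rw [← ofReal_scaledCutoff s hs] at this
  exact_mod_cast this

lemma cutoff_eq_zero {x : ℝ} (hx : 2 ≤ |x|) : cutoff x = 0 := by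
  rw [cutoff, ContDiffBump.zero_of_le_dist]
  · simp
  · simpa using hx

lemma tsupport_scaledCutoff_subset {s : ℝ} (hs : 0 < s) {r : ℝ} (hr : 2 < r * s) :
    tsupport (scaledCutoff s hs.ne') ⊆ Set.Ioo (-r) r := by
  have h1 : tsupport (scaledCutoff s hs.ne') ⊆ {x | |x| * s ≤ 2} := by
    refine closure_minimal (fun x hx => ?_) (isClosed_le (by fun_prop) continuous_const)
    by_contra h
    refine hx ?_
    have := cutoff_eq_zero (x := s * x) (by
      rw [abs_mul, abs_of_pos hs, mul_comm]; exact (not_le.1 h).le)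
    rw [← ofReal_scaledCutoff s hs.ne'] at this
    exact_mod_cast this
  intro x hx
  exact abs_lt.1 (lt_of_mul_lt_mul_right ((h1 hx).trans_lt hr) hs.le)

/-- Scale invariance: `t^n cutoff(st) = s^(-n) Φ(st)` with `Φ(t) = t^n cutoff t`, and `n`
derivatives cost at most `s^n`. -/
lemma exists_norm_iteratedDeriv_scaled_le {B : ℝ → ℂ} (hB : SmoothCompact B) (n : ℕ) :
    ∃ C : ℝ, ∀ s : ℝ, 1 ≤ s → ∀ x : ℝ,
      ‖iteratedDeriv n (fun t : ℝ => (t : ℂ) ^ n * B t * cutoff (s * t)) x‖ ≤ C := by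
  have hΦ : ContDiff ℝ ∞ fun t : ℝ => (t : ℂ) ^ n * cutoff t :=
    (contDiff_ofReal.pow n).mul contDiff_cutoff
  choose C₁ hC₁ hb₁ using fun k => exists_bound_iteratedDeriv hB.smooth hB.supp k
  choose C₂ hC₂ hb₂ using fun k =>
    exists_bound_iteratedDeriv hΦ hasCompactSupport_cutoff.mul_left k
  refine ⟨∑ i ∈ Finset.range (n + 1), n.choose i * C₁ i * C₂ (n - i), fun s hs x => ?_⟩
  have hs0 : 0 < s := by linarith
  have hs' : (s : ℂ) ≠ 0 := by exact_mod_cast hs0.ne'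
  have e : (fun t : ℝ => (t : ℂ) ^ n * B t * cutoff (s * t)) =
      fun t => B t * (((s : ℂ) ^ n)⁻¹ * (fun t : ℝ => (t : ℂ) ^ n * cutoff t) (s * t)) := by
    ext t
    push_cast
    rw [mul_pow]
    field_simp
  have hΦs : ContDiff ℝ ∞ fun t : ℝ => (fun t : ℝ => (t : ℂ) ^ n * cutoff t) (s * t) :=
    hΦ.comp (contDiff_const.mul contDiff_id)
  rw [e, iteratedDeriv_fun_mul (contDiffAt_nat hB.smooth.contDiffAt n)
    (contDiffAt_nat (contDiff_const.mul hΦs).contDiffAt n)]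
  refine (norm_sum_le _ _).trans (Finset.sum_le_sum fun i hi => ?_)
  rw [iteratedDeriv_const_mul_field, iteratedDeriv_comp_const_smul (contDiff_infty.1 hΦ _)]
  simp only [norm_mul, norm_smul, norm_inv, norm_pow, Complex.norm_real, Complex.norm_natCast,
    Real.norm_of_nonneg hs0.le]
  have h1 : (s ^ n)⁻¹ * s ^ (n - i) ≤ 1 := by
    rw [inv_mul_le_iff₀ (by positivity), mul_one]
    exact pow_le_pow_right₀ hs (Nat.sub_le n i)
  have h2 : (s ^ n)⁻¹ * (s ^ (n - i) *
      ‖iteratedDeriv (n - i) (fun t : ℝ => (t : ℂ) ^ n * cutoff t) (s * x)‖) ≤ C₂ (n - i) := by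
    rw [← mul_assoc]
    exact (mul_le_mul h1 (hb₂ _ _) (norm_nonneg _) zero_le_one).trans_eq (one_mul _)
  gcongr
  · exact mul_nonneg (Nat.cast_nonneg _) (hC₁ i)
  · exact hb₁ i x

/-- The integrands are dominated by a multiple of `|h|`, and at each `x ≠ 0` they are eventually
zero because the supports shrink to `0`. Order `0` already excludes distributions supported at `0`
such as the delta function. -/
lemma tendsto_scaledCutoff_of_vanishesToOrder {σ : 𝓓'((⊤ : TopologicalSpace.Opens ℝ), ℂ)}
    (h : VanishesToOrder 0 σ) :
    Tendsto (fun m : ℕ => σ (scaledCutoff (m + 1) (by positivity))) atTop (𝓝 0) := by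
  obtain ⟨ε, hε, N, n, b, h, hb, hh, hσ⟩ := h
  -- The coefficients are smooth only on `(-ε, ε)`; they are replaced by compactly supported ones
  -- that agree near `0`, where the shrinking cutoffs live.
  choose B hB hBb using fun l => exists_smoothCompact_eventuallyEq hε (hb l)
  obtain ⟨r, hr, hrB⟩ := Metric.eventually_nhds_iff.1 (eventually_all.2 hBb)
  have hlarge (δ : ℝ) (hδ : 0 < δ) : ∀ᶠ m : ℕ in atTop, 2 < δ * (m + 1) := by
    have : Tendsto (fun m : ℕ => δ * (m + 1 : ℝ)) atTop atTop :=
      (tendsto_atTop_add_const_right _ 1 tendsto_natCast_atTop_atTop).const_mul_atTop hδ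
    exact this.eventually_gt_atTop 2
  have hterm (l : Fin N) : Tendsto (fun m : ℕ => (-1 : ℂ) ^ n l * ∫ x in Set.Ioo (-ε) ε, h l x *
      iteratedDeriv (n l) (fun t : ℝ => (t : ℂ) ^ n l * B l t * cutoff ((m + 1) * t)) x)
      atTop (𝓝 0) := by
    obtain ⟨C, hC⟩ := exists_norm_iteratedDeriv_scaled_le (hB l) (n l)
    rw [← mul_zero ((-1 : ℂ) ^ n l)]
    refine Tendsto.const_mul _ ?_
    rw [← integral_zero ℝ ℂ (μ := volume.restrict (Set.Ioo (-ε) ε))]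
    have hsm (m : ℕ) : ContDiff ℝ ∞ fun t : ℝ => (t : ℂ) ^ n l * B l t * cutoff ((m + 1) * t) :=
      ((contDiff_ofReal.pow _).mul (hB l).smooth).mul
        (contDiff_cutoff.comp (contDiff_const.mul contDiff_id))
    refine tendsto_integral_of_dominated_convergence (fun x => ‖h l x‖ * C) (fun m => ?_) ?_
      (fun m => Eventually.of_forall fun x => ?_) ?_
    · exact (hh l).1.mul (contDiff_iteratedDeriv (hsm m) _).continuous.aestronglyMeasurable
    · exact ((hh l).integrable le_top).norm.mul_const C
    · rw [norm_mul]
      exact mul_le_mul_of_nonneg_left (hC _ (by simp) x) (norm_nonneg _)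
    · have hne : ∀ᵐ u : ℝ, u ≠ 0 := by simp [ae_iff]
      filter_upwards [ae_restrict_of_ae hne] with x hx
      refine tendsto_const_nhds.congr' ?_
      filter_upwards [hlarge (|x| / 2) (by positivity)] with m hm
      have hz : (fun t : ℝ => (t : ℂ) ^ n l * B l t * cutoff ((m + 1) * t)) =ᶠ[𝓝 x] fun _ => 0 := by
        have : ∀ᶠ t in 𝓝 x, |x| / 2 < |t| :=
          (continuous_abs.tendsto x).eventually (lt_mem_nhds (half_lt_self (abs_pos.2 hx)))
        filter_upwards [this] with t ht
        rw [cutoff_eq_zero, mul_zero]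
        rw [abs_mul, abs_of_pos (by positivity : (0 : ℝ) < m + 1)]
        nlinarith [(Nat.cast_nonneg m : (0 : ℝ) ≤ m)]
      rw [hz.iteratedDeriv_eq]
      simp
  have hsum := tendsto_finsetSum Finset.univ fun l _ => hterm l
  rw [Finset.sum_const_zero] at hsum
  refine hsum.congr' ?_
  filter_upwards [hlarge ε hε, hlarge r hr] with m hm hmr
  have hpos : (0 : ℝ) < m + 1 := by positivity
  rw [hσ _ (tsupport_scaledCutoff_subset hpos hm)]
  refine Finset.sum_congr rfl fun l _ => ?_
  have e : (fun t : ℝ => (t : ℂ) ^ (0 + n l) * b l t *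
      ((scaledCutoff (m + 1) hpos.ne' t : ℝ) : ℂ)) =
      fun t : ℝ => (t : ℂ) ^ n l * B l t * cutoff ((m + 1) * t) := by
    ext t
    rw [zero_add, ofReal_scaledCutoff]
    by_cases ht : |t| < r
    · rw [hrB (by simpa using ht) l]
    · rw [cutoff_eq_zero, mul_zero, mul_zero]
      rw [abs_mul, abs_of_pos hpos]
      nlinarith [not_lt.1 ht]
  rw [e]
  congr 1
  refine setIntegral_eq_integral_of_forall_compl_eq_zero fun x hx => ?_
  rw [← e]
  have hx' : x ∉ tsupport (fun t : ℝ => (t : ℂ) ^ (0 + n l) * b l t *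
      ((scaledCutoff (m + 1) hpos.ne' t : ℝ) : ℂ)) := fun h' =>
    hx (tsupport_scaledCutoff_subset hpos hm
      (closure_mono (fun t ht => by
        have := right_ne_zero_of_mul ht
        simpa using this) h'))
  rw [image_eq_zero_of_notMem_tsupport fun h' => hx' (tsupport_iteratedDeriv_subset _ _ h'),
    mul_zero]

/-- The difference of two cutoffs is supported away from `0`, where both extensions are given by
`F`; so the discrepancy is the same at every scale and tends to `0`. -/
lemma IsCanonicalExtension.scaledCutoff_eq {F : ℝ → ℂ}
    {σ τ : 𝓓'((⊤ : TopologicalSpace.Opens ℝ), ℂ)} (hσ : IsCanonicalExtension F σ)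
    (hτ : IsCanonicalExtension F τ) :
    σ (scaledCutoff 1 one_ne_zero) = τ (scaledCutoff 1 one_ne_zero) := by
  have h1 (m : ℕ) : σ (scaledCutoff 1 one_ne_zero) - τ (scaledCutoff 1 one_ne_zero) =
      σ (scaledCutoff (m + 1) (by positivity)) - τ (scaledCutoff (m + 1) (by positivity)) := by
    have hm : (m + 1 : ℝ) ≠ 0 := by positivity
    have h0 : (0 : ℝ) ∉ tsupport (scaledCutoff 1 one_ne_zero - scaledCutoff (m + 1) hm : 𝓣) := by
      rw [notMem_tsupport_iff_eventuallyEq]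
      filter_upwards [scaledCutoff_eventually_eq_one 1 one_ne_zero,
        scaledCutoff_eventually_eq_one (m + 1) hm] with x hx hx'
      simp [hx, hx']
    have h2 := (hσ.2.1 _ h0).trans (hτ.2.1 _ h0).symm
    rw [map_sub, map_sub] at h2
    linear_combination h2
  have h2 := (tendsto_scaledCutoff_of_vanishesToOrder (hσ.2.2 0)).sub
    (tendsto_scaledCutoff_of_vanishesToOrder (hτ.2.2 0))
  rw [sub_zero] at h2
  exact sub_eq_zero.1 (tendsto_nhds_unique (tendsto_const_nhds.congr h1) h2)

lemma HasCanonicalIntegral.unique {G : ℝ → ℂ} {c d : ℂ} (hc : HasCanonicalIntegral G c)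
    (hd : HasCanonicalIntegral G d) : c = d := by
  obtain ⟨σ, hσ, hc⟩ := hc
  obtain ⟨τ, hτ, hd⟩ := hd
  have h1 := scaledCutoff_eventually_eq_one 1 one_ne_zero
  rw [(hc _ h1).2, (hd _ h1).2, hσ.scaledCutoff_eq hτ]

/-! ### The operators -/

/-- The value at `0` is irrelevant: `(0²)⁻¹ = 0` on the one side, and `1 - φ(1/0) = 1 - φ 0 = 0` on
the other. -/
lemma HasCanonicalIntegral.congr {F G : ℝ → ℂ} {c : ℂ} (h : HasCanonicalIntegral F c)
    (hFG : ∀ x ≠ 0, F x = G x) : HasCanonicalIntegral G c := by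
  obtain ⟨σ, hσ, hc⟩ := h
  have e : (fun u : ℝ => ((u : ℂ) ^ 2)⁻¹ * F (1 / u)) =
      fun u : ℝ => ((u : ℂ) ^ 2)⁻¹ * G (1 / u) := by
    ext u
    rcases eq_or_ne u 0 with rfl | hu
    · simp
    · rw [hFG _ (one_div_ne_zero hu)]
  refine ⟨σ, e ▸ hσ, fun φ hφ => ?_⟩
  have e' : (fun x : ℝ => (1 - ((φ (1 / x) : ℝ) : ℂ)) * F x) =
      fun x => (1 - ((φ (1 / x) : ℝ) : ℂ)) * G x := by
    ext x
    rcases eq_or_ne x 0 with rfl | hx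
    · simp [hφ.self_of_nhds]
    · rw [hFG x hx]
  rw [← e']
  exact hc φ hφ

lemma Kf_mul_ey_eq_integrand (α : ℂ) (η : ZMod 2) (f : ℝ → ℂ) (y : ℝ) {x : ℝ} (hx : x ≠ 0) :
    Kf (α + 1) η 0 f x * ey y x = integrand α η f y x := by
  rw [Kf, pw_of_ne _ _ _ hx, integrand, ey, one_div, neg_add', pow_zero]
  ring

lemma IsSymbol.hasCanonicalIntegral_integrand {α : ℂ} {η : ZMod 2} {f : ℝ → ℂ} {a : ℝ}
    (h : IsSymbol a (Kf (α + 1) η 0 f)) {y : ℝ} (hy : y ≠ 0) {N : ℕ} (hN : a + 1 < N) :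
    HasCanonicalIntegral (integrand α η f y) (regFourier N (Kf (α + 1) η 0 f) y) :=
  (h.hasCanonicalIntegral (Kf_zero _ _ _ _) hy hN).congr fun _ hx =>
    Kf_mul_ey_eq_integrand α η f y hx

end Sis

/-- For all `α ∈ ℂ` and `η ∈ ℤ/2ℤ`, `T_{α,η}` is well defined on `S_sis(ℝ)` (the integral which
defines `T_{α,η} f (y)` has one and only one value, for every `y ≠ 0`) and maps it to itself. -/
theorem mainTheorem7 (α : ℂ) (η : ZMod 2) :
    (∀ f ∈ Sis.Ssis, ∀ y : ℝ, y ≠ 0 →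
      ∃! c : ℂ, Sis.HasCanonicalIntegral (Sis.integrand α η f y) c) ∧
    Set.MapsTo (Sis.T α η) Sis.Ssis Sis.Ssis := by
  constructor
  · intro f hf y hy
    obtain ⟨a, ha⟩ := Sis.exists_isTame_Kf_of_mem_Ssis hf (α + 1) η
    obtain ⟨N, hN⟩ := exists_nat_gt (a + 1)
    have h := ha.toIsSymbol.hasCanonicalIntegral_integrand hy hN
    exact ⟨_, h, fun c hc => hc.unique h⟩
  · intro f hf
    obtain ⟨a, ha⟩ := Sis.exists_isTame_Kf_of_mem_Ssis hf (α + 1) η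
    refine ha.mem_Ssis fun N hN y hy => ?_
    have h := ha.toIsSymbol.hasCanonicalIntegral_integrand hy hN
    -- The chosen value is a canonical integral, since one exists; uniqueness identifies it with the
    -- regularized transform for every admissible `N`.
    exact (Classical.epsilon_spec (p := Sis.HasCanonicalIntegral (Sis.integrand α η f y))
      ⟨_, h⟩).unique h
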